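/- Write $v(p)=p/\sqrt{1+|p|^2}$ for $p\in\mathbb R^3$. A classical solution of the Vlasov–Darwin system on $[0,T[$, $T>0$, consists of functions $f:[0,T[\times\mathbb R^3\times\mathbb R^3\to\mathbb R$ and $E_L,E_T,B:[0,T[\times\mathbb R^3\to\mathbb R^3$ such that $f$, $E_L$, $B$ are of class $C^1$, $E_T$ and $\nabla_xE_T$ exist and are continuous, $f(t,\cdot,\cdot)$ has compact support and $E_L(t,x),E_T(t,x),B(t,x)\to 0$ as $|x|\to\infty$ for every $t\in[0,T[$, and $$\partial_tf+v(p)\cdot\nabla_xf+(E_L+E_T+v(p)\times B)\cdot\nabla_pf=0,$$ $$\nabla\times E_L=0,\quad \nabla\cdot E_T=0,\quad \partial_tE_L-\nabla\times B=-j,\quad \nabla\cdot E_L=\rho,\quad \partial_tB+\nabla\times E_T=0,\quad \nabla\cdot B=0,$$ where $\rho(t,x)=\int f(t,x,p)\,dp$ and $j(t,x)=\int f(t,x,p)\,v(p)\,dp$. For $R_0,P_0>0$ let $\mathcal D$ be the set of all $g\in C^2_c(\mathbb R^3\times\mathbb R^3)$ with $g\ge 0$, $\|g\|_\infty\le 1$,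 $\|\nabla g\|_\infty\le 1$ and $\operatorname{supp} g\subset B_{R_0}(0)\times B_{P_0}(0)$, where $B_r(0)$ is the open ball in $\mathbb R^3$. For a function $F$ on $\mathbb R^3$ let $\|F\|_\infty=\sup_x|F(x)|$. The solution is said to satisfy the free streaming condition with parameter $\alpha$ on $[0,a]$, where $a<T$, if for all $t\in[0,a]$ $$\|E_T(t)\|_\infty+\|E_L(t)\|_\infty+\|B(t)\|_\infty\le\alpha(1+t)^{-3/2},$$ $$\|\nabla E_T(t)\|_\infty+\|\nabla E_L(t)\|_\infty+\|\nabla B(t)\|_\infty\le\alpha(1+t)^{-5/2}.$$ **Proposition.** For all $R_0,P_0>0$ there exist constants $\alpha>0$ and $C_2>0$, depending only on $R_0$ and $P_0$, such that for every $T>0$, every classical solution $(f,E_L,E_T,B)$ of the Vlasov–Darwin system on $[0,T[$ with $f(0)\in\mathcal D$, and every $a<T$ such that the solution satisfies the free streaming condition with parameter $\alpha$ on $[0,a]$, one has for all $t\in[1,a]$ $$\|E_T(t)\|_\infty+\|E_L(t)\|_\infty+\|B(t)\|_\infty\le C_2\,t^{-9/5},$$ $$\|\nabla E_T(t)\|_\infty+\|\nabla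 E_L(t)\|_\infty+\|\nabla B(t)\|_\infty\le C_2\,t^{-8/3}.$$ -/

import Mathlib

open MeasureTheory Set Filter Topology
open scoped ENNReal

noncomputable section

namespace VlasovDarwin

/-- Euclidean three-space. -/
abbrev E3 : Type := EuclideanSpace ℝ (Fin 3)

/-- The cross product `u × w` on Euclidean three-space. -/
def cross (u w : E3) : E3 :=
  WithLp.toLp 2 (crossProduct (WithLp.ofLp u) (WithLp.ofLp w))

/-- The partial derivative `∂ᵢ Fⱼ (x)` of a vector field. -/
def partialD (F : E3 → E3) (i j : Fin 3) (x : E3) : ℝ :=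
  (fderiv ℝ F x (EuclideanSpace.single i 1)) j

/-- The divergence `∇ · F`. -/
def divergence (F : E3 → E3) (x : E3) : ℝ :=
  ∑ i : Fin 3, partialD F i i x

/-- The rotation `∇ × F`. -/
def curl (F : E3 → E3) (x : E3) : E3 :=
  !₂[partialD F 1 2 x - partialD F 2 1 x,
     partialD F 2 0 x - partialD F 0 2 x,
     partialD F 0 1 x - partialD F 1 0 x]

/-- The relativistic velocity `v(p) = p / √(1 + |p|²)`. -/
def velocity (p : E3) : E3 :=
  (Real.sqrt (1 + ‖p‖ ^ 2))⁻¹ • p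

/-- The charge density `ρ(t,x) = ∫ f(t,x,p) dp`. -/
def chargeDensity (f : ℝ → E3 → E3 → ℝ) (t : ℝ) (x : E3) : ℝ :=
  ∫ p : E3, f t x p

/-- The current density `j(t,x) = ∫ f(t,x,p) v(p) dp`. -/
def currentDensity (f : ℝ → E3 → E3 → ℝ) (t : ℝ) (x : E3) : E3 :=
  ∫ p : E3, f t x p • velocity p

/-- The force `K(t,x,p) = E_L + E_T + v(p) × B`. -/
def force (EL ET B : ℝ → E3 → E3) (t : ℝ) (x p : E3) : E3 :=
  EL t x + ET t x + cross (velocity p) (B t x)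

/-- `(f, E_L, E_T, B)` is a classical solution of the Vlasov-Darwin system on `[0,T[`.
Time derivatives are derivatives within `[0,T[`, hence one-sided at `t = 0`. -/
structure IsClassicalSolution (T : ℝ) (f : ℝ → E3 → E3 → ℝ) (EL ET B : ℝ → E3 → E3) :
    Prop where
  /-- `f` is of class `C¹` on `[0,T[ × ℝ³ × ℝ³`. -/
  contDiffOn_f : ContDiffOn ℝ 1 (fun z : ℝ × E3 × E3 => f z.1 z.2.1 z.2.2)
    (Ico 0 T ×ˢ (univ : Set (E3 × E3)))
  /-- `f(t)` has compact support. -/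
  compact_f : ∀ t ∈ Ico 0 T, HasCompactSupport (fun z : E3 × E3 => f t z.1 z.2)
  /-- `E_L` is of class `C¹` on `[0,T[ × ℝ³`. -/
  contDiffOn_EL : ContDiffOn ℝ 1 (fun z : ℝ × E3 => EL z.1 z.2) (Ico 0 T ×ˢ (univ : Set E3))
  /-- `B` is of class `C¹` on `[0,T[ × ℝ³`. -/
  contDiffOn_B : ContDiffOn ℝ 1 (fun z : ℝ × E3 => B z.1 z.2) (Ico 0 T ×ˢ (univ : Set E3))
  /-- `E_T` is continuous on `[0,T[ × ℝ³`. -/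
  continuousOn_ET : ContinuousOn (fun z : ℝ × E3 => ET z.1 z.2) (Ico 0 T ×ˢ (univ : Set E3))
  /-- `E_T` is differentiable in `x`. -/
  differentiable_ET : ∀ t ∈ Ico 0 T, Differentiable ℝ (ET t)
  /-- `∇ₓ E_T` is continuous on `[0,T[ × ℝ³`. -/
  continuousOn_fderiv_ET : ContinuousOn (fun z : ℝ × E3 => fderiv ℝ (ET z.1) z.2)
    (Ico 0 T ×ˢ (univ : Set E3))
  /-- `∂ₜ f + v(p) · ∇ₓ f + K · ∇ₚ f = 0`. -/
  vlasov : ∀ t ∈ Ico 0 T, ∀ x p : E3,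
    derivWithin (fun s => f s x p) (Ico 0 T) t
      + inner ℝ (velocity p) (gradient (fun y => f t y p) x)
      + inner ℝ (force EL ET B t x p) (gradient (fun q => f t x q) p) = 0
  /-- `∇ × E_L = 0`. -/
  curl_EL : ∀ t ∈ Ico 0 T, ∀ x : E3, curl (EL t) x = 0
  /-- `∇ · E_T = 0`. -/
  div_ET : ∀ t ∈ Ico 0 T, ∀ x : E3, divergence (ET t) x = 0
  /-- `∂ₜ E_L - ∇ × B = -j`. -/
  ampere : ∀ t ∈ Ico 0 T, ∀ x : E3,
    derivWithin (fun s => EL s x) (Ico 0 T) t - curl (B t) x = -currentDensity f t x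
  /-- `∇ · E_L = ρ`. -/
  gauss : ∀ t ∈ Ico 0 T, ∀ x : E3, divergence (EL t) x = chargeDensity f t x
  /-- `∂ₜ B + ∇ × E_T = 0`. -/
  faraday : ∀ t ∈ Ico 0 T, ∀ x : E3,
    derivWithin (fun s => B s x) (Ico 0 T) t + curl (ET t) x = 0
  /-- `∇ · B = 0`. -/
  div_B : ∀ t ∈ Ico 0 T, ∀ x : E3, divergence (B t) x = 0
  /-- `E_L` vanishes at spatial infinity. -/
  EL_infty : ∀ t ∈ Ico 0 T, Tendsto (EL t) (cocompact E3) (𝓝 0)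
  /-- `E_T` vanishes at spatial infinity. -/
  ET_infty : ∀ t ∈ Ico 0 T, Tendsto (ET t) (cocompact E3) (𝓝 0)
  /-- `B` vanishes at spatial infinity. -/
  B_infty : ∀ t ∈ Ico 0 T, Tendsto (B t) (cocompact E3) (𝓝 0)

/-- The set `𝒟` of initial data: nonnegative `C²` functions `g` on `ℝ³ × ℝ³` with support in
`B_{R₀} × B_{P₀}`, `‖g‖_∞ ≤ 1` and `‖∇g‖_∞ ≤ 1`, where `|∇g|² = |∇ₓ g|² + |∇ₚ g|²`. -/
structure InitialData (R₀ P₀ : ℝ) (g : E3 → E3 → ℝ) : Prop where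
  contDiff : ContDiff ℝ 2 (fun z : E3 × E3 => g z.1 z.2)
  hasCompactSupport : HasCompactSupport (fun z : E3 × E3 => g z.1 z.2)
  nonneg : ∀ x p, 0 ≤ g x p
  le_one : ∀ x p, |g x p| ≤ 1
  gradient_le_one : ∀ x p,
    Real.sqrt (‖gradient (fun y => g y p) x‖ ^ 2 + ‖gradient (fun q => g x q) p‖ ^ 2) ≤ 1
  support : tsupport (fun z : E3 × E3 => g z.1 z.2) ⊆ Metric.ball 0 R₀ ×ˢ Metric.ball 0 P₀

/-- The norm `‖F‖_∞ = sup_x |F(x)|`, with values in `[0,∞]`. -/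
def supNorm {V : Type} [NormedAddCommGroup V] (F : E3 → V) : ℝ≥0∞ :=
  ⨆ x : E3, ‖F x‖ₑ

/-- `‖E_T(t)‖_∞ + ‖E_L(t)‖_∞ + ‖B(t)‖_∞`. -/
def fieldNorm (EL ET B : ℝ → E3 → E3) (t : ℝ) : ℝ≥0∞ :=
  supNorm (ET t) + supNorm (EL t) + supNorm (B t)

/-- `‖∇E_T(t)‖_∞ + ‖∇E_L(t)‖_∞ + ‖∇B(t)‖_∞`, with the operator norm of the Jacobian. -/
def gradFieldNorm (EL ET B : ℝ → E3 → E3) (t : ℝ) : ℝ≥0∞ :=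
  supNorm (fderiv ℝ (ET t)) + supNorm (fderiv ℝ (EL t)) + supNorm (fderiv ℝ (B t))

/-- The free streaming condition with parameter `α` on `[0,a]`. -/
def FreeStreaming (α a : ℝ) (EL ET B : ℝ → E3 → E3) : Prop :=
  ∀ t ∈ Icc 0 a,
    fieldNorm EL ET B t ≤ ENNReal.ofReal (α * (1 + t) ^ (-(3 / 2) : ℝ)) ∧
    gradFieldNorm EL ET B t ≤ ENNReal.ofReal (α * (1 + t) ^ (-(5 / 2) : ℝ))

end VlasovDarwin

end

/-!
The fundamental solution of `Δ²` on `ℝ³` is `-|y| / 8π`, so a field `F` that vanishes at infinity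
is recovered from its integrals against `Δ² k`, where `k` is the difference of two rescaled copies
of a mollified `|y|`. The div-curl system turns these integrals into moments of `f` against third
derivatives of `k`, which decay like `|y|⁻²`; for `E_T` the source contains `∂ₜ j`, and the Vlasov
equation trades the time derivative for one more derivative of `k`, or for the force and one
derivative less.

Under the free streaming condition characteristics disperse: particles that meet at time `t` have
momenta within `O(1/t)` of each other. Hence momentum integrals of `f` and of `∇ₓ f` at a fixed
position are `O(t⁻³)`, with `∇ₓ f` bounded because neighbouring characteristics stay together when
traced back to time `0`. Integrating `|y|⁻²` over a ball of radius `O(t)` then gives decay at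
rate `t⁻²`, and the force contributes `t^(-3/2)`, in place of the derivative of `k`. For the
gradients one more derivative falls on `k` at distances larger than `1`, and on `f` at distances
smaller than `1`.
-/

noncomputable section

namespace VlasovDarwin

open scoped ContDiff Laplacian

/-- The Lorentz factor `√(1 + |p|²)`, the denominator of the relativistic velocity. -/
def lorentz (p : E3) : ℝ := Real.sqrt (1 + ‖p‖ ^ 2)

lemma lorentz_sq (p : E3) : lorentz p ^ 2 = 1 + ‖p‖ ^ 2 :=
  Real.sq_sqrt (by positivity)

lemma norm_sq_eq_lorentz_sq_sub_one (p : E3) : ‖p‖ ^ 2 = lorentz p ^ 2 - 1 :=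
  eq_sub_of_add_eq' (lorentz_sq p).symm

lemma lorentz_pos (p : E3) : 0 < lorentz p := Real.sqrt_pos.2 (by positivity)

lemma one_le_lorentz (p : E3) : 1 ≤ lorentz p :=
  Real.one_le_sqrt.2 (le_add_of_nonneg_right (sq_nonneg _))

lemma velocity_eq (p : E3) : velocity p = (lorentz p)⁻¹ • p := rfl

lemma norm_velocity_le_one (p : E3) : ‖velocity p‖ ≤ 1 := by
  rw [velocity_eq, norm_smul, Real.norm_of_nonneg (inv_nonneg.2 (lorentz_pos p).le),
    inv_mul_le_iff₀ (lorentz_pos p), mul_one]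
  exact Real.le_sqrt_of_sq_le (by linarith)

lemma norm_velocity_sub_sq (p q : E3) :
    ‖velocity p - velocity q‖ ^ 2 = (lorentz p * lorentz q)⁻¹ * ‖p - q‖ ^ 2
      - (lorentz p - lorentz q) ^ 2 * (lorentz p * lorentz q)⁻¹
        * (1 + (lorentz p * lorentz q)⁻¹) := by
  have hp := (lorentz_pos p).ne'
  have hq := (lorentz_pos q).ne'
  rw [velocity_eq, velocity_eq, norm_sub_sq_real, norm_sub_sq_real, norm_smul, norm_smul,
    inner_smul_left, inner_smul_right, mul_pow, mul_pow, norm_sq_eq_lorentz_sq_sub_one p,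
    norm_sq_eq_lorentz_sq_sub_one q, Real.norm_eq_abs, Real.norm_eq_abs, sq_abs, sq_abs]
  simp only [conj_trivial]
  field_simp
  ring

lemma norm_velocity_sub_le (p q : E3) : ‖velocity p - velocity q‖ ≤ ‖p - q‖ := by
  have hp := lorentz_pos p
  have hq := lorentz_pos q
  have hpq : (lorentz p * lorentz q)⁻¹ ≤ 1 :=
    inv_le_one_of_one_le₀ (one_le_mul_of_one_le_of_one_le (one_le_lorentz p) (one_le_lorentz q))
  refine le_of_sq_le_sq ?_ (norm_nonneg _)
  calc ‖velocity p - velocity q‖ ^ 2 ≤ (lorentz p * lorentz q)⁻¹ * ‖p - q‖ ^ 2 := by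
        rw [norm_velocity_sub_sq]
        exact sub_le_self _ (by positivity)
    _ ≤ ‖p - q‖ ^ 2 := mul_le_of_le_one_left (sq_nonneg _) hpq

/-- The modulus of strong monotonicity of the velocity on the ball of radius `R`. -/
def monoConst (R : ℝ) : ℝ := (Real.sqrt (1 + R ^ 2))⁻¹ * (1 + R ^ 2)⁻¹

lemma monoConst_pos (R : ℝ) : 0 < monoConst R := by
  unfold monoConst
  positivity

lemma inner_velocity_sub (p q : E3) :
    inner ℝ (velocity p - velocity q) (p - q)
      = ((lorentz p)⁻¹ + (lorentz q)⁻¹) / 2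
        * (‖p - q‖ ^ 2 - (lorentz p - lorentz q) ^ 2) := by
  have hp := (lorentz_pos p).ne'
  have hq := (lorentz_pos q).ne'
  rw [velocity_eq, velocity_eq, inner_sub_left, inner_sub_right, inner_sub_right,
    inner_smul_left, inner_smul_left, inner_smul_left, inner_smul_left,
    real_inner_self_eq_norm_sq, real_inner_self_eq_norm_sq, norm_sub_sq_real,
    real_inner_comm p q, norm_sq_eq_lorentz_sq_sub_one p, norm_sq_eq_lorentz_sq_sub_one q]
  simp only [conj_trivial]
  field_simp
  ring

lemma norm_mul_sqrt_le_mul_lorentz {R : ℝ} {p : E3} (hp : ‖p‖ ≤ R) :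
    ‖p‖ * Real.sqrt (1 + R ^ 2) ≤ R * lorentz p := by
  have hR : 0 ≤ R := (norm_nonneg _).trans hp
  refine le_of_sq_le_sq ?_ (mul_nonneg hR (lorentz_pos p).le)
  rw [mul_pow, mul_pow, Real.sq_sqrt (by positivity), lorentz_sq]
  nlinarith [pow_le_pow_left₀ (norm_nonneg p) hp 2]

lemma abs_lorentz_sub_mul_sqrt_le {R : ℝ} {p q : E3} (hp : ‖p‖ ≤ R) (hq : ‖q‖ ≤ R) :
    |lorentz p - lorentz q| * Real.sqrt (1 + R ^ 2) ≤ R * ‖p - q‖ := by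
  have hpos : 0 < lorentz p + lorentz q := add_pos (lorentz_pos p) (lorentz_pos q)
  have hfactor : |lorentz p - lorentz q| * (lorentz p + lorentz q)
      = |‖p‖ - ‖q‖| * (‖p‖ + ‖q‖) := by
    rw [← abs_of_pos hpos, ← abs_mul,
      ← abs_of_nonneg (add_nonneg (norm_nonneg p) (norm_nonneg q)), ← abs_mul]
    congr 1
    linear_combination lorentz_sq p - lorentz_sq q
  have hsum : (‖p‖ + ‖q‖) * Real.sqrt (1 + R ^ 2) ≤ R * (lorentz p + lorentz q) := by
    linarith [norm_mul_sqrt_le_mul_lorentz hp, norm_mul_sqrt_le_mul_lorentz hq]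
  refine le_of_mul_le_mul_right ?_ hpos
  calc |lorentz p - lorentz q| * Real.sqrt (1 + R ^ 2) * (lorentz p + lorentz q)
      = |‖p‖ - ‖q‖| * ((‖p‖ + ‖q‖) * Real.sqrt (1 + R ^ 2)) := by
        rw [mul_right_comm, hfactor, mul_assoc]
    _ ≤ ‖p - q‖ * (R * (lorentz p + lorentz q)) :=
        mul_le_mul (abs_norm_sub_norm_le p q) hsum (by positivity) (norm_nonneg _)
    _ = R * ‖p - q‖ * (lorentz p + lorentz q) := by ring

lemma inner_velocity_sub_ge {R : ℝ} {p q : E3} (hp : ‖p‖ ≤ R) (hq : ‖q‖ ≤ R) :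
    monoConst R * ‖p - q‖ ^ 2 ≤ inner ℝ (velocity p - velocity q) (p - q) := by
  have hsq : (lorentz p - lorentz q) ^ 2 * (1 + R ^ 2) ≤ R ^ 2 * ‖p - q‖ ^ 2 := by
    have := pow_le_pow_left₀ (by positivity) (abs_lorentz_sub_mul_sqrt_le hp hq) 2
    rwa [mul_pow, mul_pow, sq_abs, Real.sq_sqrt (by positivity)] at this
  have hdiff : ‖p - q‖ ^ 2 * (1 + R ^ 2)⁻¹ ≤ ‖p - q‖ ^ 2 - (lorentz p - lorentz q) ^ 2 := by
    rw [← div_eq_mul_inv, div_le_iff₀ (by positivity)]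
    linarith
  have hmean : (Real.sqrt (1 + R ^ 2))⁻¹ ≤ ((lorentz p)⁻¹ + (lorentz q)⁻¹) / 2 := by
    have hle : ∀ u : E3, ‖u‖ ≤ R → (Real.sqrt (1 + R ^ 2))⁻¹ ≤ (lorentz u)⁻¹ := fun u hu =>
      inv_anti₀ (lorentz_pos u) (Real.sqrt_le_sqrt (by gcongr))
    linarith [hle p hp, hle q hq]
  calc monoConst R * ‖p - q‖ ^ 2
      = (Real.sqrt (1 + R ^ 2))⁻¹ * (‖p - q‖ ^ 2 * (1 + R ^ 2)⁻¹) := by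
        rw [monoConst]
        ring
    _ ≤ inner ℝ (velocity p - velocity q) (p - q) := by
        rw [inner_velocity_sub]
        exact mul_le_mul hmean hdiff (by positivity) ((by positivity : (0 : ℝ) ≤ _).trans hmean)

lemma contDiff_velocity {n : WithTop ℕ∞} : ContDiff ℝ n velocity := by
  unfold velocity
  refine ContDiff.smul (ContDiff.inv (ContDiff.sqrt ?_ fun p => ?_) fun p => ?_) contDiff_id
  · exact contDiff_const.add (contDiff_norm_sq ℝ)
  · positivity
  · positivity

lemma norm_fderiv_velocity_le (p : E3) : ‖fderiv ℝ velocity p‖ ≤ 1 :=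
  norm_fderiv_le_of_lipschitz ℝ (C := 1) <| LipschitzWith.of_dist_le_mul fun p q => by
    simpa only [dist_eq_norm, NNReal.coe_one, one_mul] using norm_velocity_sub_le p q

lemma fderiv_velocity_apply (p u : E3) :
    fderiv ℝ velocity p u
      = (lorentz p)⁻¹ • u - ((lorentz p)⁻¹ ^ 3 * inner ℝ p u) • p := by
  have hl := (lorentz_pos p).ne'
  have hsq : HasFDerivAt (fun q : E3 => 1 + ‖q‖ ^ 2) (2 • innerSL ℝ p) p := by
    simpa using (hasStrictFDerivAt_norm_sq p).hasFDerivAt.const_add 1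
  have hvel : HasFDerivAt velocity _ p :=
    ((hasDerivAt_inv hl).comp_hasFDerivAt p (hsq.sqrt (by positivity))).smul (hasFDerivAt_id p)
  rw [hvel.fderiv]
  change (lorentz p)⁻¹ • u + (-(lorentz p ^ 2)⁻¹ * (1 / (2 * lorentz p) *
    (2 • inner ℝ p u))) • p = _
  rw [sub_eq_add_neg, ← neg_smul, nsmul_eq_mul]
  congr 2
  field_simp
  norm_num

lemma fderiv_velocity_symm (p : E3) (i k : Fin 3) :
    (fderiv ℝ velocity p (EuclideanSpace.single i 1)) k
      = (fderiv ℝ velocity p (EuclideanSpace.single k 1)) i := by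
  rw [fderiv_velocity_apply, fderiv_velocity_apply]
  rcases eq_or_ne i k with rfl | h
  · rfl
  · simp only [PiLp.sub_apply, PiLp.smul_apply, EuclideanSpace.inner_single_right, conj_trivial,
      PiLp.single_apply, h, h.symm, if_false, smul_eq_mul]
    ring

lemma norm_cross_le (u w : E3) : ‖cross u w‖ ≤ ‖u‖ * ‖w‖ := by
  refine le_of_sq_le_sq ?_ (by positivity)
  have hlagrange : ‖cross u w‖ ^ 2 = ‖u‖ ^ 2 * ‖w‖ ^ 2 - inner ℝ u w ^ 2 := by
    simp only [EuclideanSpace.norm_sq_eq, cross, cross_apply, PiLp.inner_apply,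
      Fin.sum_univ_three, Real.norm_eq_abs, sq_abs, Matrix.cons_val, RCLike.inner_apply,
      conj_trivial]
    ring
  rw [hlagrange, mul_pow]
  exact sub_le_self _ (sq_nonneg _)

section Smooth

variable {E : Type*} [NormedAddCommGroup E] [NormedSpace ℝ E]

/-- Smooth scalar functions. -/
abbrev Smooth (g : E → ℝ) : Prop := ContDiff ℝ ∞ g

lemma Smooth.differentiable {g : E → ℝ} (hg : Smooth g) : Differentiable ℝ g :=
  ContDiff.differentiable hg (by simp)

/-- Test functions: smooth functions with compact support. -/
structure IsTest (g : E → ℝ) : Prop where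
  smooth : Smooth g
  compact : HasCompactSupport g

lemma IsTest.continuous {g : E → ℝ} (hg : IsTest g) : Continuous g :=
  ContDiff.continuous hg.smooth

lemma IsTest.sum {κ : Type*} (s : Finset κ) {g : κ → E → ℝ} (hg : ∀ k, IsTest (g k)) :
    IsTest fun y => ∑ k ∈ s, g k y := by
  classical
  refine ⟨ContDiff.sum fun k _ => (hg k).smooth, ?_⟩
  induction s using Finset.induction_on with
  | empty => exact HasCompactSupport.zero
  | insert k s hk ih =>
    simp only [Finset.sum_insert hk]
    exact (hg k).compact.add ih

/-- The function `y ↦ c g((y - x) / s)`. -/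
def rescale (c s : ℝ) (x : E) (g : E → ℝ) : E → ℝ := fun y => c * g (s⁻¹ • (y - x))

lemma Smooth.rescale {g : E → ℝ} (hg : Smooth g) (c s : ℝ) (x : E) :
    Smooth (rescale c s x g) :=
  contDiff_const.mul (hg.comp ((contDiff_id.sub contDiff_const).const_smul s⁻¹))

lemma IsTest.rescale {g : E → ℝ} (hg : IsTest g) (c : ℝ) {s : ℝ} (hs : 0 < s) (x : E) :
    IsTest (rescale c s x g) := by
  refine ⟨hg.smooth.rescale c s x, HasCompactSupport.mul_left (f := fun _ : E => c) ?_⟩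
  exact hg.compact.comp_homeomorph
    ((Homeomorph.subRight x).trans (Homeomorph.smulOfNeZero s⁻¹ (inv_ne_zero hs.ne')))

lemma abs_rescale_le {n : ℕ} {g : E → ℝ} {C s : ℝ} (hs : 0 < s)
    (hg : ∀ z, |g z| * ‖z‖ ^ n ≤ C) (x : E) {y : E} (hy : 0 < ‖y - x‖) :
    |rescale (s⁻¹ ^ n) s x g y| ≤ C * (‖y - x‖ ^ n)⁻¹ := by
  rw [← div_eq_mul_inv, le_div_iff₀ (by positivity), rescale, abs_mul,
    abs_of_nonneg (by positivity)]
  calc s⁻¹ ^ n * |g (s⁻¹ • (y - x))| * ‖y - x‖ ^ n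
      = |g (s⁻¹ • (y - x))| * ‖s⁻¹ • (y - x)‖ ^ n := by
        rw [norm_smul, Real.norm_of_nonneg (inv_nonneg.2 hs.le), mul_pow]
        ring
    _ ≤ C := hg _

lemma abs_rescale_le_of_one_le {g : E → ℝ} {C s : ℝ} (hs : 1 ≤ s) (hg : ∀ z, |g z| ≤ C)
    (n : ℕ) (x y : E) : |rescale (s⁻¹ ^ n) s x g y| ≤ C := by
  have hpow : s⁻¹ ^ n ≤ 1 := pow_le_one₀ (by positivity) (inv_le_one_of_one_le₀ hs)
  rw [rescale, abs_mul, abs_of_nonneg (by positivity)]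
  exact (mul_le_of_le_one_left (abs_nonneg _) hpow).trans (hg _)

/-- `g(λ z) = λᵃ g(z)` for `|z| > 1` and `λ ≥ 1`: homogeneity of degree `a` outside the unit ball,
shared by the derivatives of a mollified homogeneous kernel. -/
def HomogOutside (a : ℤ) (g : E → ℝ) : Prop :=
  ∀ z : E, 1 < ‖z‖ → ∀ l : ℝ, 1 ≤ l → g (l • z) = l ^ a * g z

lemma HomogOutside.fderiv_apply {a : ℤ} {g : E → ℝ} (hg : Differentiable ℝ g)
    (h : HomogOutside a g) (v : E) : HomogOutside (a - 1) fun z => fderiv ℝ g z v := by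
  intro z hz l hl
  have hl0 : l ≠ 0 := by positivity
  have hev : (fun y : E => g (l • y)) =ᶠ[𝓝 z] fun y => l ^ a * g y :=
    Filter.eventuallyEq_of_mem ((isOpen_lt continuous_const continuous_norm).mem_nhds hz)
      fun y hy => h y hy l hl
  have hscale : HasFDerivAt (fun y : E => l • y) (l • ContinuousLinearMap.id ℝ E) z :=
    (hasFDerivAt_id z).const_smul l
  have hderiv := (((hg (l • z)).hasFDerivAt.comp z hscale).congr_of_eventuallyEq hev.symm).unique
    ((hg z).hasFDerivAt.const_mul (l ^ a))
  have happly : fderiv ℝ g (l • z) v * l = l ^ a * fderiv ℝ g z v := by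
    simpa only [ContinuousLinearMap.comp_apply, _root_.smul_apply, ContinuousLinearMap.id_apply,
      map_smul, smul_eq_mul, mul_comm l] using DFunLike.congr_fun hderiv v
  rw [zpow_sub_one₀ hl0, mul_right_comm, ← happly, mul_inv_cancel_right₀ hl0]

lemma HomogOutside.exists_bound [ProperSpace E] {n : ℕ} {g : E → ℝ} (hg : Continuous g)
    (h : HomogOutside (-(n : ℤ)) g) :
    ∃ C : ℝ, 0 ≤ C ∧ ∀ z, |g z| ≤ C ∧ |g z| * ‖z‖ ^ n ≤ C := by
  obtain ⟨M, hM⟩ := (isCompact_closedBall (0 : E) 2).exists_bound_of_continuousOn hg.continuousOn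
  replace hM : ∀ u, ‖u‖ ≤ 2 → |g u| ≤ M := fun u hu => hM u (by simpa using hu)
  have hM0 : 0 ≤ M := (abs_nonneg _).trans (hM 0 (by simp))
  refine ⟨M * 2 ^ n, by positivity, fun z => ?_⟩
  rcases le_or_gt ‖z‖ 2 with hz | hz
  · exact ⟨(hM z hz).trans (le_mul_of_one_le_right hM0 (one_le_pow₀ one_le_two)),
      mul_le_mul (hM z hz) (pow_le_pow_left₀ (norm_nonneg _) hz n) (by positivity) hM0⟩
  -- beyond radius `2` compare with the point of norm `2` on the same ray
  · obtain ⟨l, hl, hzl⟩ : ∃ l : ℝ, 1 ≤ l ∧ ‖z‖ = l * 2 := ⟨‖z‖ / 2, by linarith, by ring⟩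
    have hl0 : 0 < l := by linarith
    have hnorm : ‖l⁻¹ • z‖ = 2 := by
      rw [norm_smul, Real.norm_of_nonneg (by positivity), hzl, inv_mul_cancel_left₀ hl0.ne']
    have hgz : |g z| * ‖z‖ ^ n = |g (l⁻¹ • z)| * 2 ^ n := by
      have := h (l⁻¹ • z) (by rw [hnorm]; norm_num) l hl
      rw [smul_inv_smul₀ hl0.ne', zpow_neg, zpow_natCast] at this
      rw [this, abs_mul, abs_of_pos (by positivity), hzl, mul_pow]
      field_simp
    have hweighted : |g z| * ‖z‖ ^ n ≤ M * 2 ^ n := by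
      rw [hgz]
      gcongr
      exact hM _ hnorm.le
    exact ⟨(le_mul_of_one_le_right (abs_nonneg _) (one_le_pow₀ (by linarith))).trans hweighted,
      hweighted⟩

end Smooth

section PartialDerivatives

variable {ι : Type*} [DecidableEq ι] {g g₁ g₂ : EuclideanSpace ℝ ι → ℝ}

/-- The partial derivative `∂ᵢ g` of a scalar function on Euclidean space. -/
def pd (i : ι) (g : EuclideanSpace ℝ ι → ℝ) : EuclideanSpace ℝ ι → ℝ :=
  fun x => fderiv ℝ g x (EuclideanSpace.single i 1)

lemma pd_sub [Finite ι] (h₁ : Differentiable ℝ g₁) (h₂ : Differentiable ℝ g₂) (i : ι) :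
    pd i (fun y => g₁ y - g₂ y) = fun y => pd i g₁ y - pd i g₂ y := by
  cases nonempty_fintype ι
  ext x
  exact DFunLike.congr_fun (fderiv_fun_sub (h₁ x) (h₂ x)) _

lemma pd_sum [Finite ι] {κ : Type*} (s : Finset κ) {g : κ → EuclideanSpace ℝ ι → ℝ}
    (h : ∀ k, Differentiable ℝ (g k)) (i : ι) :
    pd i (fun y => ∑ k ∈ s, g k y) = fun y => ∑ k ∈ s, pd i (g k) y := by
  cases nonempty_fintype ι
  ext x
  simp only [pd, fderiv_fun_sum fun k _ => h k x, _root_.sum_apply]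

lemma pd_coord_mul [Finite ι] (hg : Differentiable ℝ g) (i : ι) :
    pd i (fun y => y i * g y) = fun y => g y + y i * pd i g y := by
  cases nonempty_fintype ι
  ext y
  have hcoord : HasFDerivAt (fun y : EuclideanSpace ℝ ι => y i)
      (EuclideanSpace.proj i : EuclideanSpace ℝ ι →L[ℝ] ℝ) y :=
    (EuclideanSpace.proj i : EuclideanSpace ℝ ι →L[ℝ] ℝ).hasFDerivAt
  rw [pd, (hcoord.fun_mul (hg y).hasFDerivAt).fderiv]
  simp [pd, add_comm]

variable [Fintype ι]

lemma Smooth.pd (hg : Smooth g) (i : ι) : Smooth (pd i g) :=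
  (ContDiff.fderiv_right (m := ∞) hg (by simp)).clm_apply contDiff_const

lemma IsTest.pd (hg : IsTest g) (i : ι) : IsTest (pd i g) :=
  ⟨hg.smooth.pd i, (hg.compact.fderiv (𝕜 := ℝ)).comp_left
    (g := fun L : EuclideanSpace ℝ ι →L[ℝ] ℝ => L (EuclideanSpace.single i 1)) rfl⟩

lemma HomogOutside.pd {a : ℤ} (hg : Smooth g) (h : HomogOutside a g) (i : ι) :
    HomogOutside (a - 1) (pd i g) :=
  h.fderiv_apply hg.differentiable _

lemma pd_comm (hg : Smooth g) (i k : ι) : pd i (pd k g) = pd k (pd i g) := by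
  ext x
  have hdiff : DifferentiableAt ℝ (fderiv ℝ g) x :=
    (ContDiff.fderiv_right (m := ∞) hg (by simp)).differentiable (by simp) x
  have hsymm : IsSymmSndFDerivAt ℝ g x :=
    (contDiff_infty.1 hg 2).contDiffAt.isSymmSndFDerivAt (by simp)
  unfold pd
  rw [fderiv_clm_apply hdiff (differentiableAt_const _),
    fderiv_clm_apply hdiff (differentiableAt_const _)]
  simpa using hsymm _ _

lemma pd_rescale (hg : Differentiable ℝ g) (c s : ℝ) (x : EuclideanSpace ℝ ι) (i : ι) :
    pd i (rescale c s x g) = rescale (c * s⁻¹) s x (pd i g) := by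
  ext y
  have hinner : HasFDerivAt (fun y => s⁻¹ • (y - x))
      (s⁻¹ • ContinuousLinearMap.id ℝ (EuclideanSpace ℝ ι)) y :=
    ((hasFDerivAt_id y).sub_const x).const_smul s⁻¹
  have hderiv : HasFDerivAt (rescale c s x g) _ y :=
    ((hg (s⁻¹ • (y - x))).hasFDerivAt.comp y hinner).const_mul c
  simp only [pd, rescale, hderiv.fderiv, _root_.smul_apply, ContinuousLinearMap.comp_apply,
    ContinuousLinearMap.id_apply, map_smul, smul_eq_mul, mul_assoc]

lemma laplacian_eq_sum_pd (hg : Smooth g) : Δ g = fun x => ∑ i, pd i (pd i g) x := by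
  rw [InnerProductSpace.laplacian_eq_iteratedFDeriv_orthonormalBasis g
    (EuclideanSpace.basisFun ι ℝ)]
  ext x
  have hdiff : DifferentiableAt ℝ (fderiv ℝ g) x :=
    (ContDiff.fderiv_right (m := ∞) hg (by simp)).differentiable (by simp) x
  refine Finset.sum_congr rfl fun i _ => ?_
  unfold pd
  rw [fderiv_clm_apply hdiff (differentiableAt_const _), iteratedFDeriv_two_apply]
  simp

lemma pd_laplacian (hg : Smooth g) (i : ι) : pd i (Δ g) = Δ (pd i g) := by
  rw [laplacian_eq_sum_pd hg, laplacian_eq_sum_pd (hg.pd i),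
    pd_sum _ fun k => ((hg.pd k).pd k).differentiable]
  ext x
  refine Finset.sum_congr rfl fun k _ => ?_
  rw [pd_comm (hg.pd k), pd_comm hg]

end PartialDerivatives

section Laplacian

variable {ι : Type*} [Fintype ι] {g g₁ g₂ : EuclideanSpace ℝ ι → ℝ}

lemma Smooth.laplacian (hg : Smooth g) : Smooth (Δ g) := by
  classical
  rw [laplacian_eq_sum_pd hg]
  exact ContDiff.sum fun i _ => (hg.pd i).pd i

lemma IsTest.laplacian (hg : IsTest g) : IsTest (Δ g) := by
  classical
  rw [laplacian_eq_sum_pd hg.smooth]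
  exact IsTest.sum _ fun i => (hg.pd i).pd i

lemma Smooth.laplacian_sub (h₁ : Smooth g₁) (h₂ : Smooth g₂) :
    Δ (fun y => g₁ y - g₂ y) = fun y => Δ g₁ y - Δ g₂ y :=
  funext fun _ => ((contDiff_infty.1 h₁ 2).contDiffAt).laplacian_sub
    (contDiff_infty.1 h₂ 2).contDiffAt

lemma laplacian_rescale (hg : Smooth g) (c s : ℝ) (x : EuclideanSpace ℝ ι) :
    Δ (rescale c s x g) = rescale (c * s⁻¹ * s⁻¹) s x (Δ g) := by
  classical
  rw [laplacian_eq_sum_pd hg, laplacian_eq_sum_pd (hg.rescale c s x)]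
  simp only [pd_rescale hg.differentiable, pd_rescale (hg.pd _).differentiable]
  ext y
  simp only [rescale, Finset.mul_sum]

end Laplacian

/-! ### The bilaplacian of a mollified norm -/

section RadialLaplacian

/-- The Laplacian on `ℝⁿ` of `y ↦ η(|y|²)` is `y ↦ (radialLap n η)(|y|²)`. -/
def radialLap (n : ℕ) (η : ℝ → ℝ) : ℝ → ℝ :=
  fun q => 2 * n * deriv η q + 4 * q * deriv (deriv η) q

lemma Smooth.deriv {η : ℝ → ℝ} (hη : Smooth η) : Smooth (deriv η) :=
  ContDiff.iterate_deriv 1 hη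

lemma Smooth.radialLap {η : ℝ → ℝ} (hη : Smooth η) (n : ℕ) : Smooth (radialLap n η) :=
  (contDiff_const.mul hη.deriv).add ((contDiff_const.mul contDiff_id).mul hη.deriv.deriv)

lemma Smooth.comp_norm_sq {E : Type*} [NormedAddCommGroup E] [InnerProductSpace ℝ E] {η : ℝ → ℝ}
    (hη : Smooth η) : Smooth fun y : E => η (‖y‖ ^ 2) :=
  ContDiff.comp hη (contDiff_norm_sq ℝ)

variable {ι : Type*} [Fintype ι] {η : ℝ → ℝ}

lemma pd_comp_norm_sq [DecidableEq ι] (hη : Differentiable ℝ η) (i : ι) :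
    pd i (fun y => η (‖y‖ ^ 2)) = fun y => 2 * y i * deriv η (‖y‖ ^ 2) := by
  ext y
  have hcomp : HasFDerivAt (fun y : EuclideanSpace ℝ ι => η (‖y‖ ^ 2))
      (deriv η (‖y‖ ^ 2) • (2 • innerSL ℝ y)) y :=
    (hη _).hasDerivAt.comp_hasFDerivAt y (hasStrictFDerivAt_norm_sq y).hasFDerivAt
  rw [pd, hcomp.fderiv]
  simp [EuclideanSpace.inner_single_right]
  ring

lemma laplacian_comp_norm_sq (hη : Smooth η) :
    Δ (fun y : EuclideanSpace ℝ ι => η (‖y‖ ^ 2)) =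
      fun y => radialLap (Fintype.card ι) η (‖y‖ ^ 2) := by
  classical
  have hsecond (y : EuclideanSpace ℝ ι) (i : ι) : pd i (pd i fun y => η (‖y‖ ^ 2)) y =
      2 * deriv η (‖y‖ ^ 2) + 4 * deriv (deriv η) (‖y‖ ^ 2) * y i ^ 2 := by
    have hreorder : (fun y : EuclideanSpace ℝ ι => 2 * y i * deriv η (‖y‖ ^ 2)) =
        fun y => y i * (2 * deriv η (‖y‖ ^ 2)) := by ext; ring
    have hη₂ : Smooth fun q => 2 * deriv η q := contDiff_const.mul hη.deriv
    rw [pd_comp_norm_sq hη.differentiable, hreorder,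
      pd_coord_mul (g := fun y => 2 * deriv η (‖y‖ ^ 2)) hη₂.comp_norm_sq.differentiable,
      pd_comp_norm_sq hη₂.differentiable]
    simp only [deriv_const_mul_field]
    ring
  rw [laplacian_eq_sum_pd hη.comp_norm_sq]
  ext y
  have hnorm : ∑ i, y i ^ 2 = ‖y‖ ^ 2 := (EuclideanSpace.real_norm_sq_eq y).symm
  simp only [hsecond y, Finset.sum_add_distrib, ← Finset.mul_sum, hnorm, Finset.sum_const,
    Finset.card_univ, nsmul_eq_mul, radialLap]
  ring

end RadialLaplacian

section SmoothNorm

/-- A smooth profile that equals `√q` for `q ≥ 1`. -/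
def sqrtProfile (q : ℝ) : ℝ := √q * Real.smoothTransition (2 * q - 1)

lemma smooth_sqrtProfile : Smooth sqrtProfile := by
  rw [Smooth, contDiff_iff_contDiffAt]
  intro q
  rcases lt_or_ge q (1 / 2) with hq | hq
  · have hzero : sqrtProfile =ᶠ[𝓝 q] fun _ => 0 := by
      filter_upwards [gt_mem_nhds hq] with r hr
      rw [sqrtProfile, Real.smoothTransition.zero_of_nonpos (by linarith), mul_zero]
    exact contDiffAt_const.congr_of_eventuallyEq hzero
  · exact (contDiffAt_id.sqrt (by simp only [id]; linarith)).mul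
      (Real.smoothTransition.contDiff.comp
        ((contDiff_const.mul contDiff_id).sub contDiff_const)).contDiffAt

lemma sqrtProfile_of_one_le {q : ℝ} (hq : 1 ≤ q) : sqrtProfile q = √q := by
  rw [sqrtProfile, Real.smoothTransition.one_of_one_le (by linarith), mul_one]

variable {E : Type*} [NormedAddCommGroup E]

/-- A smooth function that equals `‖y‖` for `‖y‖ ≥ 1`. -/
def smoothNorm (y : E) : ℝ := sqrtProfile (‖y‖ ^ 2)

lemma smooth_smoothNorm [InnerProductSpace ℝ E] : Smooth (smoothNorm (E := E)) :=
  smooth_sqrtProfile.comp_norm_sq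

lemma smoothNorm_of_one_le {y : E} (hy : 1 ≤ ‖y‖) : smoothNorm y = ‖y‖ := by
  rw [smoothNorm, sqrtProfile_of_one_le (one_le_pow₀ hy), Real.sqrt_sq (norm_nonneg _)]

lemma homogOutside_smoothNorm [NormedSpace ℝ E] :
    HomogOutside 1 (smoothNorm (E := E)) := by
  intro z hz l hl
  have hlz : ‖l • z‖ = l * ‖z‖ := by rw [norm_smul, Real.norm_of_nonneg (by linarith)]
  rw [smoothNorm_of_one_le hz.le, smoothNorm_of_one_le (by rw [hlz]; nlinarith), hlz, zpow_one]

end SmoothNorm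

section BilapKernel

lemma radialLap_sqrtProfile {q : ℝ} (hq : 1 < q) :
    radialLap 3 sqrtProfile q = 2 * q ^ (-(1 / 2) : ℝ) := by
  have hderiv : ∀ q, 1 < q → deriv sqrtProfile q = (1 / 2) * q ^ (-(1 / 2) : ℝ) := by
    intro q hq
    have heq : sqrtProfile =ᶠ[𝓝 q] fun q => q ^ (1 / 2 : ℝ) := by
      filter_upwards [Ioi_mem_nhds hq] with r hr
      rw [sqrtProfile_of_one_le (le_of_lt hr), Real.sqrt_eq_rpow]
    rw [heq.deriv_eq, Real.deriv_rpow_const]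
    norm_num
  have hderiv₂ : deriv (deriv sqrtProfile) q = -(1 / 4) * q ^ (-(3 / 2) : ℝ) := by
    rw [(eventuallyEq_of_mem (Ioi_mem_nhds hq) hderiv).deriv_eq, deriv_const_mul_field,
      Real.deriv_rpow_const]
    norm_num
    ring
  have hpow : q ^ (-(1 / 2) : ℝ) = q * q ^ (-(3 / 2) : ℝ) := by
    rw [← Real.rpow_one_add' (by linarith) (by norm_num)]
    norm_num
  rw [radialLap, hderiv q hq, hderiv₂, hpow]
  push_cast
  ring

lemma deriv_radialLap_sqrtProfile {q : ℝ} (hq : 1 < q) :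
    deriv (radialLap 3 sqrtProfile) q = -q ^ (-(3 / 2) : ℝ) := by
  rw [(eventuallyEq_of_mem (Ioi_mem_nhds hq) fun _ => radialLap_sqrtProfile).deriv_eq,
    deriv_const_mul_field, Real.deriv_rpow_const]
  norm_num
  ring

lemma radialLap_radialLap_sqrtProfile {q : ℝ} (hq : 1 < q) :
    radialLap 3 (radialLap 3 sqrtProfile) q = 0 := by
  have hderiv₂ : deriv (deriv (radialLap 3 sqrtProfile)) q = (3 / 2) * q ^ (-(5 / 2) : ℝ) := by
    rw [(eventuallyEq_of_mem (Ioi_mem_nhds hq) fun _ => deriv_radialLap_sqrtProfile).deriv_eq,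
      deriv.fun_neg, Real.deriv_rpow_const]
    norm_num
  have hpow : q ^ (-(3 / 2) : ℝ) = q * q ^ (-(5 / 2) : ℝ) := by
    rw [← Real.rpow_one_add' (by linarith) (by norm_num)]
    norm_num
  rw [radialLap, deriv_radialLap_sqrtProfile hq, hderiv₂, hpow]
  push_cast
  ring

/-- The bilaplacian of `smoothNorm` on `ℝ³`; since `Δ² |y| = -8π δ₀`, it is a mollified Dirac mass
up to the factor `-8π`. -/
def bilapKernel : E3 → ℝ := Δ (Δ (smoothNorm : E3 → ℝ))

lemma bilapKernel_eq (y : E3) :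
    bilapKernel y = radialLap 3 (radialLap 3 sqrtProfile) (‖y‖ ^ 2) := by
  have hlap : Δ (smoothNorm : E3 → ℝ) = fun y => radialLap 3 sqrtProfile (‖y‖ ^ 2) :=
    laplacian_comp_norm_sq smooth_sqrtProfile
  rw [bilapKernel, hlap, laplacian_comp_norm_sq (smooth_sqrtProfile.radialLap 3),
    Fintype.card_fin]

lemma bilapKernel_eq_zero {y : E3} (hy : 1 < ‖y‖) : bilapKernel y = 0 := by
  rw [bilapKernel_eq, radialLap_radialLap_sqrtProfile (one_lt_pow₀ hy two_ne_zero)]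

lemma isTest_bilapKernel : IsTest bilapKernel :=
  ⟨smooth_smoothNorm.laplacian.laplacian,
    HasCompactSupport.intro (isCompact_closedBall (0 : E3) 1) fun _ hy =>
      bilapKernel_eq_zero (by simpa using hy)⟩

/-- The divergence theorem on a ball of radius `r` in `ℝⁿ`, for a radial function. -/
lemma hasDerivAt_pow_mul_deriv_sq {η : ℝ → ℝ} (hη : Smooth η) {n : ℕ} (hn : n ≠ 0) (r : ℝ) :
    HasDerivAt (fun r => 2 * r ^ n * deriv η (r ^ 2)) (r ^ (n - 1) * radialLap n η (r ^ 2)) r := by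
  have hcomp : HasDerivAt (fun r => deriv η (r ^ 2)) (deriv (deriv η) (r ^ 2) * (2 * r)) r :=
    ((hη.deriv.differentiable _).hasDerivAt.comp r (hasDerivAt_pow 2 r)).congr_deriv (by norm_num)
  refine (((hasDerivAt_pow n r).const_mul 2).mul hcomp).congr_deriv ?_
  obtain ⟨m, rfl⟩ := Nat.exists_eq_succ_of_ne_zero hn
  simp only [radialLap, Nat.succ_eq_add_one, Nat.add_sub_cancel]
  ring

lemma integral_radial_bilapKernel :
    ∫ r in Ioi (0 : ℝ), r ^ 2 * radialLap 3 (radialLap 3 sqrtProfile) (r ^ 2) = -2 := by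
  have hη := smooth_sqrtProfile.radialLap 3
  have hcont : Continuous fun r : ℝ => r ^ 2 * radialLap 3 (radialLap 3 sqrtProfile) (r ^ 2) := by
    have := (hη.radialLap 3).continuous
    fun_prop
  have htrunc : ∫ r in Ioi (0 : ℝ), r ^ 2 * radialLap 3 (radialLap 3 sqrtProfile) (r ^ 2) =
      ∫ r in Ioc (0 : ℝ) 2, r ^ 2 * radialLap 3 (radialLap 3 sqrtProfile) (r ^ 2) := by
    refine setIntegral_eq_of_subset_of_forall_sdiff_eq_zero measurableSet_Ioi
      (fun r hr => hr.1) fun r hr => ?_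
    have hr₂ : 2 < r := not_le.1 fun hle => hr.2 ⟨hr.1, hle⟩
    rw [radialLap_radialLap_sqrtProfile (one_lt_pow₀ (by linarith) two_ne_zero), mul_zero]
  have hpow : ((2 : ℝ) ^ 2) ^ (-(3 / 2) : ℝ) = 1 / 8 := by
    rw [← Real.rpow_natCast, ← Real.rpow_mul zero_le_two]
    norm_num
  rw [htrunc, ← intervalIntegral.integral_of_le zero_le_two,
    intervalIntegral.integral_eq_sub_of_hasDerivAt
      (fun r _ => hasDerivAt_pow_mul_deriv_sq hη three_ne_zero r) (hcont.intervalIntegrable _ _),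
    deriv_radialLap_sqrtProfile (by norm_num), hpow]
  norm_num

lemma integral_bilapKernel : ∫ y, bilapKernel y = -(8 * Real.pi) := by
  have hball : volume.real (Metric.ball (0 : E3) 1) = 4 / 3 * Real.pi := by
    rw [Measure.real, EuclideanSpace.volume_ball_fin_three, ENNReal.toReal_mul,
      ENNReal.toReal_ofReal (by positivity)]
    norm_num
    ring
  simp only [bilapKernel_eq]
  rw [integral_fun_norm_addHaar volume
    fun r : ℝ => radialLap 3 (radialLap 3 sqrtProfile) (r ^ 2)]
  simp only [finrank_euclideanSpace, Fintype.card_fin, Nat.reduceSub, smul_eq_mul, nsmul_eq_mul,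
    integral_radial_bilapKernel, hball]
  push_cast
  ring

end BilapKernel

section IntegrationByParts

variable {ι : Type*} [Fintype ι] {F g : EuclideanSpace ℝ ι → ℝ}

lemma integrable_mul_test (hF : Continuous F) (hg : IsTest g) : Integrable fun y => F y * g y :=
  (hF.mul hg.continuous).integrable_of_hasCompactSupport hg.compact.mul_left

lemma integral_mul_pd [DecidableEq ι] (hF : Differentiable ℝ F) {i : ι}
    (hF' : Continuous (pd i F)) (hg : IsTest g) :
    ∫ y, F y * pd i g y = -∫ y, pd i F y * g y :=
  integral_mul_fderiv_eq_neg_fderiv_mul_of_integrable (integrable_mul_test hF' hg)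
    (integrable_mul_test hF.continuous (hg.pd i)) (integrable_mul_test hF.continuous hg)
    (fun y _ => hF y) fun y _ => hg.smooth.differentiable y

end IntegrationByParts

/-! ### Scaled kernels -/

section IteratedPartials

variable {ι : Type*} [DecidableEq ι]

/-- The iterated partial derivative `∂_{i₁} ⋯ ∂_{iₙ} g` along a list of indices. -/
def pds (l : List ι) (g : EuclideanSpace ℝ ι → ℝ) : EuclideanSpace ℝ ι → ℝ := l.foldr pd g

variable [Fintype ι] {g g₁ g₂ : EuclideanSpace ℝ ι → ℝ}

lemma Smooth.pds (hg : Smooth g) : ∀ l : List ι, Smooth (pds l g)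
  | [] => hg
  | i :: l => (Smooth.pds hg l).pd i

lemma IsTest.pds (hg : IsTest g) : ∀ l : List ι, IsTest (pds l g)
  | [] => hg
  | i :: l => (IsTest.pds hg l).pd i

lemma pds_sub (h₁ : Smooth g₁) (h₂ : Smooth g₂) (l : List ι) :
    pds l (fun y => g₁ y - g₂ y) = fun y => pds l g₁ y - pds l g₂ y := by
  induction l with
  | nil => rfl
  | cons i l ih =>
    change pd i (pds l _) = _
    rw [ih, pd_sub (h₁.pds l).differentiable (h₂.pds l).differentiable]
    rfl

lemma pds_rescale (hg : Smooth g) (c s : ℝ) (x : EuclideanSpace ℝ ι) (l : List ι) :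
    pds l (rescale c s x g) = rescale (c * s⁻¹ ^ l.length) s x (pds l g) := by
  induction l with
  | nil => simp [pds]
  | cons i l ih =>
    change pd i (pds l _) = _
    rw [ih, pd_rescale (hg.pds l).differentiable, mul_assoc, ← pow_succ]
    rfl

lemma HomogOutside.pds {a : ℤ} (hg : Smooth g) (h : HomogOutside a g) (l : List ι) :
    HomogOutside (a - l.length) (pds l g) := by
  induction l with
  | nil => simpa [VlasovDarwin.pds] using h
  | cons i l ih => simpa [VlasovDarwin.pds, sub_sub] using ih.pd (hg.pds l) i

end IteratedPartials

section Kernels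

variable {E : Type*} [NormedAddCommGroup E] [NormedSpace ℝ E]

/-- The kernel `s h((y - x) / s)` with `h = smoothNorm`, which regularizes `|y - x|` at
scale `s`. -/
def normKernel (s : ℝ) (x : E) : E → ℝ := rescale s s x smoothNorm

/-- The difference of the kernels regularized at two scales. -/
def kernelDiff (s r : ℝ) (x : E) : E → ℝ := fun y => normKernel s x y - normKernel r x y

lemma normKernel_of_le {s : ℝ} (hs : 0 < s) {x y : E} (hy : s ≤ ‖y - x‖) :
    normKernel s x y = ‖y - x‖ := by
  have hnorm : ‖s⁻¹ • (y - x)‖ = s⁻¹ * ‖y - x‖ := by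
    rw [norm_smul, Real.norm_of_nonneg (by positivity)]
  have hone : 1 ≤ ‖s⁻¹ • (y - x)‖ := by rwa [hnorm, inv_mul_eq_div, one_le_div hs]
  rw [normKernel, rescale, smoothNorm_of_one_le hone, hnorm, mul_inv_cancel_left₀ hs.ne']

lemma kernelDiff_eq_zero {s r : ℝ} (hs : 0 < s) (hr : 0 < r) {x y : E} (hsy : s ≤ ‖y - x‖)
    (hry : r ≤ ‖y - x‖) : kernelDiff s r x y = 0 := by
  rw [kernelDiff, normKernel_of_le hs hsy, normKernel_of_le hr hry, sub_self]

end Kernels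

section KernelCalculus

lemma smooth_normKernel {E : Type*} [NormedAddCommGroup E] [InnerProductSpace ℝ E] (s : ℝ) (x : E) :
    Smooth (normKernel s x) :=
  smooth_smoothNorm.rescale s s x

lemma isTest_kernelDiff {E : Type*} [NormedAddCommGroup E] [InnerProductSpace ℝ E] [ProperSpace E]
    {s r : ℝ} (hs : 0 < s) (hr : 0 < r) (x : E) : IsTest (kernelDiff s r x) := by
  refine ⟨(smooth_normKernel s x).sub (smooth_normKernel r x), ?_⟩
  refine HasCompactSupport.intro (isCompact_closedBall x (max s r)) fun y hy => ?_
  rw [Metric.mem_closedBall, dist_eq_norm, not_le, max_lt_iff] at hy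
  exact kernelDiff_eq_zero hs hr hy.1.le hy.2.le

variable {ι : Type*} [Fintype ι] [DecidableEq ι]

lemma pds_kernelDiff (s r : ℝ) (x : EuclideanSpace ℝ ι) (l : List ι) :
    pds l (kernelDiff s r x) = fun y => pds l (normKernel s x) y - pds l (normKernel r x) y :=
  pds_sub (smooth_normKernel s x) (smooth_normKernel r x) l

lemma pds_kernelDiff_add (s r q : ℝ) (x y : EuclideanSpace ℝ ι) (l : List ι) :
    pds l (kernelDiff s r x) y + pds l (kernelDiff r q x) y = pds l (kernelDiff s q x) y := by
  simp only [pds_kernelDiff]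
  ring

lemma pds_kernelDiff_eq_zero {s r : ℝ} (hs : 0 < s) (hr : 0 < r) {x y : EuclideanSpace ℝ ι}
    (hsy : s < ‖y - x‖) (hry : r < ‖y - x‖) (l : List ι) : pds l (kernelDiff s r x) y = 0 := by
  induction l generalizing y with
  | nil => exact kernelDiff_eq_zero hs hr hsy.le hry.le
  | cons i l ih =>
    have hopen : IsOpen {y : EuclideanSpace ℝ ι | s < ‖y - x‖ ∧ r < ‖y - x‖} :=
      (isOpen_lt continuous_const (continuous_id.sub continuous_const).norm).inter
        (isOpen_lt continuous_const (continuous_id.sub continuous_const).norm)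
    have hzero : pds l (kernelDiff s r x) =ᶠ[𝓝 y] fun _ => 0 :=
      eventuallyEq_of_mem (hopen.mem_nhds ⟨hsy, hry⟩) fun _ hz => ih hz.1 hz.2
    change fderiv ℝ (pds l (kernelDiff s r x)) y _ = 0
    rw [hzero.fderiv_eq, fderiv_fun_const, Pi.zero_apply, _root_.zero_apply]

lemma pds_normKernel {s : ℝ} (hs : s ≠ 0) (x : EuclideanSpace ℝ ι) {n : ℕ} {l : List ι}
    (hl : l.length = n + 1) :
    pds l (normKernel s x) = rescale (s⁻¹ ^ n) s x (pds l smoothNorm) := by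
  rw [normKernel, pds_rescale smooth_smoothNorm, hl, pow_succ', mul_inv_cancel_left₀ hs]

end KernelCalculus

section KernelBounds

/-- `C` bounds the partial derivatives of order `n + 1 ≤ 4` of the mollified norm, together with
their products with the weight `|z|ⁿ`. -/
structure KernelBound (C : ℝ) : Prop where
  nonneg : 0 ≤ C
  bound : ∀ n ≤ 3, ∀ l : List (Fin 3), l.length = n + 1 → ∀ z : E3,
    |pds l smoothNorm z| ≤ C ∧ |pds l smoothNorm z| * ‖z‖ ^ n ≤ C

lemma exists_kernelBound : ∃ C, KernelBound C := by
  have hlist (p : Fin 3 × List (Fin 3)) : ∃ C : ℝ, 0 ≤ C ∧ ∀ z : E3,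
      |pds (p.1 :: p.2) smoothNorm z| ≤ C ∧
        |pds (p.1 :: p.2) smoothNorm z| * ‖z‖ ^ p.2.length ≤ C := by
    refine HomogOutside.exists_bound (smooth_smoothNorm.pds _).continuous ?_
    simpa using homogOutside_smoothNorm.pds smooth_smoothNorm (p.1 :: p.2)
  choose C _ hC using hlist
  obtain ⟨M, hM⟩ := ((finite_univ.prod (List.finite_length_le (Fin 3) 3)).image C).bddAbove
  refine ⟨max M 0, le_max_right _ _, fun n hn l hl z => ?_⟩
  obtain ⟨i, l, rfl⟩ := List.exists_cons_of_length_eq_add_one hl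
  obtain rfl : l.length = n := by simpa using hl
  have hmem : (i, l) ∈ univ ×ˢ {l : List (Fin 3) | l.length ≤ 3} := ⟨mem_univ i, hn⟩
  have hCM : C (i, l) ≤ max M 0 := (hM (mem_image_of_mem C hmem)).trans (le_max_left _ _)
  exact ⟨(hC (i, l) z).1.trans hCM, (hC (i, l) z).2.trans hCM⟩

lemma le_mul_rpow_neg {u C d β : ℝ} {n : ℕ} (hd : 0 < d) (hβ : 0 ≤ β) (hβn : β ≤ n) (hC : 0 ≤ C)
    (hu : u ≤ C) (hun : u ≤ C * (d ^ n)⁻¹) : u ≤ C * d ^ (-β) := by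
  rcases le_or_gt d 1 with hd₁ | hd₁
  · exact hu.trans (le_mul_of_one_le_right hC
      (Real.one_le_rpow_of_pos_of_le_one_of_nonpos hd hd₁ (neg_nonpos.2 hβ)))
  · refine hun.trans (mul_le_mul_of_nonneg_left ?_ hC)
    rw [← Real.rpow_natCast, ← Real.rpow_neg hd.le]
    exact Real.rpow_le_rpow_of_exponent_le hd₁.le (neg_le_neg hβn)

variable {C s r : ℝ} {n : ℕ} {l : List (Fin 3)} {x y : E3}

lemma KernelBound.abs_pds_kernelDiff_le (hC : KernelBound C) (hn : n ≤ 3) (hl : l.length = n + 1)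
    (hs : 0 < s) (hr : 0 < r) (hy : y ≠ x) :
    |pds l (kernelDiff s r x) y| ≤ 2 * C * ‖y - x‖ ^ (-(n : ℝ)) := by
  have hpos : 0 < ‖y - x‖ := norm_pos_iff.2 (sub_ne_zero.2 hy)
  have hkernel : ∀ s > 0, |pds l (normKernel s x) y| ≤ C * ‖y - x‖ ^ (-(n : ℝ)) := by
    intro s hs
    rw [pds_normKernel hs.ne' x hl, Real.rpow_neg hpos.le, Real.rpow_natCast]
    exact abs_rescale_le hs (fun z => (hC.bound n hn l hl z).2) x hpos
  rw [pds_kernelDiff]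
  refine (abs_sub _ _).trans ?_
  linarith [hkernel s hs, hkernel r hr]

lemma KernelBound.abs_pds_kernelDiff_le_of_one_le (hC : KernelBound C) (hn : n ≤ 3)
    (hl : l.length = n + 1) (hs : 1 ≤ s) (hr : 1 ≤ r) (hy : y ≠ x) {β : ℝ} (hβ : 0 ≤ β)
    (hβn : β ≤ n) : |pds l (kernelDiff s r x) y| ≤ 2 * C * ‖y - x‖ ^ (-β) := by
  have hpos : 0 < ‖y - x‖ := norm_pos_iff.2 (sub_ne_zero.2 hy)
  have hkernel : ∀ s, 1 ≤ s → |pds l (normKernel s x) y| ≤ C * ‖y - x‖ ^ (-β) := by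
    intro s hs
    have hs₀ : 0 < s := zero_lt_one.trans_le hs
    rw [pds_normKernel hs₀.ne' x hl]
    exact le_mul_rpow_neg hpos hβ hβn hC.nonneg
      (abs_rescale_le_of_one_le hs (fun z => (hC.bound n hn l hl z).1) n x y)
      (abs_rescale_le hs₀ (fun z => (hC.bound n hn l hl z).2) x hpos)
  rw [pds_kernelDiff]
  refine (abs_sub _ _).trans ?_
  linarith [hkernel s hs, hkernel r hr]

end KernelBounds

/-! ### Recovering a function from its integrals against bilaplacians -/

section Scaling

variable {E : Type*} [NormedAddCommGroup E] [InnerProductSpace ℝ E] [FiniteDimensional ℝ E]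
  [MeasurableSpace E] [BorelSpace E] {F g : E → ℝ} {M : ℝ}

lemma integral_mul_rescale (F g : E → ℝ) {s : ℝ} (hs : 0 < s) (x : E) :
    ∫ y, F y * rescale (s⁻¹ ^ Module.finrank ℝ E) s x g y = ∫ z, F (x + s • z) * g z := by
  set n := Module.finrank ℝ E
  calc ∫ y, F y * rescale (s⁻¹ ^ n) s x g y
      = ∫ y, (fun u => s⁻¹ ^ n * (F (x + s • s⁻¹ • u) * g (s⁻¹ • u))) (y - x) := by
        refine integral_congr_ae (ae_of_all _ fun y => ?_)
        simp only [rescale, smul_inv_smul₀ hs.ne', add_sub_cancel]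
        ring
    _ = ∫ z, F (x + s • z) * g z := by
        rw [integral_sub_right_eq_self (fun u => s⁻¹ ^ n * (F (x + s • s⁻¹ • u) * g (s⁻¹ • u))) x,
          integral_const_mul,
          Measure.integral_comp_inv_smul volume (fun z => F (x + s • z) * g z) s,
          abs_of_nonneg (by positivity), smul_eq_mul, inv_pow,
          inv_mul_cancel_left₀ (pow_ne_zero _ hs.ne')]

lemma tendsto_integral_comp_smul (hF : Continuous F) (hM : ∀ y, |F y| ≤ M) (hg : IsTest g) (x : E)
    {l : Filter ℝ} [l.IsCountablyGenerated] {F₀ : ℝ}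
    (hlim : ∀ᵐ z, Tendsto (fun s : ℝ => F (x + s • z)) l (𝓝 F₀)) :
    Tendsto (fun s : ℝ => ∫ z, F (x + s • z) * g z) l (𝓝 (F₀ * ∫ z, g z)) := by
  rw [← integral_const_mul]
  refine tendsto_integral_filter_of_dominated_convergence (fun z => M * |g z|)
    (Eventually.of_forall fun s => ?_) (Eventually.of_forall fun s => ae_of_all _ fun z => ?_) ?_
    (hlim.mono fun z hz => hz.mul_const _)
  · have := hg.continuous
    exact (by fun_prop : Continuous fun z => F (x + s • z) * g z).aestronglyMeasurable
  · rw [Real.norm_eq_abs, abs_mul]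
    exact mul_le_mul_of_nonneg_right (hM _) (abs_nonneg _)
  · exact (hg.continuous.integrable_of_hasCompactSupport hg.compact).abs.const_mul M

lemma tendsto_integral_comp_smul_zero (hF : Continuous F) (hM : ∀ y, |F y| ≤ M) (hg : IsTest g)
    (x : E) :
    Tendsto (fun s : ℝ => ∫ z, F (x + s • z) * g z) (𝓝[>] 0) (𝓝 (F x * ∫ z, g z)) := by
  refine tendsto_integral_comp_smul hF hM hg x (ae_of_all _ fun z => ?_)
  have hcont : Continuous fun s : ℝ => F (x + s • z) := by fun_prop
  simpa using (hcont.tendsto 0).mono_left nhdsWithin_le_nhds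

lemma tendsto_integral_comp_smul_atTop [Nontrivial E] (hF : Continuous F) (hM : ∀ y, |F y| ≤ M)
    (hF₀ : Tendsto F (cocompact E) (𝓝 0)) (hg : IsTest g) (x : E) :
    Tendsto (fun s : ℝ => ∫ z, F (x + s • z) * g z) atTop (𝓝 0) := by
  rw [← zero_mul (∫ z, g z)]
  refine tendsto_integral_comp_smul hF hM hg x ?_
  filter_upwards [Measure.ae_ne volume (0 : E)] with z hz
  have hescape : Tendsto (fun s : ℝ => x + s • z) atTop (cocompact E) := by
    rw [← Metric.cobounded_eq_cocompact]
    refine (tendsto_const_add_cobounded x).comp (tendsto_norm_atTop_iff_cobounded.1 ?_)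
    simp only [norm_smul, Real.norm_eq_abs]
    exact tendsto_abs_atTop_atTop.atTop_mul_const (norm_pos_iff.2 hz)
  exact hF₀.comp hescape

lemma tendsto_inv_mul_integral_comp_smul_atTop (hM : ∀ y, |F y| ≤ M) (hg : IsTest g) (x : E) :
    Tendsto (fun r : ℝ => r⁻¹ * ∫ z, F (x + r • z) * g z) atTop (𝓝 0) := by
  have hbound (r : ℝ) : |∫ z, F (x + r • z) * g z| ≤ ∫ z, M * |g z| := by
    rw [← Real.norm_eq_abs]
    refine norm_integral_le_of_norm_le
      ((hg.continuous.integrable_of_hasCompactSupport hg.compact).abs.const_mul M)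
      (ae_of_all _ fun z => ?_)
    rw [Real.norm_eq_abs, abs_mul]
    exact mul_le_mul_of_nonneg_right (hM _) (abs_nonneg _)
  have hlim : Tendsto (fun r : ℝ => |r⁻¹| * ∫ z, M * |g z|) atTop (𝓝 0) := by
    simpa using (tendsto_inv_atTop_zero (𝕜 := ℝ)).abs.mul_const (∫ z, M * |g z|)
  refine squeeze_zero_norm (fun r => ?_) hlim
  rw [Real.norm_eq_abs, abs_mul]
  exact mul_le_mul_of_nonneg_left (hbound r) (abs_nonneg _)

end Scaling

lemma abs_le_of_tendsto_of_abs_sub_le {u v : ℝ → ℝ} {a Q : ℝ} (hu : Tendsto u (𝓝[>] 0) (𝓝 a))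
    (hv : Tendsto v atTop (𝓝 0)) (hQ : ∀ s r : ℝ, 0 < s → s < 1 → 1 < r → |u s - v r| ≤ Q) :
    |a| ≤ Q := by
  refine le_of_tendsto hu.abs ?_
  filter_upwards [Ioo_mem_nhdsGT (zero_lt_one (α := ℝ))] with s hs
  have hlim := (hv.const_sub (u s)).abs
  rw [sub_zero] at hlim
  refine le_of_tendsto hlim ?_
  filter_upwards [eventually_gt_atTop (1 : ℝ)] with r hr using hQ s r hs.1 hs.2 hr

section Bilaplacian

variable {F : E3 → ℝ} {M M' Q s r : ℝ} {x : E3} {l : Fin 3}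

lemma bilaplacian_normKernel (hs : s ≠ 0) (x : E3) :
    Δ (Δ (normKernel s x)) = rescale (s⁻¹ ^ Module.finrank ℝ E3) s x bilapKernel := by
  rw [normKernel, laplacian_rescale smooth_smoothNorm,
    laplacian_rescale smooth_smoothNorm.laplacian, bilapKernel, finrank_euclideanSpace_fin]
  congr 1
  field_simp

lemma bilaplacian_kernelDiff (hs : s ≠ 0) (hr : r ≠ 0) (x : E3) :
    Δ (Δ (kernelDiff s r x)) = fun y => rescale (s⁻¹ ^ Module.finrank ℝ E3) s x bilapKernel y -
      rescale (r⁻¹ ^ Module.finrank ℝ E3) r x bilapKernel y := by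
  rw [← bilaplacian_normKernel hs, ← bilaplacian_normKernel hr,
    ← (smooth_normKernel s x).laplacian.laplacian_sub (smooth_normKernel r x).laplacian,
    ← (smooth_normKernel s x).laplacian_sub (smooth_normKernel r x)]
  rfl

lemma integral_mul_bilaplacian_kernelDiff (hF : Continuous F) (hs : 0 < s) (hr : 0 < r) (x : E3) :
    ∫ y, F y * Δ (Δ (kernelDiff s r x)) y =
      (∫ z, F (x + s • z) * bilapKernel z) - ∫ z, F (x + r • z) * bilapKernel z := by
  simp only [bilaplacian_kernelDiff hs.ne' hr.ne', mul_sub]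
  rw [integral_sub (integrable_mul_test hF (isTest_bilapKernel.rescale _ hs x))
    (integrable_mul_test hF (isTest_bilapKernel.rescale _ hr x)),
    integral_mul_rescale F _ hs, integral_mul_rescale F _ hr]

lemma integral_mul_bilaplacian_pd_kernelDiff (hF : Differentiable ℝ F) (hF' : Continuous (pd l F))
    (hs : 0 < s) (hr : 0 < r) (x : E3) :
    ∫ y, F y * Δ (Δ (pd l (kernelDiff s r x))) y =
      -(∫ z, pd l F (x + s • z) * bilapKernel z) -
        r⁻¹ * ∫ z, F (x + r • z) * pd l bilapKernel z := by
  have hks := isTest_bilapKernel.rescale (s⁻¹ ^ Module.finrank ℝ E3) hs x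
  have hkr := isTest_bilapKernel.rescale (r⁻¹ ^ Module.finrank ℝ E3) hr x
  have hdiff := (isTest_kernelDiff hs hr x).smooth
  rw [← pd_laplacian hdiff, ← pd_laplacian hdiff.laplacian,
    bilaplacian_kernelDiff hs.ne' hr.ne',
    pd_sub hks.smooth.differentiable hkr.smooth.differentiable]
  simp only [mul_sub]
  rw [integral_sub (integrable_mul_test hF.continuous (hks.pd l))
    (integrable_mul_test hF.continuous (hkr.pd l)), integral_mul_pd hF hF' hks,
    integral_mul_rescale _ _ hs, pd_rescale isTest_bilapKernel.smooth.differentiable,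
    ← integral_mul_rescale _ _ hr, ← integral_const_mul]
  congr 1
  refine integral_congr_ae (ae_of_all _ fun y => ?_)
  simp only [rescale]
  ring

lemma abs_mul_integral_bilapKernel (a : ℝ) :
    |a * ∫ z, bilapKernel z| = 8 * Real.pi * |a| := by
  rw [integral_bilapKernel, abs_mul, abs_neg, abs_of_nonneg (a := 8 * Real.pi) (by positivity),
    mul_comm]

lemma abs_le_of_integral_bilaplacian (hF : Continuous F) (hM : ∀ y, |F y| ≤ M)
    (hF₀ : Tendsto F (cocompact E3) (𝓝 0))
    (hQ : ∀ s r : ℝ, 0 < s → s < 1 → 1 < r → |∫ y, F y * Δ (Δ (kernelDiff s r x)) y| ≤ Q) :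
    8 * Real.pi * |F x| ≤ Q := by
  rw [← abs_mul_integral_bilapKernel]
  refine abs_le_of_tendsto_of_abs_sub_le
    (tendsto_integral_comp_smul_zero hF hM isTest_bilapKernel x)
    (tendsto_integral_comp_smul_atTop hF hM hF₀ isTest_bilapKernel x) fun s r hs hs₁ hr => ?_
  rw [← integral_mul_bilaplacian_kernelDiff hF hs (zero_lt_one.trans hr)]
  exact hQ s r hs hs₁ hr

lemma abs_pd_le_of_integral_bilaplacian (hF : Differentiable ℝ F) (hF' : Continuous (pd l F))
    (hM : ∀ y, |F y| ≤ M) (hM' : ∀ y, |pd l F y| ≤ M')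
    (hQ : ∀ s r : ℝ, 0 < s → s < 1 → 1 < r →
      |∫ y, F y * Δ (Δ (pd l (kernelDiff s r x))) y| ≤ Q) :
    8 * Real.pi * |pd l F x| ≤ Q := by
  rw [← abs_mul_integral_bilapKernel, ← abs_neg]
  refine abs_le_of_tendsto_of_abs_sub_le
    (tendsto_integral_comp_smul_zero hF' hM' isTest_bilapKernel x).neg
    (tendsto_inv_mul_integral_comp_smul_atTop hM (isTest_bilapKernel.pd l) x)
    fun s r hs hs₁ hr => ?_
  rw [← integral_mul_bilaplacian_pd_kernelDiff hF hF' hs (zero_lt_one.trans hr)]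
  exact hQ s r hs hs₁ hr

end Bilaplacian

/-! ### Characteristics of a decaying force field -/

lemma one_add_rpow_pos {s : ℝ} (hs : 0 ≤ s) (β : ℝ) : 0 < (1 + s) ^ β :=
  Real.rpow_pos_of_pos (by linarith) β

lemma one_add_rpow_le_one {s β : ℝ} (hs : 0 ≤ s) (hβ : β ≤ 0) : (1 + s) ^ β ≤ 1 :=
  Real.rpow_le_one_of_one_le_of_nonpos (by linarith) hβ

lemma hasDerivAt_one_add_rpow {s : ℝ} (hs : 0 ≤ s) (β : ℝ) :
    HasDerivAt (fun s : ℝ => (1 + s) ^ β) (β * (1 + s) ^ (β - 1)) s := by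
  simpa using ((hasDerivAt_id s).const_add 1).rpow_const (p := β)
    (Or.inl (by simp only [id_eq]; linarith))

lemma hasDerivAt_one_add_rpow_neg_half {s : ℝ} (hs : 0 ≤ s) :
    HasDerivAt (fun s : ℝ => 2 * (1 + s) ^ (-(1 / 2) : ℝ)) (-(1 + s) ^ (-(3 / 2) : ℝ)) s := by
  refine ((hasDerivAt_one_add_rpow hs (-(1 / 2))).const_mul 2).congr_deriv ?_
  norm_num
  ring

lemma hasDerivAt_one_add_rpow_neg_three_half {s : ℝ} (hs : 0 ≤ s) :
    HasDerivAt (fun s : ℝ => 2 / 3 * (1 + s) ^ (-(3 / 2) : ℝ)) (-(1 + s) ^ (-(5 / 2) : ℝ)) s := by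
  refine ((hasDerivAt_one_add_rpow hs (-(3 / 2))).const_mul (2 / 3)).congr_deriv ?_
  norm_num
  ring

lemma norm_sub_le_of_norm_deriv_le {V : Type*} [NormedAddCommGroup V] [NormedSpace ℝ V]
    {t : ℝ} {u u' : ℝ → V} {Φ φ : ℝ → ℝ}
    (hu : ∀ s ∈ Icc 0 t, HasDerivWithinAt u (u' s) (Icc 0 t) s)
    (hΦ : ∀ s ∈ Icc 0 t, HasDerivAt Φ (-φ s) s) (hb : ∀ s ∈ Icc 0 t, ‖u' s‖ ≤ φ s)
    {s : ℝ} (hs : s ∈ Icc 0 t) : ‖u t - u s‖ ≤ Φ s - Φ t := by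
  have hsub : Icc s t ⊆ Icc 0 t := Icc_subset_Icc_left hs.1
  refine image_norm_le_of_norm_deriv_right_le_deriv_boundary' (f := fun τ => u τ - u s)
    (f' := u') (a := s) (b := t) (B := fun τ => Φ s - Φ τ) (B' := φ)
    (fun τ hτ => ((hu τ (hsub hτ)).continuousWithinAt.mono hsub).sub continuousWithinAt_const)
    (fun τ hτ => ?_) (by simp)
    (fun τ hτ => (hΦ τ (hsub hτ)).continuousAt.continuousWithinAt.const_sub _) (fun τ hτ => ?_)
    (fun τ hτ => hb τ (hsub (Ico_subset_Icc_self hτ))) ⟨hs.2, le_rfl⟩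
  · exact ((hu τ (hsub (Ico_subset_Icc_self hτ))).sub_const (u s)).mono_of_mem_nhdsWithin <|
      mem_of_superset (Icc_mem_nhdsGE hτ.2) (Icc_subset_Icc_left (hs.1.trans hτ.1))
  · simpa using ((hΦ τ (hsub (Ico_subset_Icc_self hτ))).const_sub (Φ s)).hasDerivWithinAt

lemma sub_le_sub_of_deriv_le {t : ℝ} {u u' Φ φ : ℝ → ℝ} (ht : 0 ≤ t)
    (hu : ∀ s ∈ Icc 0 t, HasDerivWithinAt u (u' s) (Icc 0 t) s)
    (hΦ : ∀ s ∈ Icc 0 t, HasDerivAt Φ (φ s) s) (hb : ∀ s ∈ Icc 0 t, φ s ≤ u' s) :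
    Φ t - Φ 0 ≤ u t - u 0 := by
  have hderiv : ∀ s ∈ Icc 0 t,
      HasDerivWithinAt (fun s => u s - Φ s) (u' s - φ s) (Icc 0 t) s := fun s hs =>
    (hu s hs).sub (hΦ s hs).hasDerivWithinAt
  have hderivAt : ∀ s ∈ interior (Icc 0 t), HasDerivAt (fun s => u s - Φ s) (u' s - φ s) s :=
    fun s hs => (hderiv s (interior_subset hs)).hasDerivAt (mem_interior_iff_mem_nhds.1 hs)
  have hmono : MonotoneOn (fun s => u s - Φ s) (Icc 0 t) := by
    refine monotoneOn_of_deriv_nonneg (convex_Icc 0 t)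
      (fun s hs => (hderiv s hs).continuousWithinAt)
      (fun s hs => (hderivAt s hs).differentiableAt.differentiableWithinAt) fun s hs => ?_
    rw [(hderivAt s hs).deriv]
    exact sub_nonneg.2 (hb s (interior_subset hs))
  have := hmono (left_mem_Icc.2 ht) (right_mem_Icc.2 ht) ht
  simp only at this
  linarith

lemma exists_eq_mul_forall_le_mul {X : Type*} [TopologicalSpace X] {S : Set X} (hS : IsCompact S)
    (hne : S.Nonempty) {g w : X → ℝ} (hg : ContinuousOn g S) (hw : ContinuousOn w S)
    (hpos : ∀ x ∈ S, 0 < w x) : ∃ m ∈ S, ∃ N, g m = N * w m ∧ ∀ x ∈ S, g x ≤ N * w x := by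
  obtain ⟨m, hm, hmax⟩ := hS.exists_isMaxOn hne (hg.div hw fun x hx => (hpos x hx).ne')
  exact ⟨m, hm, g m / w m, (div_mul_cancel₀ _ (hpos m hm).ne').symm,
    fun x hx => (div_le_iff₀ (hpos x hx)).1 (hmax hx)⟩

/-- A force field whose size and Lipschitz constants on `[0,a]` decay at the rates granted by the
free streaming condition. -/
structure DecayingForce (α a : ℝ) (K : ℝ → E3 → E3 → E3) : Prop where
  nonneg : 0 ≤ α
  cont : ∀ x p, ContinuousOn (fun s => K s x p) (Icc 0 a)
  norm_le : ∀ s ∈ Icc 0 a, ∀ x p, ‖K s x p‖ ≤ α * (1 + s) ^ (-(3 / 2) : ℝ)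
  norm_sub_le : ∀ s ∈ Icc 0 a, ∀ x y p q, ‖K s x p - K s y q‖
    ≤ α * (1 + s) ^ (-(5 / 2) : ℝ) * ‖x - y‖ + α * (1 + s) ^ (-(3 / 2) : ℝ) * ‖p - q‖

/-- `(X, P)` is a characteristic of the Vlasov equation on `[0,t]`: it solves `X' = v(P)`,
`P' = K(s, X, P)`, with one-sided derivatives at the end points. -/
structure IsCharacteristic (K : ℝ → E3 → E3 → E3) (t : ℝ) (X P : ℝ → E3) : Prop where
  pos : ∀ s ∈ Icc 0 t, HasDerivWithinAt X (velocity (P s)) (Icc 0 t) s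
  mom : ∀ s ∈ Icc 0 t, HasDerivWithinAt P (K s (X s) (P s)) (Icc 0 t) s

section Characteristics

variable {α a t : ℝ} {K : ℝ → E3 → E3 → E3} {X P Y Q : ℝ → E3}

lemma DecayingForce.norm_le_const (hK : DecayingForce α a K) {s : ℝ} (hs : s ∈ Icc 0 a)
    (x p : E3) : ‖K s x p‖ ≤ α :=
  (hK.norm_le s hs x p).trans
    (mul_le_of_le_one_right hK.nonneg (one_add_rpow_le_one hs.1 (by norm_num)))

lemma DecayingForce.norm_sub_le_const (hK : DecayingForce α a K) {s : ℝ} (hs : s ∈ Icc 0 a)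
    (z w : E3 × E3) : ‖K s z.1 z.2 - K s w.1 w.2‖ ≤ 2 * α * ‖z - w‖ := by
  have hα := hK.nonneg
  calc ‖K s z.1 z.2 - K s w.1 w.2‖
      ≤ α * (1 + s) ^ (-(5 / 2) : ℝ) * ‖z.1 - w.1‖
        + α * (1 + s) ^ (-(3 / 2) : ℝ) * ‖z.2 - w.2‖ := hK.norm_sub_le s hs _ _ _ _
    _ ≤ α * 1 * ‖z - w‖ + α * 1 * ‖z - w‖ := by
        gcongr
        · exact one_add_rpow_le_one hs.1 (by norm_num)
        · exact norm_fst_le (z - w)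
        · exact one_add_rpow_le_one hs.1 (by norm_num)
        · exact norm_snd_le (z - w)
    _ = 2 * α * ‖z - w‖ := by ring

lemma DecayingForce.isPicardLindelof (hK : DecayingForce α a K) (ht : t ∈ Icc 0 a) (z : E3 × E3) :
    IsPicardLindelof (fun s (z : E3 × E3) => (velocity z.2, K s z.1 z.2)) (tmin := 0) (tmax := t)
      ⟨t, right_mem_Icc.2 ht.1⟩ z ((1 + α).toNNReal * t.toNNReal) 0 (1 + α).toNNReal
      (1 + 2 * α).toNNReal := by
  have hα := hK.nonneg
  have hsub : Icc 0 t ⊆ Icc 0 a := Icc_subset_Icc_right ht.2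
  refine ⟨fun s hs => (LipschitzWith.of_dist_le_mul fun z w => ?_).lipschitzOnWith,
    fun z _ => continuousOn_const.prodMk ((hK.cont z.1 z.2).mono hsub), fun s hs z _ => ?_,
    by simp [ht.1]⟩
  · rw [dist_eq_norm, dist_eq_norm, Real.coe_toNNReal _ (by positivity)]
    refine max_le ?_ ((hK.norm_sub_le_const (hsub hs) z w).trans ?_)
    · refine (norm_velocity_sub_le _ _).trans ((norm_snd_le (z - w)).trans ?_)
      exact le_mul_of_one_le_left (norm_nonneg _) (by linarith)
    · exact mul_le_mul_of_nonneg_right (by linarith) (norm_nonneg _)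
  · rw [Real.coe_toNNReal _ (by positivity)]
    exact max_le ((norm_velocity_le_one _).trans (by linarith))
      ((hK.norm_le_const (hsub hs) _ _).trans (by linarith))

lemma DecayingForce.exists_isCharacteristic (hK : DecayingForce α a K) (ht : t ∈ Icc 0 a)
    (x p : E3) : ∃ X P : ℝ → E3, IsCharacteristic K t X P ∧ X t = x ∧ P t = p := by
  obtain ⟨Z, hZt, hZ⟩ :=
    (hK.isPicardLindelof ht (x, p)).exists_eq_forall_mem_Icc_hasDerivWithinAt₀
  exact ⟨fun s => (Z s).1, fun s => (Z s).2, ⟨fun s hs => (hZ s hs).fst, fun s hs => (hZ s hs).snd⟩,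
    congrArg Prod.fst hZt, congrArg Prod.snd hZt⟩

lemma IsCharacteristic.continuousOn_mom (h : IsCharacteristic K t X P) :
    ContinuousOn P (Icc 0 t) := fun s hs => (h.mom s hs).continuousWithinAt

lemma IsCharacteristic.norm_pos_sub_le (h : IsCharacteristic K t X P) (ht : 0 ≤ t) :
    ‖X t - X 0‖ ≤ t := by
  simpa using norm_sub_le_of_norm_deriv_le (φ := fun _ => 1) (Φ := fun s => -s) h.pos
    (fun s _ => (hasDerivAt_id s).neg) (fun s _ => norm_velocity_le_one _) (left_mem_Icc.2 ht)

lemma IsCharacteristic.norm_mom_sub_le (h : IsCharacteristic K t X P) (hK : DecayingForce α a K)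
    (ht : t ∈ Icc 0 a) {s : ℝ} (hs : s ∈ Icc 0 t) : ‖P t - P s‖ ≤ 2 * α := by
  have hα := hK.nonneg
  have hdiff := norm_sub_le_of_norm_deriv_le (φ := fun s => α * (1 + s) ^ (-(3 / 2) : ℝ)) h.mom
    (fun s hs => ((hasDerivAt_one_add_rpow_neg_half hs.1).const_mul α).congr_deriv (by ring))
    (fun s hs => hK.norm_le s ⟨hs.1, hs.2.trans ht.2⟩ _ _) hs
  have hs1 := one_add_rpow_le_one hs.1 (by norm_num : (-(1 / 2) : ℝ) ≤ 0)
  have ht0 := one_add_rpow_pos ht.1 (-(1 / 2))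
  nlinarith

lemma DecayingForce.norm_sub_le_of_le (hK : DecayingForce α a K) {A b N s : ℝ} (hs : s ∈ Icc 0 a)
    (hN : 0 ≤ N) {x y p q : E3} (hxy : ‖x - y‖ ≤ A)
    (hpq : ‖p - q‖ ≤ b + N * (1 + s) ^ (-(3 / 2) : ℝ)) :
    ‖K s x p - K s y q‖
      ≤ α * ((A + N) * (1 + s) ^ (-(5 / 2) : ℝ) + b * (1 + s) ^ (-(3 / 2) : ℝ)) := by
  have hα := hK.nonneg
  have h52 := one_add_rpow_pos hs.1 (-(5 / 2))
  have h32 := one_add_rpow_pos hs.1 (-(3 / 2))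
  have hsq : (1 + s) ^ (-(3 / 2) : ℝ) * (1 + s) ^ (-(3 / 2) : ℝ) ≤ (1 + s) ^ (-(5 / 2) : ℝ) := by
    rw [← Real.rpow_add (by linarith [hs.1])]
    exact Real.rpow_le_rpow_of_exponent_le (by linarith [hs.1]) (by norm_num)
  calc ‖K s x p - K s y q‖
      ≤ α * (1 + s) ^ (-(5 / 2) : ℝ) * ‖x - y‖ + α * (1 + s) ^ (-(3 / 2) : ℝ) * ‖p - q‖ :=
        hK.norm_sub_le s hs _ _ _ _
    _ ≤ α * (1 + s) ^ (-(5 / 2) : ℝ) * A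
        + α * (1 + s) ^ (-(3 / 2) : ℝ) * (b + N * (1 + s) ^ (-(3 / 2) : ℝ)) := by gcongr
    _ = α * (A * (1 + s) ^ (-(5 / 2) : ℝ) + b * (1 + s) ^ (-(3 / 2) : ℝ)
        + N * ((1 + s) ^ (-(3 / 2) : ℝ) * (1 + s) ^ (-(3 / 2) : ℝ))) := by ring
    _ ≤ α * (A * (1 + s) ^ (-(5 / 2) : ℝ) + b * (1 + s) ^ (-(3 / 2) : ℝ)
        + N * (1 + s) ^ (-(5 / 2) : ℝ)) := by gcongr
    _ = _ := by ring

lemma IsCharacteristic.norm_pos_sub_sub_le (h : IsCharacteristic K t X P)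
    (h' : IsCharacteristic K t Y Q) {b N : ℝ} (hb : 0 ≤ b) (hN : 0 ≤ N)
    (hPQ : ∀ s ∈ Icc 0 t, ‖P s - Q s‖ ≤ b + N * (1 + s) ^ (-(3 / 2) : ℝ))
    {s : ℝ} (hs : s ∈ Icc 0 t) : ‖(X t - Y t) - (X s - Y s)‖ ≤ b * t + 2 * N := by
  have hdiff := norm_sub_le_of_norm_deriv_le (φ := fun s => b + N * (1 + s) ^ (-(3 / 2) : ℝ))
    (fun s hs => (h.pos s hs).sub (h'.pos s hs))
    (fun s hs => (((hasDerivAt_id s).const_mul (-b)).add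
      ((hasDerivAt_one_add_rpow_neg_half hs.1).const_mul N)).congr_deriv (by ring))
    (fun s hs => (norm_velocity_sub_le _ _).trans (hPQ s hs)) hs
  have hs1 := one_add_rpow_le_one hs.1 (by norm_num : (-(1 / 2) : ℝ) ≤ 0)
  have ht0 := one_add_rpow_pos (hs.1.trans hs.2) (-(1 / 2))
  refine hdiff.trans ?_
  simp only [Pi.add_apply, id_eq]
  nlinarith [mul_nonneg hb hs.1]

lemma IsCharacteristic.norm_mom_sub_sub_le (h : IsCharacteristic K t X P)
    (h' : IsCharacteristic K t Y Q) (hK : DecayingForce α a K) (ht : t ∈ Icc 0 a) {A b N : ℝ}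
    (hb : 0 ≤ b) (hN : 0 ≤ N) (hXY : ∀ s ∈ Icc 0 t, ‖X s - Y s‖ ≤ A)
    (hPQ : ∀ s ∈ Icc 0 t, ‖P s - Q s‖ ≤ b + N * (1 + s) ^ (-(3 / 2) : ℝ))
    {s : ℝ} (hs : s ∈ Icc 0 t) :
    ‖(P t - Q t) - (P s - Q s)‖ ≤ α * (2 / 3 * (A + N) * (1 + s) ^ (-(3 / 2) : ℝ) + 2 * b) := by
  have hα := hK.nonneg
  have hA : 0 ≤ A := (norm_nonneg _).trans (hXY s hs)
  have hdiff := norm_sub_le_of_norm_deriv_le (fun s hs => (h.mom s hs).sub (h'.mom s hs))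
    (fun s hs => (((hasDerivAt_one_add_rpow_neg_three_half hs.1).const_mul (A + N)).add
      ((hasDerivAt_one_add_rpow_neg_half hs.1).const_mul b)).const_mul α |>.congr_deriv (by ring))
    (fun s hs => hK.norm_sub_le_of_le ⟨hs.1, hs.2.trans ht.2⟩ hN (hXY s hs) (hPQ s hs)) hs
  have hs1 := one_add_rpow_le_one hs.1 (by norm_num : (-(1 / 2) : ℝ) ≤ 0)
  have ht3 := one_add_rpow_pos ht.1 (-(3 / 2))
  have ht1 := one_add_rpow_pos ht.1 (-(1 / 2))
  refine hdiff.trans ?_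
  simp only [Pi.add_apply]
  rw [← mul_sub]
  refine mul_le_mul_of_nonneg_left ?_ hα
  nlinarith [mul_nonneg (add_nonneg hA hN) ht3.le]

lemma IsCharacteristic.norm_sub_le_of_mom_eq (h : IsCharacteristic K t X P)
    (h' : IsCharacteristic K t Y Q) (hK : DecayingForce α a K) (hα6 : α ≤ 1 / 6)
    (ht : t ∈ Icc 0 a) (hPQ : P t = Q t) :
    ‖X 0 - Y 0‖ ≤ 2 * ‖X t - Y t‖ ∧ ‖P 0 - Q 0‖ ≤ ‖X t - Y t‖ := by
  have h0 : (0 : ℝ) ∈ Icc 0 t := left_mem_Icc.2 ht.1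
  obtain ⟨m, hm, N, hNm, hN⟩ := exists_eq_mul_forall_le_mul isCompact_Icc ⟨0, h0⟩
    (g := fun s => ‖P s - Q s‖) (h.continuousOn_mom.sub h'.continuousOn_mom).norm
    (fun s hs => (hasDerivAt_one_add_rpow hs.1 (-(3 / 2))).continuousAt.continuousWithinAt)
    (fun s hs => one_add_rpow_pos hs.1 _)
  have hwm := one_add_rpow_pos hm.1 (-(3 / 2))
  have hN0 : 0 ≤ N := nonneg_of_mul_nonneg_left (hNm ▸ norm_nonneg _) hwm
  have hmom : ∀ s ∈ Icc 0 t, ‖P s - Q s‖ ≤ 0 + N * (1 + s) ^ (-(3 / 2) : ℝ) := by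
    simpa only [zero_add] using hN
  have hpos : ∀ s ∈ Icc 0 t, ‖X s - Y s‖ ≤ ‖X t - Y t‖ + 2 * N := fun s hs => by
    have := h.norm_pos_sub_sub_le h' le_rfl hN0 hmom hs
    linarith [norm_sub_norm_le (X s - Y s) (X t - Y t), norm_sub_rev (X s - Y s) (X t - Y t)]
  have hNe : N ≤ ‖X t - Y t‖ / 6 := by
    have hgap := h.norm_mom_sub_sub_le h' hK ht le_rfl hN0 hpos hmom hm
    rw [hPQ, sub_self, zero_sub, norm_neg, hNm, mul_zero, add_zero, ← mul_assoc] at hgap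
    have := le_of_mul_le_mul_right hgap hwm
    nlinarith [norm_nonneg (X t - Y t)]
  refine ⟨(hpos 0 h0).trans (by linarith [norm_nonneg (X t - Y t)]), (hN 0 h0).trans ?_⟩
  simp only [add_zero, Real.one_rpow, mul_one]
  linarith [norm_nonneg (X t - Y t)]

lemma IsCharacteristic.norm_mom_sub_sub_le_of_pos_eq (h : IsCharacteristic K t X P)
    (h' : IsCharacteristic K t Y Q) (hK : DecayingForce α a K) (hα6 : α ≤ 1 / 6)
    (ht : t ∈ Icc 0 a) (hXY : X t = Y t) {s : ℝ} (hs : s ∈ Icc 0 t) :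
    ‖(P t - Q t) - (P s - Q s)‖
      ≤ 6 * α * ‖P t - Q t‖ * (1 + t * (1 + s) ^ (-(3 / 2) : ℝ)) := by
  have hα := hK.nonneg
  have ht0 := ht.1
  have hw : ∀ s ∈ Icc 0 t, 1 ≤ 1 + t * (1 + s) ^ (-(3 / 2) : ℝ) := fun s hs =>
    le_add_of_nonneg_right (mul_nonneg ht0 (one_add_rpow_pos hs.1 _).le)
  obtain ⟨m, hm, M, hMm, hM⟩ := exists_eq_mul_forall_le_mul isCompact_Icc
    ⟨0, left_mem_Icc.2 ht0⟩ (g := fun s => ‖P s - Q s‖)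
    (h.continuousOn_mom.sub h'.continuousOn_mom).norm
    (fun s hs => (((hasDerivAt_one_add_rpow hs.1 (-(3 / 2))).const_mul t).const_add
      1).continuousAt.continuousWithinAt) (fun s hs => one_pos.trans_le (hw s hs))
  have hM0 : 0 ≤ M :=
    nonneg_of_mul_nonneg_left (hMm ▸ norm_nonneg _) (one_pos.trans_le (hw m hm))
  have hmom : ∀ s ∈ Icc 0 t, ‖P s - Q s‖ ≤ M + M * t * (1 + s) ^ (-(3 / 2) : ℝ) := fun s hs =>
    (hM s hs).trans_eq (by ring)
  have hpos : ∀ s ∈ Icc 0 t, ‖X s - Y s‖ ≤ M * t + 2 * (M * t) := fun s hs => by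
    simpa only [hXY, sub_self, zero_sub, norm_neg] using
      h.norm_pos_sub_sub_le h' hM0 (by positivity) hmom hs
  have hgap : ∀ s ∈ Icc 0 t, ‖(P t - Q t) - (P s - Q s)‖
      ≤ 3 * α * M * (1 + t * (1 + s) ^ (-(3 / 2) : ℝ)) := fun s hs => by
    have := one_add_rpow_pos hs.1 (-(3 / 2))
    have hslack : 0 ≤ α * M * (1 + 1 / 3 * (t * (1 + s) ^ (-(3 / 2) : ℝ))) := by positivity
    linarith [h.norm_mom_sub_sub_le h' hK ht hM0 (by positivity) hpos hmom hs]
  have hMd : M ≤ 2 * ‖P t - Q t‖ := by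
    have htri := norm_sub_norm_le (P m - Q m) (P t - Q t)
    rw [norm_sub_rev (P m - Q m), hMm] at htri
    have hscaled : M * (1 + t * (1 + m) ^ (-(3 / 2) : ℝ))
        ≤ (‖P t - Q t‖ + 3 * α * M) * (1 + t * (1 + m) ^ (-(3 / 2) : ℝ)) := by
      nlinarith [hgap m hm, hw m hm, norm_nonneg (P t - Q t)]
    have := le_of_mul_le_mul_right hscaled (one_pos.trans_le (hw m hm))
    nlinarith
  refine (hgap s hs).trans (mul_le_mul_of_nonneg_right ?_ (zero_le_one.trans (hw s hs)))
  nlinarith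

lemma inner_velocity_sub_ge_of_norm_sub_le {R δ : ℝ} {p q d : E3} (hp : ‖p‖ ≤ R)
    (hpd : ‖p - d‖ ≤ R) (hd : ‖d - (p - q)‖ ≤ δ) :
    monoConst R * ‖d‖ ^ 2 - δ * ‖d‖ ≤ inner ℝ (velocity p - velocity q) d := by
  have hmono := inner_velocity_sub_ge hp hpd
  rw [sub_sub_cancel] at hmono
  have hsplit : inner ℝ (velocity p - velocity q) d
      = inner ℝ (velocity p - velocity (p - d)) d
        + inner ℝ (velocity (p - d) - velocity q) d := by
    rw [← inner_add_left, sub_add_sub_cancel]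
  have hle : ‖velocity (p - d) - velocity q‖ ≤ δ := by
    refine (norm_velocity_sub_le _ _).trans (le_of_eq_of_le ?_ hd)
    rw [← norm_neg]
    congr 1
    abel
  have herror := (abs_le.1 (abs_real_inner_le_norm (velocity (p - d) - velocity q) d)).1
  rw [hsplit]
  nlinarith [mul_le_mul_of_nonneg_right hle (norm_nonneg d)]

/-- Dispersion: strong monotonicity of `v` makes characteristics which meet at time `t` with
different momenta come from starting points that are `O(t)` apart. -/
lemma IsCharacteristic.norm_sub_ge_of_pos_eq (h : IsCharacteristic K t X P)
    (h' : IsCharacteristic K t Y Q) (hK : DecayingForce α a K) (hα6 : α ≤ 1 / 6)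
    (ht : t ∈ Icc 0 a) {R : ℝ} (hαR : 36 * α ≤ monoConst (3 * R)) (hXY : X t = Y t)
    (hP : ∀ s ∈ Icc 0 t, ‖P s‖ ≤ R) (hQ : ‖Q t‖ ≤ R) :
    monoConst (3 * R) / 2 * t * ‖P t - Q t‖ ≤ ‖X 0 - Y 0‖ := by
  have hα := hK.nonneg
  have ht0 := ht.1
  set d := P t - Q t
  set c := monoConst (3 * R)
  have hd : ‖d‖ ≤ 2 * R := by
    linarith [norm_sub_le (P t) (Q t), hP t (right_mem_Icc.2 ht0)]
  have hinner : ∀ s ∈ Icc 0 t, c * ‖d‖ ^ 2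
      - 6 * α * ‖d‖ ^ 2 * (1 + t * (1 + s) ^ (-(3 / 2) : ℝ))
      ≤ inner ℝ (velocity (P s) - velocity (Q s)) d := fun s hs => by
    refine le_of_eq_of_le ?_ (inner_velocity_sub_ge_of_norm_sub_le (R := 3 * R)
      (by linarith [hP s hs, norm_nonneg d]) (by linarith [norm_sub_le (P s) d, hP s hs])
      (h.norm_mom_sub_sub_le_of_pos_eq h' hK hα6 ht hXY hs))
    ring
  have hgrow := sub_le_sub_of_deriv_le ht0
    (fun s hs => ((h.pos s hs).sub (h'.pos s hs)).inner ℝ (hasDerivWithinAt_const s (Icc 0 t) d))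
    (fun s hs => (((hasDerivAt_id s).const_mul (c * ‖d‖ ^ 2)).sub
      (((hasDerivAt_id s).sub ((hasDerivAt_one_add_rpow_neg_half hs.1).const_mul t)).const_mul
        (6 * α * ‖d‖ ^ 2))).congr_deriv (by ring))
    (fun s hs => (hinner s hs).trans_eq (by simp only [inner_zero_right, zero_add]))
  simp only [hXY, sub_self, inner_zero_left, zero_sub, Pi.sub_apply, id_eq, add_zero,
    Real.one_rpow] at hgrow
  have hcs := (abs_le.1 (abs_real_inner_le_norm (X 0 - Y 0) d)).1
  have hend : 0 ≤ 12 * α * ‖d‖ ^ 2 * t * (1 + t) ^ (-(1 / 2) : ℝ) := by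
    have := one_add_rpow_pos ht0 (-(1 / 2))
    positivity
  have hsmall : 0 ≤ (c - 36 * α) * (‖d‖ ^ 2 * t) := mul_nonneg (by linarith) (by positivity)
  rcases (norm_nonneg d).eq_or_lt with hzero | hpos
  · rw [← hzero, mul_zero]
    exact norm_nonneg _
  · refine le_of_mul_le_mul_right ?_ hpos
    nlinarith

end Characteristics

/-! ### Functions of class `C¹` on a time slab -/

section Slab

variable {V W : Type*} [NormedAddCommGroup V] [NormedSpace ℝ V] [NormedAddCommGroup W]
  [NormedSpace ℝ W] {T : ℝ} {G : ℝ × V → W}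

/-- The space-time derivative of a function on the slab `[0,T[ × V`, one-sided in time at
`t = 0`. -/
def slabDeriv (T : ℝ) (G : ℝ × V → W) (z : ℝ × V) : ℝ × V →L[ℝ] W :=
  fderivWithin ℝ G (Ico 0 T ×ˢ univ) z

lemma hasFDerivWithinAt_slab (hG : ContDiffOn ℝ 1 G (Ico 0 T ×ˢ univ)) {t : ℝ} (ht : t ∈ Ico 0 T)
    (y : V) : HasFDerivWithinAt G (slabDeriv T G (t, y)) (Ico 0 T ×ˢ univ) (t, y) :=
  ((hG.differentiableOn (by simp)) (t, y) ⟨ht, mem_univ _⟩).hasFDerivWithinAt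

lemma continuousOn_slabDeriv (hG : ContDiffOn ℝ 1 G (Ico 0 T ×ˢ univ)) :
    ContinuousOn (slabDeriv T G) (Ico 0 T ×ˢ univ) :=
  hG.continuousOn_fderivWithin ((uniqueDiffOn_Ico 0 T).prod uniqueDiffOn_univ) le_rfl

lemma hasDerivWithinAt_slab (hG : ContDiffOn ℝ 1 G (Ico 0 T ×ˢ univ)) {t : ℝ} (ht : t ∈ Ico 0 T)
    (y : V) : HasDerivWithinAt (fun s => G (s, y)) (slabDeriv T G (t, y) (1, 0)) (Ico 0 T) t := by
  have hline : HasDerivWithinAt (fun s : ℝ => (s, y)) ((1 : ℝ), (0 : V)) (Ico 0 T) t :=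
    (hasDerivWithinAt_id t _).prodMk (hasDerivWithinAt_const t _ y)
  have hmem : MapsTo (fun s : ℝ => (s, y)) (Ico 0 T) (Ico 0 T ×ˢ univ) :=
    fun s hs => ⟨hs, mem_univ _⟩
  exact (hasFDerivWithinAt_slab hG ht y).comp_hasDerivWithinAt t hline hmem

lemma derivWithin_slab (hG : ContDiffOn ℝ 1 G (Ico 0 T ×ˢ univ)) {t : ℝ} (ht : t ∈ Ico 0 T)
    (y : V) : derivWithin (fun s => G (s, y)) (Ico 0 T) t = slabDeriv T G (t, y) (1, 0) :=
  (hasDerivWithinAt_slab hG ht y).derivWithin (uniqueDiffOn_Ico 0 T t ht)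

lemma hasDerivAt_slab (hG : ContDiffOn ℝ 1 G (Ico 0 T ×ˢ univ)) {t : ℝ} (ht : t ∈ Ioo 0 T)
    (y : V) : HasDerivAt (fun s => G (s, y)) (slabDeriv T G (t, y) (1, 0)) t :=
  (hasDerivWithinAt_slab hG ⟨ht.1.le, ht.2⟩ y).hasDerivAt (Ico_mem_nhds ht.1 ht.2)

lemma hasFDerivAt_slab (hG : ContDiffOn ℝ 1 G (Ico 0 T ×ˢ univ)) {t : ℝ} (ht : t ∈ Ico 0 T)
    (y : V) : HasFDerivAt (fun y => G (t, y))
      ((slabDeriv T G (t, y)).comp (ContinuousLinearMap.inr ℝ ℝ V)) y := by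
  have hslice : HasFDerivAt (fun y : V => (t, y)) (ContinuousLinearMap.inr ℝ ℝ V) y :=
    (hasFDerivAt_const t y).prodMk (hasFDerivAt_id y)
  rw [← hasFDerivWithinAt_univ] at hslice ⊢
  exact (hasFDerivWithinAt_slab hG ht y).comp y hslice fun s _ => ⟨ht, mem_univ _⟩

lemma differentiable_slab (hG : ContDiffOn ℝ 1 G (Ico 0 T ×ˢ univ)) {t : ℝ} (ht : t ∈ Ico 0 T) :
    Differentiable ℝ fun y => G (t, y) := fun y => (hasFDerivAt_slab hG ht y).differentiableAt

lemma continuousOn_fderiv_slab (hG : ContDiffOn ℝ 1 G (Ico 0 T ×ˢ univ)) :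
    ContinuousOn (fun z : ℝ × V => fderiv ℝ (fun y => G (z.1, y)) z.2) (Ico 0 T ×ˢ univ) :=
  ((continuousOn_slabDeriv hG).clm_comp
    (continuousOn_const (c := ContinuousLinearMap.inr ℝ ℝ V))).congr
      fun z hz => (hasFDerivAt_slab hG hz.1 z.2).fderiv

lemma continuous_fderiv_slab (hG : ContDiffOn ℝ 1 G (Ico 0 T ×ˢ univ)) {t : ℝ}
    (ht : t ∈ Ico 0 T) : Continuous (fderiv ℝ fun y => G (t, y)) :=
  (continuousOn_fderiv_slab hG).comp_continuous (f := fun y => (t, y)) (by fun_prop)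
    fun y => ⟨ht, mem_univ _⟩

end Slab

/-! ### The force of a solution with the free streaming condition -/

lemma exists_norm_le_of_supNorm_add_le {V : Type} [NormedAddCommGroup V] {F G H : E3 → V} {c : ℝ}
    (hc : 0 ≤ c) (h : supNorm F + supNorm G + supNorm H ≤ ENNReal.ofReal c) :
    ∃ a b d : ℝ, a + b + d ≤ c ∧ (∀ x, ‖F x‖ ≤ a) ∧ (∀ x, ‖G x‖ ≤ b) ∧ ∀ x, ‖H x‖ ≤ d := by
  have hfin := (h.trans_lt ENNReal.ofReal_lt_top).ne
  obtain ⟨hFG, hH⟩ := ENNReal.add_ne_top.1 hfin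
  obtain ⟨hF, hG⟩ := ENNReal.add_ne_top.1 hFG
  have hle : ∀ {J : E3 → V}, supNorm J ≠ ⊤ → ∀ x, ‖J x‖ ≤ (supNorm J).toReal := fun hJ x => by
    rw [← toReal_enorm]
    exact ENNReal.toReal_mono hJ (le_iSup (fun x => ‖_‖ₑ) x)
  refine ⟨_, _, _, ?_, hle hF, hle hG, hle hH⟩
  rw [← ENNReal.toReal_add hF hG, ← ENNReal.toReal_add hFG hH]
  exact ENNReal.toReal_le_of_le_ofReal hc h

lemma norm_sub_le_of_norm_fderiv_le {V W : Type*} [NormedAddCommGroup V] [NormedSpace ℝ V]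
    [NormedAddCommGroup W] [NormedSpace ℝ W] {F : V → W} (hF : Differentiable ℝ F) {C : ℝ}
    (h : ∀ x, ‖fderiv ℝ F x‖ ≤ C) (x y : V) : ‖F x - F y‖ ≤ C * ‖x - y‖ :=
  convex_univ.norm_image_sub_le_of_norm_fderiv_le (fun x _ => hF x) (fun x _ => h x)
    (mem_univ _) (mem_univ _)

lemma cross_sub_cross (u u' w w' : E3) :
    cross u w - cross u' w' = cross u (w - w') + cross (u - u') w' := by
  simp only [cross, WithLp.ofLp_sub, map_sub, LinearMap.sub_apply]
  rw [← WithLp.toLp_sub, ← WithLp.toLp_add, sub_add_sub_cancel]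

lemma continuous_cross : Continuous fun z : E3 × E3 => cross z.1 z.2 := by
  refine (PiLp.continuous_toLp 2 _).comp (continuous_pi fun i => ?_)
  fin_cases i <;>
    simp only [cross_apply, Fin.zero_eta, Fin.mk_one, Fin.reduceFinMk, Matrix.cons_val] <;>
    fun_prop

lemma norm_force_le (EL ET B : ℝ → E3 → E3) (t : ℝ) (x p : E3) :
    ‖force EL ET B t x p‖ ≤ ‖EL t x‖ + ‖ET t x‖ + ‖B t x‖ :=
  norm_add₃_le.trans <| by
    gcongr
    exact (norm_cross_le _ _).trans
      (mul_le_of_le_one_left (norm_nonneg _) (norm_velocity_le_one p))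

lemma norm_force_sub_le (EL ET B : ℝ → E3 → E3) (t : ℝ) (x y p q : E3) :
    ‖force EL ET B t x p - force EL ET B t y q‖
      ≤ ‖EL t x - EL t y‖ + ‖ET t x - ET t y‖ + ‖B t x - B t y‖ + ‖p - q‖ * ‖B t y‖ := by
  have hsplit : force EL ET B t x p - force EL ET B t y q
      = (EL t x - EL t y) + (ET t x - ET t y) + cross (velocity p) (B t x - B t y)
        + cross (velocity p - velocity q) (B t y) := by
    rw [add_assoc _ (cross _ _), ← cross_sub_cross]
    unfold force
    abel
  have hB : ‖cross (velocity p) (B t x - B t y)‖ ≤ ‖B t x - B t y‖ :=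
    (norm_cross_le _ _).trans (mul_le_of_le_one_left (norm_nonneg _) (norm_velocity_le_one p))
  have hv : ‖cross (velocity p - velocity q) (B t y)‖ ≤ ‖p - q‖ * ‖B t y‖ :=
    (norm_cross_le _ _).trans
      (mul_le_mul_of_nonneg_right (norm_velocity_sub_le p q) (norm_nonneg _))
  rw [hsplit]
  exact (norm_add_le _ _).trans (add_le_add (norm_add₃_le.trans (by gcongr)) hv)

section Solution

variable {T : ℝ} {f : ℝ → E3 → E3 → ℝ} {EL ET B : ℝ → E3 → E3}

lemma IsClassicalSolution.differentiable_EL (h : IsClassicalSolution T f EL ET B) {t : ℝ}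
    (ht : t ∈ Ico 0 T) : Differentiable ℝ (EL t) := differentiable_slab h.contDiffOn_EL ht

lemma IsClassicalSolution.differentiable_B (h : IsClassicalSolution T f EL ET B) {t : ℝ}
    (ht : t ∈ Ico 0 T) : Differentiable ℝ (B t) := differentiable_slab h.contDiffOn_B ht

lemma IsClassicalSolution.continuousOn_force (h : IsClassicalSolution T f EL ET B) :
    ContinuousOn (fun z : ℝ × E3 × E3 => force EL ET B z.1 z.2.1 z.2.2)
      (Ico 0 T ×ˢ (univ : Set (E3 × E3))) := by
  have hlift {F : ℝ → E3 → E3}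
      (hF : ContinuousOn (fun z : ℝ × E3 => F z.1 z.2) (Ico 0 T ×ˢ (univ : Set E3))) :
      ContinuousOn (fun z : ℝ × E3 × E3 => F z.1 z.2.1) (Ico 0 T ×ˢ (univ : Set (E3 × E3))) :=
    hF.comp (f := fun z : ℝ × E3 × E3 => (z.1, z.2.1)) (by fun_prop)
      fun z hz => mem_prod.2 ⟨hz.1, mem_univ _⟩
  have hv : Continuous fun z : ℝ × E3 × E3 => velocity z.2.2 :=
    (contDiff_velocity (n := 0)).continuous.comp (by fun_prop)
  have hcross : ContinuousOn (fun z : ℝ × E3 × E3 => cross (velocity z.2.2) (B z.1 z.2.1))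
      (Ico 0 T ×ˢ (univ : Set (E3 × E3))) :=
    continuous_cross.comp_continuousOn (f := fun z : ℝ × E3 × E3 => (velocity z.2.2, B z.1 z.2.1))
      (hv.continuousOn.prodMk (hlift h.contDiffOn_B.continuousOn))
  unfold force
  exact ContinuousOn.add
    (ContinuousOn.add (hlift h.contDiffOn_EL.continuousOn) (hlift h.continuousOn_ET)) hcross

lemma IsClassicalSolution.decayingForce (h : IsClassicalSolution T f EL ET B) {α a : ℝ}
    (hα : 0 ≤ α) (ha : a < T) (hfs : FreeStreaming α a EL ET B) :
    DecayingForce α a (force EL ET B) := by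
  have hbound : ∀ s ∈ Icc 0 a, ∃ eT eL b : ℝ, eT + eL + b ≤ α * (1 + s) ^ (-(3 / 2) : ℝ) ∧
      (∀ x, ‖ET s x‖ ≤ eT) ∧ (∀ x, ‖EL s x‖ ≤ eL) ∧ ∀ x, ‖B s x‖ ≤ b := fun s hs =>
    exists_norm_le_of_supNorm_add_le (mul_nonneg hα (one_add_rpow_pos hs.1 _).le) (hfs s hs).1
  refine ⟨hα, fun x p => ?_, fun s hs x p => ?_, fun s hs x y p q => ?_⟩
  · exact h.continuousOn_force.comp (f := fun s => (s, x, p)) (by fun_prop)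
      fun s hs => ⟨⟨hs.1, hs.2.trans_lt ha⟩, mem_univ _⟩
  · obtain ⟨eT, eL, b, hsum, hT, hL, hB⟩ := hbound s hs
    linarith [norm_force_le EL ET B s x p, hT x, hL x, hB x]
  · have hsT : s ∈ Ico 0 T := ⟨hs.1, hs.2.trans_lt ha⟩
    obtain ⟨eT, eL, b, hsum, hT, hL, hB⟩ := hbound s hs
    obtain ⟨gT, gL, gB, hgsum, hgT, hgL, hgB⟩ := exists_norm_le_of_supNorm_add_le
      (mul_nonneg hα (one_add_rpow_pos hs.1 _).le) (hfs s hs).2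
    have hb : b ≤ α * (1 + s) ^ (-(3 / 2) : ℝ) := by
      linarith [(norm_nonneg _).trans (hT x), (norm_nonneg _).trans (hL x)]
    calc ‖force EL ET B s x p - force EL ET B s y q‖
        ≤ ‖EL s x - EL s y‖ + ‖ET s x - ET s y‖ + ‖B s x - B s y‖ + ‖p - q‖ * ‖B s y‖ :=
          norm_force_sub_le EL ET B s x y p q
      _ ≤ gL * ‖x - y‖ + gT * ‖x - y‖ + gB * ‖x - y‖
            + ‖p - q‖ * (α * (1 + s) ^ (-(3 / 2) : ℝ)) := by
          gcongr
          · exact norm_sub_le_of_norm_fderiv_le (h.differentiable_EL hsT) hgL x y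
          · exact norm_sub_le_of_norm_fderiv_le (h.differentiable_ET s hsT) hgT x y
          · exact norm_sub_le_of_norm_fderiv_le (h.differentiable_B hsT) hgB x y
          · exact (hB y).trans hb
      _ = (gT + gL + gB) * ‖x - y‖ + α * (1 + s) ^ (-(3 / 2) : ℝ) * ‖p - q‖ := by ring
      _ ≤ _ := by gcongr

end Solution

/-! ### The distribution function along characteristics -/

/-- The distribution function as a function on space-time, the form in which it lives on a time
slab. -/
def spaceTime (f : ℝ → E3 → E3 → ℝ) (z : ℝ × E3 × E3) : ℝ := f z.1 z.2.1 z.2.2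

lemma inner_gradient {g : E3 → ℝ} {x : E3} (hg : DifferentiableAt ℝ g x) (u : E3) :
    inner ℝ u (gradient g x) = fderiv ℝ g x u := by
  rw [real_inner_comm, hg.hasGradientAt.hasFDerivAt.fderiv, InnerProductSpace.toDual_apply_apply]

section Solution

variable {T : ℝ} {f : ℝ → E3 → E3 → ℝ} {EL ET B : ℝ → E3 → E3}

lemma IsClassicalSolution.hasFDerivAt_pos (h : IsClassicalSolution T f EL ET B) {t : ℝ}
    (ht : t ∈ Ico 0 T) (x p : E3) :
    HasFDerivAt (fun y => f t y p) ((slabDeriv T (spaceTime f) (t, x, p)).comp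
      ((ContinuousLinearMap.inr ℝ ℝ (E3 × E3)).comp (ContinuousLinearMap.inl ℝ E3 E3))) x :=
  (hasFDerivAt_slab (G := spaceTime f) h.contDiffOn_f ht (x, p)).comp (f := fun y => (y, p)) x
    ((hasFDerivAt_id x).prodMk (hasFDerivAt_const p x))

lemma IsClassicalSolution.hasFDerivAt_mom (h : IsClassicalSolution T f EL ET B) {t : ℝ}
    (ht : t ∈ Ico 0 T) (x p : E3) :
    HasFDerivAt (fun q => f t x q) ((slabDeriv T (spaceTime f) (t, x, p)).comp
      ((ContinuousLinearMap.inr ℝ ℝ (E3 × E3)).comp (ContinuousLinearMap.inr ℝ E3 E3))) p :=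
  (hasFDerivAt_slab (G := spaceTime f) h.contDiffOn_f ht (x, p)).comp (f := fun q => (x, q)) p
    ((hasFDerivAt_const x p).prodMk (hasFDerivAt_id p))

lemma IsClassicalSolution.slabDeriv_characteristic_eq_zero (h : IsClassicalSolution T f EL ET B)
    {t : ℝ} (ht : t ∈ Ico 0 T) (x p : E3) :
    slabDeriv T (spaceTime f) (t, x, p) (1, velocity p, force EL ET B t x p) = 0 := by
  have hpos := h.hasFDerivAt_pos ht x p
  have hmom := h.hasFDerivAt_mom ht x p
  have htime : derivWithin (fun s => f s x p) (Ico 0 T) t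
      = slabDeriv T (spaceTime f) (t, x, p) (1, 0, 0) :=
    derivWithin_slab (G := spaceTime f) h.contDiffOn_f ht (x, p)
  have hvlasov := h.vlasov t ht x p
  rw [inner_gradient hpos.differentiableAt, inner_gradient hmom.differentiableAt, hpos.fderiv,
    hmom.fderiv, htime] at hvlasov
  have hdir : ((1 : ℝ), velocity p, force EL ET B t x p)
      = (1, 0, 0) + (0, velocity p, 0) + (0, 0, force EL ET B t x p) := by
    simp only [Prod.mk_add_mk, add_zero, zero_add]
  rw [hdir, map_add, map_add]
  exact hvlasov

lemma IsClassicalSolution.eq_initial (h : IsClassicalSolution T f EL ET B) {t : ℝ}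
    (ht : t ∈ Ico 0 T) {X P : ℝ → E3} (hc : IsCharacteristic (force EL ET B) t X P) :
    f t (X t) (P t) = f 0 (X 0) (P 0) := by
  have hsub : ∀ s ∈ Icc 0 t, s ∈ Ico 0 T := fun s hs => ⟨hs.1, hs.2.trans_lt ht.2⟩
  have hconst : ∀ s ∈ Icc 0 t, HasDerivWithinAt (fun s => f s (X s) (P s)) 0 (Icc 0 t) s := by
    intro s hs
    have hcurve : HasDerivWithinAt (fun s => (s, X s, P s))
        ((1 : ℝ), velocity (P s), force EL ET B s (X s) (P s)) (Icc 0 t) s :=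
      (hasDerivWithinAt_id s _).prodMk ((hc.pos s hs).prodMk (hc.mom s hs))
    have hmaps : MapsTo (fun s => (s, X s, P s)) (Icc 0 t) (Ico 0 T ×ˢ (univ : Set (E3 × E3))) :=
      fun τ hτ => ⟨hsub τ hτ, mem_univ _⟩
    exact ((hasFDerivWithinAt_slab (G := spaceTime f) h.contDiffOn_f (hsub s hs)
      (X s, P s)).comp_hasDerivWithinAt s hcurve hmaps).congr_deriv
        (h.slabDeriv_characteristic_eq_zero (hsub s hs) (X s) (P s))
  refine constant_of_derivWithin_zero (fun s hs => (hconst s hs).differentiableWithinAt)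
    (fun s hs => ?_) t (right_mem_Icc.2 ht.1)
  exact (hconst s (Ico_subset_Icc_self hs)).derivWithin
    (uniqueDiffOn_Icc (hs.1.trans_lt hs.2) s (Ico_subset_Icc_self hs))

end Solution

/-- The part of `InitialData` that the decay estimates depend on: a distribution function with
values in `[0,1]`, Lipschitz constant `1` in position and in momentum, and support in the closed
balls of radius `R₀` and `P₀`. -/
structure LipschitzData (R₀ P₀ : ℝ) (g : E3 → E3 → ℝ) : Prop where
  nonneg : ∀ x p, 0 ≤ g x p
  le_one : ∀ x p, g x p ≤ 1
  abs_sub_le : ∀ x y p q, |g x p - g y q| ≤ ‖x - y‖ + ‖p - q‖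
  norm_le : ∀ {x p}, g x p ≠ 0 → ‖x‖ ≤ R₀ ∧ ‖p‖ ≤ P₀

section Data

variable {R₀ P₀ : ℝ} {g : E3 → E3 → ℝ}

lemma InitialData.norm_fderiv_le (h : InitialData R₀ P₀ g) (x p : E3) :
    ‖fderiv ℝ (fun y => g y p) x‖ ≤ 1 ∧ ‖fderiv ℝ (fun q => g x q) p‖ ≤ 1 := by
  have hgrad := h.gradient_le_one x p
  simp only [gradient, LinearIsometryEquiv.norm_map] at hgrad
  exact ⟨(Real.le_sqrt_of_sq_le (le_add_of_nonneg_right (sq_nonneg _))).trans hgrad,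
    (Real.le_sqrt_of_sq_le (le_add_of_nonneg_left (sq_nonneg _))).trans hgrad⟩

lemma InitialData.lipschitzData (h : InitialData R₀ P₀ g) : LipschitzData R₀ P₀ g := by
  have hdiff : Differentiable ℝ fun z : E3 × E3 => g z.1 z.2 :=
    h.contDiff.differentiable two_ne_zero
  refine ⟨h.nonneg, fun x p => (le_abs_self _).trans (h.le_one x p), fun x y p q => ?_,
    fun {x p} hne => ?_⟩
  · have hpos : |g x p - g y p| ≤ 1 * ‖x - y‖ :=
      norm_sub_le_of_norm_fderiv_le (F := fun z => g z p)
        (hdiff.comp (f := fun z => (z, p)) (by fun_prop)) (fun z => (h.norm_fderiv_le z p).1) x y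
    have hmom : |g y p - g y q| ≤ 1 * ‖p - q‖ :=
      norm_sub_le_of_norm_fderiv_le (F := fun r => g y r)
        (hdiff.comp (f := fun r => (y, r)) (by fun_prop)) (fun r => (h.norm_fderiv_le y r).2) p q
    linarith [_root_.abs_sub_le (g x p) (g y p) (g y q)]
  · have hmem := h.support (subset_tsupport _ (a := (x, p)) hne)
    simp only [mem_prod, mem_ball_zero_iff] at hmem
    exact ⟨hmem.1.le, hmem.2.le⟩

end Data

/-- The constant in the bound `O(1/t)` for the diameter of the momentum support at a fixed
position. -/
def dispersion (R₀ P₀ : ℝ) : ℝ := 4 * R₀ / monoConst (3 * (P₀ + 1))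

/-- The properties of a distribution function `g` at time `t` which has dispersed from data in
`LipschitzData R₀ P₀` under a weak force. -/
structure DensityBounds (R₀ P₀ t : ℝ) (g : E3 → E3 → ℝ) : Prop where
  nonneg : ∀ x p, 0 ≤ g x p
  le_one : ∀ x p, g x p ≤ 1
  pos_le : ∀ {x p}, g x p ≠ 0 → ‖x‖ ≤ R₀ + t
  mom_le : ∀ {x p}, g x p ≠ 0 → ‖p‖ ≤ P₀ + 1
  mom_sub_le : ∀ {x p q}, g x p ≠ 0 → g x q ≠ 0 → t * ‖p - q‖ ≤ dispersion R₀ P₀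
  abs_sub_le : ∀ x y p, |g x p - g y p| ≤ 3 * ‖x - y‖

section Solution

variable {T : ℝ} {f : ℝ → E3 → E3 → ℝ} {EL ET B : ℝ → E3 → E3} {R₀ P₀ α a t : ℝ} {X P : ℝ → E3}

lemma IsCharacteristic.norm_mom_le (hc : IsCharacteristic (force EL ET B) t X P)
    (hK : DecayingForce α a (force EL ET B)) (hα6 : α ≤ 1 / 6) (ht : t ∈ Icc 0 a)
    (hP : ‖P 0‖ ≤ P₀) {s : ℝ} (hs : s ∈ Icc 0 t) : ‖P s‖ ≤ P₀ + 1 := by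
  have hend := hc.norm_mom_sub_le hK ht (left_mem_Icc.2 ht.1)
  have htail := hc.norm_mom_sub_le hK ht hs
  have htri := norm_sub_le_norm_sub_add_norm_sub (P 0) (P t) (P s)
  linarith [norm_sub_norm_le (P s) (P 0), norm_sub_rev (P s) (P 0), norm_sub_rev (P 0) (P t)]

lemma IsClassicalSolution.densityBounds (h : IsClassicalSolution T f EL ET B) (hα : 0 ≤ α)
    (hα6 : α ≤ 1 / 6) (hαP : 36 * α ≤ monoConst (3 * (P₀ + 1)))
    (hI : LipschitzData R₀ P₀ (f 0)) (ha : a < T) (hfs : FreeStreaming α a EL ET B)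
    (ht : t ∈ Icc 0 a) : DensityBounds R₀ P₀ t (f t) := by
  have hK := h.decayingForce hα ha hfs
  have htT : t ∈ Ico 0 T := ⟨ht.1, ht.2.trans_lt ha⟩
  have hstart : ∀ {X P : ℝ → E3}, IsCharacteristic (force EL ET B) t X P → f t (X t) (P t) ≠ 0 →
      ‖X 0‖ ≤ R₀ ∧ ∀ s ∈ Icc 0 t, ‖P s‖ ≤ P₀ + 1 := fun hc hne =>
    have hball := hI.norm_le (h.eq_initial htT hc ▸ hne)
    ⟨hball.1, fun s hs => hc.norm_mom_le hK hα6 ht hball.2 hs⟩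
  have hthrough := hK.exists_isCharacteristic ht
  refine ⟨fun x p => ?_, fun x p => ?_, fun {x p} hne => ?_, fun {x p} hne => ?_,
    fun {x p q} hp hq => ?_, fun x y p => ?_⟩
  · obtain ⟨X, P, hc, rfl, rfl⟩ := hthrough x p
    exact h.eq_initial htT hc ▸ hI.nonneg _ _
  · obtain ⟨X, P, hc, rfl, rfl⟩ := hthrough x p
    exact h.eq_initial htT hc ▸ hI.le_one _ _
  · obtain ⟨X, P, hc, rfl, rfl⟩ := hthrough x p
    linarith [(hstart hc hne).1, hc.norm_pos_sub_le ht.1, norm_sub_norm_le (X t) (X 0)]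
  · obtain ⟨X, P, hc, rfl, rfl⟩ := hthrough x p
    exact (hstart hc hne).2 t (right_mem_Icc.2 ht.1)
  · obtain ⟨X, P, hc, rfl, rfl⟩ := hthrough x p
    obtain ⟨Y, Q, hc', hY, rfl⟩ := hthrough (X t) q
    rw [← hY] at hq
    obtain ⟨hX₀, hP⟩ := hstart hc hp
    obtain ⟨hY₀, hQ⟩ := hstart hc' hq
    have hapart := hc.norm_sub_ge_of_pos_eq hc' hK hα6 ht hαP hY.symm hP
      (hQ t (right_mem_Icc.2 ht.1))
    rw [dispersion, le_div_iff₀ (monoConst_pos _)]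
    linarith [norm_sub_le (X 0) (Y 0)]
  · obtain ⟨X, P, hc, rfl, rfl⟩ := hthrough x p
    obtain ⟨Y, Q, hc', rfl, hQ⟩ := hthrough y (P t)
    have hclose := hc.norm_sub_le_of_mom_eq hc' hK hα6 ht hQ.symm
    calc |f t (X t) (P t) - f t (Y t) (P t)| = |f 0 (X 0) (P 0) - f 0 (Y 0) (Q 0)| := by
          rw [h.eq_initial htT hc, ← h.eq_initial htT hc', hQ]
      _ ≤ ‖X 0 - Y 0‖ + ‖P 0 - Q 0‖ := hI.abs_sub_le _ _ _ _
      _ ≤ 3 * ‖X t - Y t‖ := by linarith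

end Solution

/-! ### Weak form of the div-curl system -/

lemma integral_pd_mul_pd_comm {ι : Type*} [Fintype ι] [DecidableEq ι]
    {F g : EuclideanSpace ℝ ι → ℝ} (hF : Differentiable ℝ F) (hF' : ∀ k, Continuous (pd k F))
    (hg : IsTest g) (i k : ι) :
    ∫ y, pd i F y * pd k g y = ∫ y, pd k F y * pd i g y := by
  have hik := integral_mul_pd hF (hF' i) (hg.pd k)
  rw [pd_comm hg.smooth, integral_mul_pd hF (hF' k) (hg.pd i)] at hik
  exact (neg_injective hik).symm

lemma integral_mul_laplacian {ι : Type*} [Fintype ι] [DecidableEq ι]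
    {F g : EuclideanSpace ℝ ι → ℝ} (hF : Differentiable ℝ F) (hF' : ∀ k, Continuous (pd k F))
    (hg : IsTest g) : ∫ y, F y * Δ g y = -∑ k, ∫ y, pd k F y * pd k g y := by
  simp only [laplacian_eq_sum_pd hg.smooth, Finset.mul_sum]
  rw [integral_finsetSum _ fun k _ => integrable_mul_test hF.continuous ((hg.pd k).pd k),
    ← Finset.sum_neg_distrib]
  exact Finset.sum_congr rfl fun k _ => integral_mul_pd hF (hF' k) (hg.pd k)

section Coord

variable {F : E3 → E3}

lemma hasFDerivAt_coord {L : E3 →L[ℝ] E3} {x : E3} (hF : HasFDerivAt F L x) (i : Fin 3) :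
    HasFDerivAt (fun y => F y i) ((EuclideanSpace.proj i : E3 →L[ℝ] ℝ).comp L) x :=
  (EuclideanSpace.proj i : E3 →L[ℝ] ℝ).hasFDerivAt.comp x hF

lemma differentiable_coord (hF : Differentiable ℝ F) (i : Fin 3) :
    Differentiable ℝ fun y => F y i :=
  fun x => (hasFDerivAt_coord (hF x).hasFDerivAt i).differentiableAt

lemma pd_coord (hF : Differentiable ℝ F) (k i : Fin 3) :
    pd k (fun y => F y i) = partialD F k i := by
  ext x
  rw [pd, (hasFDerivAt_coord (hF x).hasFDerivAt i).fderiv]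
  rfl

lemma continuous_partialD (hF' : Continuous (fderiv ℝ F)) (k i : Fin 3) :
    Continuous (partialD F k i) := by
  unfold partialD
  fun_prop

lemma continuous_curl (hF' : Continuous (fderiv ℝ F)) (i : Fin 3) :
    Continuous fun y => curl F y i := by
  have hc := continuous_partialD hF'
  fin_cases i
  · exact (hc 1 2).sub (hc 2 1)
  · exact (hc 2 0).sub (hc 0 2)
  · exact (hc 0 1).sub (hc 1 0)

lemma curl_apply (F : E3 → E3) (x : E3) (i : Fin 3) :
    curl F x i = partialD F (i + 1) (i + 2) x - partialD F (i + 2) (i + 1) x := by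
  fin_cases i <;> rfl

lemma sum_partialD_sub_mul (F : E3 → E3) (x : E3) (d : Fin 3 → ℝ) (i : Fin 3) :
    ∑ k, (partialD F k i x - partialD F i k x) * d k
      = curl F x (i + 1) * d (i + 2) - curl F x (i + 2) * d (i + 1) := by
  fin_cases i <;>
    simp only [curl_apply, Fin.sum_univ_three, Fin.zero_eta, Fin.mk_one, Fin.reduceFinMk,
      Fin.reduceAdd, Fin.isValue, zero_add] <;>
    ring

/-- The `i`-th component of `∫ F × ∇g`. Indices are added modulo `3`. -/
def integralCross (F : E3 → E3) (g : E3 → ℝ) (i : Fin 3) : ℝ :=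
  (∫ y, F y (i + 1) * pd (i + 2) g y) - ∫ y, F y (i + 2) * pd (i + 1) g y

variable {g : E3 → ℝ}

lemma integralCross_eq_integral_curl_mul (hF : Differentiable ℝ F) (hF' : Continuous (fderiv ℝ F))
    (hg : IsTest g) (i : Fin 3) : integralCross F g i = ∫ y, curl F y i * g y := by
  have hparts : ∀ k l, ∫ y, F y k * pd l g y = -∫ y, partialD F l k y * g y := fun k l => by
    have hc := pd_coord hF l k ▸ continuous_partialD hF' l k
    rw [integral_mul_pd (differentiable_coord hF k) hc hg, pd_coord hF]
  have hint : ∀ k l, Integrable fun y => partialD F k l y * g y := fun k l =>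
    integrable_mul_test (continuous_partialD hF' k l) hg
  simp only [curl_apply, sub_mul]
  rw [integral_sub (hint _ _) (hint _ _), integralCross, hparts, hparts]
  ring

lemma integral_mul_laplacian_eq_sub_integralCross (hF : Differentiable ℝ F)
    (hF' : Continuous (fderiv ℝ F)) (hg : IsTest g) (i : Fin 3) :
    ∫ y, F y i * Δ g y = -(∫ y, divergence F y * pd i g y) - integralCross (curl F) g i := by
  have hd := differentiable_coord hF
  have hc : ∀ i k, Continuous (pd k fun y => F y i) := fun i k =>
    pd_coord hF k i ▸ continuous_partialD hF' k i
  have hint : ∀ k l m, Integrable fun y => partialD F k l y * pd m g y := fun k l m =>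
    integrable_mul_test (continuous_partialD hF' k l) (hg.pd m)
  have hdiv : ∫ y, divergence F y * pd i g y = ∑ k, ∫ y, partialD F i k y * pd k g y := by
    simp only [divergence, Finset.sum_mul]
    rw [integral_finsetSum _ fun k _ => hint k k i]
    refine Finset.sum_congr rfl fun k _ => ?_
    simpa only [pd_coord hF] using integral_pd_mul_pd_comm (hd k) (hc k) hg k i
  have hpoint : ∀ y, curl F y (i + 1) * pd (i + 2) g y - curl F y (i + 2) * pd (i + 1) g y
      = ∑ k, (partialD F k i y * pd k g y - partialD F i k y * pd k g y) := fun y => by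
    simp only [← sum_partialD_sub_mul F y (fun k => pd k g y) i, ← sub_mul]
  have hcurl : integralCross (curl F) g i
      = ∑ k, ((∫ y, partialD F k i y * pd k g y) - ∫ y, partialD F i k y * pd k g y) := by
    rw [integralCross, ← integral_sub (integrable_mul_test (continuous_curl hF' _) (hg.pd _))
      (integrable_mul_test (continuous_curl hF' _) (hg.pd _))]
    simp only [hpoint]
    have hsub : ∀ k, Integrable fun y =>
        partialD F k i y * pd k g y - partialD F i k y * pd k g y := fun k =>
      (hint k i k).sub (hint i k k)
    rw [integral_finsetSum _ fun k _ => hsub k]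
    exact Finset.sum_congr rfl fun k _ => integral_sub (hint k i k) (hint i k k)
  rw [integral_mul_laplacian (hd i) (hc i) hg, hdiv, hcurl, Finset.sum_sub_distrib]
  simp only [pd_coord hF]
  ring

end Coord

/-! ### Differentiation under the integral sign -/

lemma hasDerivAt_integral_of_compact {Z W : Type*} [TopologicalSpace Z] [MeasurableSpace Z]
    [OpensMeasurableSpace Z] [SecondCountableTopology Z] [T2Space Z] [NormedAddCommGroup W]
    [NormedSpace ℝ W] {μ : Measure Z} [IsFiniteMeasureOnCompacts μ] {U U' : ℝ → Z → W} {b c t : ℝ}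
    (ht : t ∈ Ioo b c) {S : Set Z} (hS : IsCompact S) (hU : ∀ s ∈ Ioo b c, Continuous (U s))
    (hU' : ContinuousOn (fun z : ℝ × Z => U' z.1 z.2) (Ioo b c ×ˢ univ))
    (hderiv : ∀ s ∈ Ioo b c, ∀ z, HasDerivAt (fun s => U s z) (U' s z) s)
    (hzero : ∀ s ∈ Ioo b c, ∀ z ∉ S, U s z = 0) :
    HasDerivAt (fun s => ∫ z, U s z ∂μ) (∫ z, U' t z ∂μ) t := by
  have hzero' : ∀ s ∈ Ioo b c, ∀ z ∉ S, U' s z = 0 := by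
    intro s hs z hz
    have hev : (fun s => U s z) =ᶠ[𝓝 s] fun _ => 0 :=
      Filter.eventuallyEq_of_mem (isOpen_Ioo.mem_nhds hs) fun s hs => hzero s hs z hz
    exact (hderiv s hs z).unique ((hasDerivAt_const s (0 : W)).congr_of_eventuallyEq hev)
  obtain ⟨δ, hδ, hsub⟩ := Metric.nhds_basis_closedBall.mem_iff.1 (isOpen_Ioo.mem_nhds ht)
  obtain ⟨C, hC⟩ := ((isCompact_closedBall t δ).prod hS).exists_bound_of_continuousOn
    (hU'.mono (prod_mono hsub (subset_univ _)))
  have hcont : Continuous (U' t) :=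
    hU'.comp_continuous (f := fun z => (t, z)) (by fun_prop) fun z => ⟨ht, mem_univ _⟩
  refine (hasDerivAt_integral_of_dominated_loc_of_deriv_le (s := Metric.closedBall t δ)
    (bound := S.indicator fun _ => C) (Metric.closedBall_mem_nhds t hδ) ?_ ?_
    hcont.aestronglyMeasurable (ae_of_all _ fun z s hs => ?_) ?_
    (ae_of_all _ fun z s hs => hderiv s (hsub hs) z)).2
  · filter_upwards [isOpen_Ioo.mem_nhds ht] with s hs using (hU s hs).aestronglyMeasurable
  · exact (hU t ht).integrable_of_hasCompactSupport (HasCompactSupport.intro hS (hzero t ht))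
  · by_cases hz : z ∈ S
    · rw [indicator_of_mem hz]
      exact hC (s, z) ⟨hs, hz⟩
    · rw [indicator_of_notMem hz, hzero' s (hsub hs) z hz, norm_zero]
  · exact (integrable_indicator_iff hS.measurableSet).2 (integrableOn_const hS.measure_lt_top.ne)

/-- The time derivative of a field on the time slab `[0,T[ × ℝ³`, one-sided at `t = 0`. -/
def timeDeriv (T : ℝ) (F : ℝ → E3 → E3) (t : ℝ) (y : E3) : E3 :=
  slabDeriv T (fun z : ℝ × E3 => F z.1 z.2) (t, y) (1, 0)

section Field

variable {T : ℝ} {F : ℝ → E3 → E3}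

lemma continuousOn_timeDeriv
    (hF : ContDiffOn ℝ 1 (fun z : ℝ × E3 => F z.1 z.2) (Ico 0 T ×ˢ univ)) :
    ContinuousOn (fun z : ℝ × E3 => timeDeriv T F z.1 z.2) (Ico 0 T ×ˢ univ) :=
  (continuousOn_slabDeriv hF).clm_apply continuousOn_const

lemma continuous_timeDeriv
    (hF : ContDiffOn ℝ 1 (fun z : ℝ × E3 => F z.1 z.2) (Ico 0 T ×ˢ univ)) {t : ℝ}
    (ht : t ∈ Ico 0 T) : Continuous (timeDeriv T F t) :=
  (continuousOn_timeDeriv hF).comp_continuous (f := fun y => (t, y)) (by fun_prop)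
    fun y => ⟨ht, mem_univ _⟩

lemma hasDerivAt_integral_field
    (hF : ContDiffOn ℝ 1 (fun z : ℝ × E3 => F z.1 z.2) (Ico 0 T ×ˢ univ)) {t : ℝ}
    (ht : t ∈ Ioo 0 T) {g : E3 → ℝ} (hg : IsTest g) (i : Fin 3) :
    HasDerivAt (fun s => ∫ y, F s y i * g y) (∫ y, timeDeriv T F t y i * g y) t := by
  have hgc := hg.continuous
  refine hasDerivAt_integral_of_compact (U := fun s y => F s y i * g y)
    (U' := fun s y => timeDeriv T F s y i * g y) ht hg.compact
    (fun s hs => ?_) ?_ (fun s hs y => ?_) fun s _ y hy => ?_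
  · have : Continuous (F s) := (differentiable_slab hF (Ioo_subset_Ico_self hs)).continuous
    fun_prop
  · have hcoord : ContinuousOn (fun z : ℝ × E3 => timeDeriv T F z.1 z.2 i) (Ioo 0 T ×ˢ univ) :=
      (EuclideanSpace.proj i : E3 →L[ℝ] ℝ).continuous.comp_continuousOn
        ((continuousOn_timeDeriv hF).mono (prod_mono Ioo_subset_Ico_self Subset.rfl))
    exact hcoord.mul (by fun_prop)
  · exact ((EuclideanSpace.proj i : E3 →L[ℝ] ℝ).hasFDerivAt.comp_hasDerivAt s
      (hasDerivAt_slab hF hs y)).mul_const (g y)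
  · simp only [image_eq_zero_of_notMem_tsupport hy, mul_zero]

lemma hasDerivAt_integralCross
    (hF : ContDiffOn ℝ 1 (fun z : ℝ × E3 => F z.1 z.2) (Ico 0 T ×ˢ univ)) {t : ℝ}
    (ht : t ∈ Ioo 0 T) {g : E3 → ℝ} (hg : IsTest g) (i : Fin 3) :
    HasDerivAt (fun s => integralCross (F s) g i) (integralCross (timeDeriv T F t) g i) t :=
  (hasDerivAt_integral_field hF ht (hg.pd (i + 2)) (i + 1)).sub
    (hasDerivAt_integral_field hF ht (hg.pd (i + 1)) (i + 2))

end Field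

section Solution

variable {T : ℝ} {f : ℝ → E3 → E3 → ℝ} {EL ET B : ℝ → E3 → E3} {t : ℝ} {g : E3 → ℝ}

lemma IsClassicalSolution.continuous_fderiv_EL (h : IsClassicalSolution T f EL ET B)
    (ht : t ∈ Ico 0 T) : Continuous (fderiv ℝ (EL t)) := continuous_fderiv_slab h.contDiffOn_EL ht

lemma IsClassicalSolution.continuous_fderiv_B (h : IsClassicalSolution T f EL ET B)
    (ht : t ∈ Ico 0 T) : Continuous (fderiv ℝ (B t)) := continuous_fderiv_slab h.contDiffOn_B ht

lemma IsClassicalSolution.continuous_fderiv_ET (h : IsClassicalSolution T f EL ET B)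
    (ht : t ∈ Ico 0 T) : Continuous (fderiv ℝ (ET t)) :=
  h.continuousOn_fderiv_ET.comp_continuous (f := fun y => (t, y)) (by fun_prop)
    fun y => ⟨ht, mem_univ _⟩

lemma IsClassicalSolution.integral_EL_mul_laplacian (h : IsClassicalSolution T f EL ET B)
    (ht : t ∈ Ico 0 T) (hg : IsTest g) (i : Fin 3) :
    ∫ y, EL t y i * Δ g y = -∫ y, chargeDensity f t y * pd i g y := by
  rw [integral_mul_laplacian_eq_sub_integralCross (h.differentiable_EL ht)
    (h.continuous_fderiv_EL ht) hg, integralCross]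
  simp only [h.curl_EL t ht, h.gauss t ht, PiLp.zero_apply, zero_mul, integral_zero, sub_zero]

lemma IsClassicalSolution.integralCross_EL (h : IsClassicalSolution T f EL ET B)
    (ht : t ∈ Ico 0 T) (hg : IsTest g) (i : Fin 3) : integralCross (EL t) g i = 0 := by
  rw [integralCross_eq_integral_curl_mul (h.differentiable_EL ht) (h.continuous_fderiv_EL ht) hg]
  simp only [h.curl_EL t ht, PiLp.zero_apply, zero_mul, integral_zero]

lemma IsClassicalSolution.integralCross_timeDeriv_EL (h : IsClassicalSolution T f EL ET B)
    (ht : t ∈ Ioo 0 T) (hg : IsTest g) (i : Fin 3) :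
    integralCross (timeDeriv T EL t) g i = 0 := by
  refine (hasDerivAt_integralCross h.contDiffOn_EL ht hg i).unique
    ((hasDerivAt_const t (0 : ℝ)).congr_of_eventuallyEq ?_)
  filter_upwards [isOpen_Ioo.mem_nhds ht] with s hs
  exact h.integralCross_EL (Ioo_subset_Ico_self hs) hg i

lemma IsClassicalSolution.curl_B (h : IsClassicalSolution T f EL ET B) (ht : t ∈ Ico 0 T)
    (y : E3) : curl (B t) y = currentDensity f t y + timeDeriv T EL t y := by
  have hE : derivWithin (fun s => EL s y) (Ico 0 T) t = timeDeriv T EL t y :=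
    derivWithin_slab h.contDiffOn_EL ht y
  rw [← hE, ← neg_neg (currentDensity f t y), ← h.ampere t ht y]
  abel

lemma IsClassicalSolution.curl_ET (h : IsClassicalSolution T f EL ET B) (ht : t ∈ Ico 0 T)
    (y : E3) : curl (ET t) y = -timeDeriv T B t y := by
  have hB : derivWithin (fun s => B s y) (Ico 0 T) t = timeDeriv T B t y :=
    derivWithin_slab h.contDiffOn_B ht y
  rw [← hB]
  exact eq_neg_of_add_eq_zero_right (h.faraday t ht y)

lemma IsClassicalSolution.integral_B_mul_laplacian (h : IsClassicalSolution T f EL ET B)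
    (ht : t ∈ Ioo 0 T) (hg : IsTest g) (i : Fin 3) :
    ∫ y, B t y i * Δ g y = -integralCross (currentDensity f t) g i := by
  have ht' : t ∈ Ico 0 T := Ioo_subset_Ico_self ht
  have hcurl : ∀ k l, ∫ y, currentDensity f t y k * pd l g y
      = (∫ y, curl (B t) y k * pd l g y) - ∫ y, timeDeriv T EL t y k * pd l g y := fun k l => by
    have hcE : Continuous fun y => timeDeriv T EL t y k := by
      have := continuous_timeDeriv h.contDiffOn_EL ht'
      fun_prop
    rw [← integral_sub (integrable_mul_test (continuous_curl (h.continuous_fderiv_B ht') k)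
      (hg.pd l)) (integrable_mul_test hcE (hg.pd l))]
    simp only [h.curl_B ht', PiLp.add_apply, add_mul, add_sub_cancel_right]
  have hE := h.integralCross_timeDeriv_EL ht hg i
  rw [integral_mul_laplacian_eq_sub_integralCross (h.differentiable_B ht')
    (h.continuous_fderiv_B ht') hg]
  simp only [h.div_B t ht', zero_mul, integral_zero, neg_zero]
  simp only [integralCross, hcurl] at hE ⊢
  linarith

lemma IsClassicalSolution.integral_ET_mul_laplacian (h : IsClassicalSolution T f EL ET B)
    (ht : t ∈ Ico 0 T) (hg : IsTest g) (i : Fin 3) :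
    ∫ y, ET t y i * Δ g y = integralCross (timeDeriv T B t) g i := by
  rw [integral_mul_laplacian_eq_sub_integralCross (h.differentiable_ET t ht)
    (h.continuous_fderiv_ET ht) hg]
  simp only [h.div_ET t ht, integralCross, h.curl_ET ht, PiLp.neg_apply, neg_mul, integral_neg,
    zero_mul, integral_zero]
  ring

/-- `E_T` solves a Poisson equation with source `∂ₜ ∇ × B`, and `B` one with source `∇ × j`:
a second Laplacian trades the unknown `∂ₜB` for `∂ₜj`. -/
lemma IsClassicalSolution.hasDerivAt_integralCross_currentDensity
    (h : IsClassicalSolution T f EL ET B) (ht : t ∈ Ioo 0 T) (hg : IsTest g) (i : Fin 3) :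
    HasDerivAt (fun s => integralCross (currentDensity f s) (pd (i + 1) g) (i + 2)
        - integralCross (currentDensity f s) (pd (i + 2) g) (i + 1))
      (∫ y, ET t y i * Δ (Δ g) y) t := by
  rw [h.integral_ET_mul_laplacian (Ioo_subset_Ico_self ht) hg.laplacian]
  refine (hasDerivAt_integralCross h.contDiffOn_B ht hg.laplacian i).congr_of_eventuallyEq ?_
  filter_upwards [isOpen_Ioo.mem_nhds ht] with s hs
  rw [integralCross.eq_def (B s), pd_laplacian hg.smooth, pd_laplacian hg.smooth,
    h.integral_B_mul_laplacian hs (hg.pd (i + 2)), h.integral_B_mul_laplacian hs (hg.pd (i + 1))]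
  ring

end Solution

/-! ### Weak form of the Vlasov equation -/

section Divergence

variable {V : Type*} [NormedAddCommGroup V] [NormedSpace ℝ V] [FiniteDimensional ℝ V]
  [MeasurableSpace V] [BorelSpace V] {μ : Measure V} [μ.IsAddHaarMeasure]

lemma integral_fderiv_apply_eq_zero {φ : V → ℝ} (hφ : ContDiff ℝ 1 φ) (hc : HasCompactSupport φ)
    (w : V) : ∫ z, fderiv ℝ φ z w ∂μ = 0 := by
  have hd : Integrable (fun z => fderiv ℝ φ z w) μ :=
    ((hφ.continuous_fderiv one_ne_zero).clm_apply
      continuous_const).integrable_of_hasCompactSupport (hc.fderiv_apply (𝕜 := ℝ) w)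
  have hparts := integral_mul_fderiv_eq_neg_fderiv_mul_of_integrable (μ := μ) (v := w)
    (f := fun _ => (1 : ℝ)) (g := φ) (by simp) (by simpa using hd)
    (by simpa using hφ.continuous.integrable_of_hasCompactSupport hc)
    (fun z _ => differentiableAt_const 1) fun z _ => hφ.differentiable one_ne_zero z
  simpa using hparts

lemma integral_trace_fderiv_eq_zero {Y : V → V} (hY : ContDiff ℝ 1 Y)
    (hc : HasCompactSupport Y) : ∫ z, LinearMap.trace ℝ V (fderiv ℝ Y z) ∂μ = 0 := by
  let b := Module.finBasis ℝ V
  let c : Fin (Module.finrank ℝ V) → V →L[ℝ] ℝ := fun i => (b.coord i).toContinuousLinearMap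
  have hcY : ∀ i, ContDiff ℝ 1 fun z => c i (Y z) := fun i => (c i).contDiff.comp hY
  have hcc : ∀ i, HasCompactSupport fun z => c i (Y z) := fun i => hc.comp_left (map_zero (c i))
  have htrace : ∀ z, LinearMap.trace ℝ V (fderiv ℝ Y z)
      = ∑ i, fderiv ℝ (fun z => c i (Y z)) z (b i) := fun z => by
    rw [LinearMap.trace_eq_matrix_trace ℝ b, Matrix.trace]
    refine Finset.sum_congr rfl fun i _ => ?_
    have hi : HasFDerivAt (fun z => c i (Y z)) ((c i).comp (fderiv ℝ Y z)) z :=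
      (c i).hasFDerivAt.comp z (hY.differentiable one_ne_zero z).hasFDerivAt
    rw [hi.fderiv, Matrix.diag_apply, LinearMap.toMatrix_apply]
    rfl
  simp only [htrace]
  rw [integral_finsetSum _ fun i _ => (((hcY i).continuous_fderiv one_ne_zero).clm_apply
    continuous_const).integrable_of_hasCompactSupport ((hcc i).fderiv_apply (𝕜 := ℝ) (b i))]
  exact Finset.sum_eq_zero fun i _ => integral_fderiv_apply_eq_zero (hcY i) (hcc i) (b i)

lemma integral_fderiv_apply_mul {G Φ : V → ℝ} {X : V → V} (hG : ContDiff ℝ 1 G)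
    (hc : HasCompactSupport G) (hΦ : ContDiff ℝ 1 Φ) (hX : ContDiff ℝ 1 X)
    (htr : ∀ z, LinearMap.trace ℝ V (fderiv ℝ X z) = 0) :
    ∫ z, fderiv ℝ G z (X z) * Φ z ∂μ = -∫ z, G z * fderiv ℝ Φ z (X z) ∂μ := by
  have hdiv : ∀ z, LinearMap.trace ℝ V (fderiv ℝ (fun z => (G z * Φ z) • X z) z)
      = fderiv ℝ G z (X z) * Φ z + G z * fderiv ℝ Φ z (X z) := fun z => by
    have hGΦ := (hG.differentiable one_ne_zero z).hasFDerivAt.fun_mul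
      (hΦ.differentiable one_ne_zero z).hasFDerivAt
    rw [(hGΦ.fun_smul (hX.differentiable one_ne_zero z).hasFDerivAt).fderiv,
      ContinuousLinearMap.toLinearMap_add, ContinuousLinearMap.toLinearMap_smul, map_add,
      map_smul, htr, smul_zero, zero_add]
    refine (LinearMap.trace_smulRight _ (X z)).trans ?_
    simp only [ContinuousLinearMap.coe_coe, add_apply,
      smul_apply, smul_eq_mul]
    ring
  have hG' := hG.continuous_fderiv one_ne_zero
  have hΦ' := hΦ.continuous_fderiv one_ne_zero
  have hXc := hX.continuous
  have hleft : Integrable (fun z => fderiv ℝ G z (X z) * Φ z) μ := by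
    refine ((hG'.clm_apply hXc).mul hΦ.continuous).integrable_of_hasCompactSupport ?_
    refine HasCompactSupport.mul_right (HasCompactSupport.intro (hc.fderiv (𝕜 := ℝ)) fun z hz => ?_)
    rw [image_eq_zero_of_notMem_tsupport hz, zero_apply]
  have hright : Integrable (fun z => G z * fderiv ℝ Φ z (X z)) μ :=
    (hG.continuous.mul (hΦ'.clm_apply hXc)).integrable_of_hasCompactSupport hc.mul_right
  have hzero := integral_trace_fderiv_eq_zero (μ := μ) (Y := fun z => (G z * Φ z) • X z)
    ((hG.mul hΦ).smul hX) hc.mul_right.smul_right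
  simp only [hdiv] at hzero
  rw [integral_add hleft hright] at hzero
  exact eq_neg_of_add_eq_zero_left hzero

end Divergence

lemma trace_prod {R M N : Type*} [CommRing R] [AddCommGroup M] [Module R M] [AddCommGroup N]
    [Module R N] [Module.Free R M] [Module.Finite R M] [Module.Free R N] [Module.Finite R N]
    (L : M × N →ₗ[R] M × N) :
    LinearMap.trace R (M × N) L
      = LinearMap.trace R M (LinearMap.fst R M N ∘ₗ L ∘ₗ LinearMap.inl R M N)
        + LinearMap.trace R N (LinearMap.snd R M N ∘ₗ L ∘ₗ LinearMap.inr R M N) := by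
  have hsplit : L = LinearMap.inl R M N ∘ₗ (LinearMap.fst R M N ∘ₗ L)
      + LinearMap.inr R M N ∘ₗ (LinearMap.snd R M N ∘ₗ L) := by
    ext <;> simp
  conv_lhs => rw [hsplit]
  rw [map_add, LinearMap.trace_comp_comm',
    LinearMap.trace_comp_comm' (_ ∘ₗ L) (LinearMap.inr R M N)]
  rfl

instance : (volume : Measure (E3 × E3)).IsAddHaarMeasure :=
  inferInstanceAs ((volume : Measure E3).prod (volume : Measure E3)).IsAddHaarMeasure

lemma trace_eq_sum_coord (L : E3 →ₗ[ℝ] E3) :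
    LinearMap.trace ℝ E3 L = ∑ k, L (EuclideanSpace.single k 1) k := by
  rw [LinearMap.trace_eq_sum_inner L (EuclideanSpace.basisFun (Fin 3) ℝ)]
  simp [EuclideanSpace.inner_single_left]

lemma cross_coord (u w : E3) (k : Fin 3) :
    cross u w k = u (k + 1) * w (k + 2) - u (k + 2) * w (k + 1) := by
  fin_cases k <;> simp [cross, cross_apply]

lemma contDiff_cross {V : Type*} [NormedAddCommGroup V] [NormedSpace ℝ V] {n : WithTop ℕ∞}
    {u w : V → E3} (hu : ContDiff ℝ n u) (hw : ContDiff ℝ n w) :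
    ContDiff ℝ n fun z => cross (u z) (w z) := by
  rw [contDiff_euclidean] at hu hw ⊢
  intro i
  simp only [cross_coord]
  exact ((hu _).mul (hw _)).sub ((hu _).mul (hw _))

/-- The phase-space vector field `(v(p), K(t,x,p))` along which the Vlasov equation transports. -/
def transportField (EL ET B : ℝ → E3 → E3) (t : ℝ) (z : E3 × E3) : E3 × E3 :=
  (velocity z.2, force EL ET B t z.1 z.2)

section Solution

variable {T : ℝ} {f : ℝ → E3 → E3 → ℝ} {EL ET B : ℝ → E3 → E3} {t : ℝ}

lemma IsClassicalSolution.contDiff_transportField (h : IsClassicalSolution T f EL ET B)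
    (ht : t ∈ Ico 0 T) : ContDiff ℝ 1 (transportField EL ET B t) := by
  have hEL : ContDiff ℝ 1 (EL t) :=
    contDiff_one_iff_fderiv.2 ⟨h.differentiable_EL ht, h.continuous_fderiv_EL ht⟩
  have hET : ContDiff ℝ 1 (ET t) :=
    contDiff_one_iff_fderiv.2 ⟨h.differentiable_ET t ht, h.continuous_fderiv_ET ht⟩
  have hB : ContDiff ℝ 1 (B t) :=
    contDiff_one_iff_fderiv.2 ⟨h.differentiable_B ht, h.continuous_fderiv_B ht⟩
  have hv : ContDiff ℝ 1 fun z : E3 × E3 => velocity z.2 := contDiff_velocity.comp contDiff_snd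
  exact hv.prodMk (((hEL.comp contDiff_fst).add (hET.comp contDiff_fst)).add
    (contDiff_cross hv (hB.comp contDiff_fst)))

lemma fderiv_force_mom (EL ET B : ℝ → E3 → E3) (t : ℝ) (x p u : E3) (k : Fin 3) :
    fderiv ℝ (fun q => force EL ET B t x q) p u k
      = cross (fderiv ℝ velocity p u) (B t x) k := by
  have hd : DifferentiableAt ℝ (fun q => force EL ET B t x q) p :=
    (differentiableAt_const _).add
      ((contDiff_cross (contDiff_velocity (n := 1)) contDiff_const).differentiable one_ne_zero p)
  have hv : ∀ i, HasFDerivAt (fun q => velocity q i) _ p := fun i => hasFDerivAt_coord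
    ((contDiff_velocity (n := 1)).differentiable one_ne_zero p).hasFDerivAt i
  have hk : HasFDerivAt (fun q => force EL ET B t x q k) _ p :=
    ((((hv (k + 1)).mul_const (B t x (k + 2))).sub ((hv (k + 2)).mul_const
      (B t x (k + 1)))).const_add (EL t x k + ET t x k)).congr_of_eventuallyEq
      (Eventually.of_forall fun q => by simp [force, cross_coord])
  have := congrArg (fun L : E3 →L[ℝ] ℝ => L u)
    ((hasFDerivAt_coord hd.hasFDerivAt k).unique hk)
  simpa [cross_coord, mul_comm] using this

/-- The matrix `Dv` is symmetric, so that `p ↦ v(p) × B` is divergence free. -/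
lemma sum_cross_fderiv_velocity (p b : E3) :
    ∑ k, cross (fderiv ℝ velocity p (EuclideanSpace.single k 1)) b k = 0 := by
  have hsymm := fderiv_velocity_symm p
  simp only [cross_coord, Fin.sum_univ_three, Fin.isValue, zero_add, Fin.reduceAdd]
  rw [hsymm 1 0, hsymm 2 0, hsymm 2 1]
  ring

lemma IsClassicalSolution.trace_fderiv_transportField (h : IsClassicalSolution T f EL ET B)
    (ht : t ∈ Ico 0 T) (z : E3 × E3) :
    LinearMap.trace ℝ (E3 × E3) (fderiv ℝ (transportField EL ET B t) z) = 0 := by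
  obtain ⟨x, p⟩ := z
  set L := fderiv ℝ (transportField EL ET B t) (x, p)
  have hX : HasFDerivAt (transportField EL ET B t) L (x, p) :=
    ((h.contDiff_transportField ht).differentiable one_ne_zero (x, p)).hasFDerivAt
  have hXpos := hX.comp (f := fun y => (y, p)) x (hasFDerivAt_prodMk_left x p)
  have hXmom := hX.comp (f := fun q => (x, q)) p (hasFDerivAt_prodMk_right x p)
  have hpos : HasFDerivAt (fun _ : E3 => velocity p)
      ((ContinuousLinearMap.fst ℝ E3 E3).comp (L.comp (ContinuousLinearMap.inl ℝ E3 E3))) x :=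
    (ContinuousLinearMap.fst ℝ E3 E3).hasFDerivAt.comp x hXpos
  have hmom : HasFDerivAt (fun q => force EL ET B t x q)
      ((ContinuousLinearMap.snd ℝ E3 E3).comp (L.comp (ContinuousLinearMap.inr ℝ E3 E3))) p :=
    (ContinuousLinearMap.snd ℝ E3 E3).hasFDerivAt.comp p hXmom
  calc LinearMap.trace ℝ (E3 × E3) L
    _ = LinearMap.trace ℝ E3 ((ContinuousLinearMap.fst ℝ E3 E3).comp
          (L.comp (ContinuousLinearMap.inl ℝ E3 E3)))
        + LinearMap.trace ℝ E3 ((ContinuousLinearMap.snd ℝ E3 E3).comp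
          (L.comp (ContinuousLinearMap.inr ℝ E3 E3))) := trace_prod _
    _ = ∑ k, cross (fderiv ℝ velocity p (EuclideanSpace.single k 1)) (B t x) k := by
      rw [hpos.unique (hasFDerivAt_const _ x), ContinuousLinearMap.toLinearMap_zero, map_zero,
        zero_add, ← hmom.fderiv, trace_eq_sum_coord]
      simp only [ContinuousLinearMap.coe_coe, fderiv_force_mom]
    _ = 0 := sum_cross_fderiv_velocity p (B t x)

lemma IsClassicalSolution.contDiff_f (h : IsClassicalSolution T f EL ET B)
    (ht : t ∈ Ico 0 T) : ContDiff ℝ 1 fun z : E3 × E3 => f t z.1 z.2 :=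
  contDiff_one_iff_fderiv.2 ⟨differentiable_slab (G := spaceTime f) h.contDiffOn_f ht,
    continuous_fderiv_slab (G := spaceTime f) h.contDiffOn_f ht⟩

lemma IsClassicalSolution.slabDeriv_time (h : IsClassicalSolution T f EL ET B)
    (ht : t ∈ Ico 0 T) (z : E3 × E3) :
    slabDeriv T (spaceTime f) (t, z) (1, 0)
      = -fderiv ℝ (fun z : E3 × E3 => f t z.1 z.2) z (transportField EL ET B t z) := by
  have hspace : fderiv ℝ (fun z : E3 × E3 => f t z.1 z.2) z
      = (slabDeriv T (spaceTime f) (t, z)).comp (ContinuousLinearMap.inr ℝ ℝ (E3 × E3)) :=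
    (hasFDerivAt_slab (G := spaceTime f) h.contDiffOn_f ht z).fderiv
  have hvlasov := h.slabDeriv_characteristic_eq_zero ht z.1 z.2
  have hdir : ((1 : ℝ), velocity z.2, force EL ET B t z.1 z.2)
      = (1, 0) + (0, transportField EL ET B t z) := by
    simp only [Prod.mk_add_mk, add_zero, zero_add, transportField]
  rw [hdir, map_add] at hvlasov
  rw [hspace]
  exact eq_neg_of_add_eq_zero_left hvlasov

lemma IsClassicalSolution.hasDerivAt_integral_mul (h : IsClassicalSolution T f EL ET B)
    {a : ℝ} (ha : a < T) {S : Set (E3 × E3)} (hS : IsCompact S)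
    (hfS : ∀ s ∈ Ioo 0 a, ∀ z ∉ S, f s z.1 z.2 = 0) (ht : t ∈ Ioo 0 a) {Φ : E3 × E3 → ℝ}
    (hΦ : ContDiff ℝ 1 Φ) :
    HasDerivAt (fun s => ∫ z : E3 × E3, f s z.1 z.2 * Φ z)
      (∫ z : E3 × E3, f t z.1 z.2 * fderiv ℝ Φ z (transportField EL ET B t z)) t := by
  have hsub : ∀ s ∈ Ioo 0 a, s ∈ Ioo 0 T := fun s hs => ⟨hs.1, hs.2.trans ha⟩
  have hsub' : ∀ s ∈ Ioo 0 a, s ∈ Ico 0 T := fun s hs => Ioo_subset_Ico_self (hsub s hs)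
  have hΦc := hΦ.continuous
  have htime : ContinuousOn (fun z : ℝ × E3 × E3 => slabDeriv T (spaceTime f) (z.1, z.2) (1, 0))
      (Ioo 0 a ×ˢ univ) :=
    ((continuousOn_slabDeriv (G := spaceTime f) h.contDiffOn_f).clm_apply
      continuousOn_const).mono (prod_mono hsub' Subset.rfl)
  have hder := hasDerivAt_integral_of_compact (μ := (volume : Measure (E3 × E3)))
    (U := fun s z => f s z.1 z.2 * Φ z)
    (U' := fun s z => slabDeriv T (spaceTime f) (s, z) (1, 0) * Φ z) ht hS
    (fun s hs => (h.contDiff_f (hsub' s hs)).continuous.mul hΦc) (htime.mul (by fun_prop))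
    (fun s hs z => (hasDerivAt_slab (G := spaceTime f) h.contDiffOn_f (hsub s hs) z).mul_const _)
    fun s hs z hz => by rw [hfS s hs z hz, zero_mul]
  refine hder.congr_deriv ?_
  simp only [h.slabDeriv_time (hsub' t ht), neg_mul, integral_neg]
  rw [integral_fderiv_apply_mul (h.contDiff_f (hsub' t ht)) (h.compact_f t (hsub' t ht)) hΦ
    (h.contDiff_transportField (hsub' t ht)) (h.trace_fderiv_transportField (hsub' t ht)), neg_neg]

end Solution

section Moments

lemma continuous_coord {Z : Type*} [TopologicalSpace Z] {u : Z → E3} (hu : Continuous u)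
    (k : Fin 3) : Continuous fun z => u z k :=
  (EuclideanSpace.proj k : E3 →L[ℝ] ℝ).continuous.comp hu

lemma continuous_velocity_coord (k : Fin 3) : Continuous fun p => velocity p k :=
  continuous_coord (contDiff_velocity (n := 0)).continuous k

lemma sum_coord_smul_single (u : E3) :
    ∑ k, u k • (EuclideanSpace.single k 1 : E3) = u := by
  simpa using (EuclideanSpace.basisFun (Fin 3) ℝ).sum_repr u

lemma fderiv_apply_eq_sum_pd (k : E3 → ℝ) (x u : E3) :
    fderiv ℝ k x u = ∑ l, u l * pd l k x := by
  conv_lhs => rw [← sum_coord_smul_single u, map_sum]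
  simp only [map_smul, smul_eq_mul, pd]

lemma hasCompactSupport_slice {X Y R : Type*} [TopologicalSpace X] [TopologicalSpace Y]
    [R1Space Y] [Zero R] {g : X → Y → R} (hc : HasCompactSupport fun z : X × Y => g z.1 z.2)
    (x : X) : HasCompactSupport (g x) :=
  HasCompactSupport.intro (hc.image continuous_snd) fun y hy =>
    image_eq_zero_of_notMem_tsupport (x := (x, y)) fun hz => hy ⟨(x, y), hz, rfl⟩

lemma integral_moment_mul {g : E3 → E3 → ℝ} (hg : Continuous fun z : E3 × E3 => g z.1 z.2)
    (hc : HasCompactSupport fun z : E3 × E3 => g z.1 z.2) {w k : E3 → ℝ} (hw : Continuous w)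
    (hk : Continuous k) :
    ∫ x, (∫ p, g x p * w p) * k x = ∫ z : E3 × E3, g z.1 z.2 * w z.2 * k z.1 := by
  have hcont : Continuous fun z : E3 × E3 => g z.1 z.2 * w z.2 * k z.1 := by fun_prop
  rw [Measure.volume_eq_prod,
    integral_prod _ (hcont.integrable_of_hasCompactSupport hc.mul_right.mul_right)]
  exact integral_congr_ae (ae_of_all _ fun x => (integral_mul_const (k x) _).symm)

variable {T : ℝ} {f : ℝ → E3 → E3 → ℝ} {EL ET B : ℝ → E3 → E3} {t : ℝ} {k : E3 → ℝ}

lemma IsClassicalSolution.currentDensity_apply (h : IsClassicalSolution T f EL ET B)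
    (ht : t ∈ Ico 0 T) (x : E3) (n : Fin 3) :
    currentDensity f t x n = ∫ p, f t x p * velocity p n := by
  have hcont : Continuous fun p => f t x p • velocity p := by
    have hf : Continuous fun p => f t x p :=
      (h.contDiff_f ht).continuous.comp (by fun_prop : Continuous fun p : E3 => (x, p))
    exact hf.smul (contDiff_velocity (n := 0)).continuous
  have hint : Integrable fun p => f t x p • velocity p :=
    hcont.integrable_of_hasCompactSupport (hasCompactSupport_slice (h.compact_f t ht) x).smul_right
  exact ((EuclideanSpace.proj n : E3 →L[ℝ] ℝ).integral_comp_comm hint).symm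

lemma IsClassicalSolution.integral_chargeDensity_mul (h : IsClassicalSolution T f EL ET B)
    (ht : t ∈ Ico 0 T) (hk : Continuous k) :
    ∫ x, chargeDensity f t x * k x = ∫ z : E3 × E3, f t z.1 z.2 * 1 * k z.1 := by
  simpa only [mul_one, chargeDensity] using
    integral_moment_mul (h.contDiff_f ht).continuous (h.compact_f t ht)
      (w := fun _ => 1) continuous_const hk

lemma IsClassicalSolution.integral_currentDensity_mul (h : IsClassicalSolution T f EL ET B)
    (ht : t ∈ Ico 0 T) (hk : Continuous k) (n : Fin 3) :
    ∫ x, currentDensity f t x n * k x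
      = ∫ z : E3 × E3, f t z.1 z.2 * velocity z.2 n * k z.1 := by
  simp only [h.currentDensity_apply ht]
  exact integral_moment_mul (h.contDiff_f ht).continuous (h.compact_f t ht)
    (continuous_velocity_coord n) hk

lemma fderiv_velocity_coord_mul (hk : Differentiable ℝ k) (n : Fin 3) (z w : E3 × E3) :
    fderiv ℝ (fun z : E3 × E3 => velocity z.2 n * k z.1) z w
      = (∑ l, w.1 l * velocity z.2 n * pd l k z.1) + fderiv ℝ velocity z.2 w.2 n * k z.1 := by
  have hv := hasFDerivAt_coord
    ((contDiff_velocity (n := 1)).differentiable one_ne_zero z.2).hasFDerivAt n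
  have hΦ : HasFDerivAt (fun z : E3 × E3 => velocity z.2 n * k z.1) _ z :=
    (hv.comp z hasFDerivAt_snd).mul ((hk z.1).hasFDerivAt.comp z hasFDerivAt_fst)
  calc fderiv ℝ (fun z : E3 × E3 => velocity z.2 n * k z.1) z w
    _ = velocity z.2 n * fderiv ℝ k z.1 w.1 + k z.1 * fderiv ℝ velocity z.2 w.2 n := by
      rw [hΦ.fderiv]
      rfl
    _ = _ := by
      rw [fderiv_apply_eq_sum_pd, Finset.mul_sum, mul_comm (k z.1)]
      exact congrArg (· + _) (Finset.sum_congr rfl fun l _ => by ring)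

lemma IsClassicalSolution.hasDerivAt_integral_currentDensity_mul
    (h : IsClassicalSolution T f EL ET B) {a : ℝ} (ha : a < T) {S : Set (E3 × E3)}
    (hS : IsCompact S) (hfS : ∀ s ∈ Ioo 0 a, ∀ z ∉ S, f s z.1 z.2 = 0) (ht : t ∈ Ioo 0 a)
    (hk : ContDiff ℝ 1 k) (n : Fin 3) :
    HasDerivAt (fun s => ∫ x, currentDensity f s x n * k x)
      ((∑ l, ∫ z : E3 × E3, f t z.1 z.2 * (velocity z.2 l * velocity z.2 n) * pd l k z.1)
        + ∫ z : E3 × E3, f t z.1 z.2 * (fderiv ℝ velocity z.2 (force EL ET B t z.1 z.2) n * k z.1))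
      t := by
  have hsub : ∀ s ∈ Ioo 0 a, s ∈ Ico 0 T := fun s hs => ⟨hs.1.le, hs.2.trans ha⟩
  have hkc := hk.continuous
  have hfc := (h.contDiff_f (hsub t ht)).continuous
  have hfs := h.compact_f t (hsub t ht)
  have hX := (h.contDiff_transportField (hsub t ht)).continuous
  have hpd : ∀ l, Continuous fun z : E3 × E3 => pd l k z.1 := fun l =>
    ((hk.continuous_fderiv one_ne_zero).clm_apply continuous_const).comp continuous_fst
  have hv : ∀ l, Continuous fun z : E3 × E3 => velocity z.2 l := fun l =>
    (continuous_velocity_coord l).comp continuous_snd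
  have hDv : Continuous fun z : E3 × E3 =>
      fderiv ℝ velocity z.2 (force EL ET B t z.1 z.2) n :=
    continuous_coord ((((contDiff_velocity (n := 1)).continuous_fderiv one_ne_zero).comp
      continuous_snd).clm_apply hX.snd) n
  have hpos : ∀ l ∈ Finset.univ, Integrable fun z : E3 × E3 =>
      f t z.1 z.2 * (velocity z.2 l * velocity z.2 n) * pd l k z.1 := fun l _ =>
    ((hfc.mul ((hv l).mul (hv n))).mul (hpd l)).integrable_of_hasCompactSupport
      hfs.mul_right.mul_right
  have hmom : Integrable fun z : E3 × E3 =>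
      f t z.1 z.2 * (fderiv ℝ velocity z.2 (force EL ET B t z.1 z.2) n * k z.1) :=
    (hfc.mul (hDv.mul (hkc.comp continuous_fst))).integrable_of_hasCompactSupport hfs.mul_right
  have hΦ : ContDiff ℝ 1 fun z : E3 × E3 => velocity z.2 n * k z.1 :=
    (((contDiff_euclidean.1 contDiff_velocity) n).comp contDiff_snd).mul (hk.comp contDiff_fst)
  refine ((h.hasDerivAt_integral_mul ha hS hfS ht hΦ).congr_of_eventuallyEq ?_).congr_deriv ?_
  · filter_upwards [isOpen_Ioo.mem_nhds ht] with s hs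
    simp only [h.integral_currentDensity_mul (hsub s hs) hkc, mul_assoc]
  · rw [← integral_finsetSum _ hpos, ← integral_add (integrable_finsetSum _ hpos) hmom]
    refine integral_congr_ae (ae_of_all _ fun z => ?_)
    simp only [fderiv_velocity_coord_mul (hk.differentiable one_ne_zero), transportField, mul_add,
      Finset.mul_sum, mul_assoc]

lemma integral_mul_pd_fst {g : E3 × E3 → ℝ} (hg : ContDiff ℝ 1 g) (hc : HasCompactSupport g)
    {w : E3 → ℝ} (hw : Continuous w) (hk : ContDiff ℝ 1 k) (l : Fin 3) :
    ∫ z, g z * w z.2 * pd l k z.1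
      = -∫ z, fderiv ℝ g z (EuclideanSpace.single l 1, 0) * w z.2 * k z.1 := by
  have hwc : Continuous fun z : E3 × E3 => w z.2 := hw.comp continuous_snd
  have hkc : Continuous fun z : E3 × E3 => k z.1 := hk.continuous.comp continuous_fst
  have hpd : Continuous fun z : E3 × E3 => pd l k z.1 :=
    ((hk.continuous_fderiv one_ne_zero).clm_apply continuous_const).comp continuous_fst
  have hdg : Continuous fun z => fderiv ℝ g z (EuclideanSpace.single l 1, 0) :=
    (hg.continuous_fderiv one_ne_zero).clm_apply continuous_const
  have hline : ∀ z, HasLineDerivAt ℝ (fun z : E3 × E3 => w z.2 * k z.1) (w z.2 * pd l k z.1) z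
      (EuclideanSpace.single l 1, 0) := fun z => by
    have hk' := ((hk.differentiable one_ne_zero z.1).hasFDerivAt.comp z
      hasFDerivAt_fst).hasLineDerivAt (EuclideanSpace.single l 1, 0)
    refine (HasDerivAt.const_mul (w z.2) hk').congr_of_eventuallyEq
      (Eventually.of_forall fun s => ?_)
    simp only [Prod.snd_add, Prod.smul_snd, smul_zero, add_zero, Function.comp_apply]
  have hparts := integral_bilinear_hasLineDerivAt_right_eq_neg_left_of_integrable (μ := volume)
    (B := ContinuousLinearMap.mul ℝ ℝ) (f := g)
    (f' := fun z => fderiv ℝ g z (EuclideanSpace.single l 1, 0))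
    ((hdg.mul (hwc.mul hkc)).integrable_of_hasCompactSupport
      (hc.fderiv_apply (𝕜 := ℝ) _).mul_right)
    ((hg.continuous.mul (hwc.mul hpd)).integrable_of_hasCompactSupport hc.mul_right)
    ((hg.continuous.mul (hwc.mul hkc)).integrable_of_hasCompactSupport hc.mul_right)
    (fun z _ => (hg.differentiable one_ne_zero z).hasFDerivAt.hasLineDerivAt _) fun z _ => hline z
  simpa only [ContinuousLinearMap.mul_apply', Pi.mul_apply, mul_assoc] using hparts

end Moments

/-! ### Integrals of power kernels -/

section PowerKernel

open Module (finrank)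

variable {V : Type*} [NormedAddCommGroup V]

/-- The kernel `|y - x|^(-β)` cut off at distance `L` from `x`. -/
def nearKernel (β L : ℝ) (x y : V) : ℝ := (Iic L).indicator (fun r => r ^ (-β)) ‖y - x‖

lemma nearKernel_of_le {β L : ℝ} {x y : V} (h : ‖y - x‖ ≤ L) :
    nearKernel β L x y = ‖y - x‖ ^ (-β) := indicator_of_mem (s := Iic L) h _

lemma nearKernel_nonneg (β L : ℝ) (x y : V) : 0 ≤ nearKernel β L x y :=
  indicator_apply_nonneg fun _ => Real.rpow_nonneg (norm_nonneg _) _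

/-- A majorant of `|y - x|^(-β)` on the ball of radius `L` around the origin, with an integral
bounded uniformly in `x`. -/
def ballKernel (β L : ℝ) (x y : V) : ℝ :=
  nearKernel β L x y + (Metric.closedBall (0 : V) L).indicator (fun _ => L ^ (-β)) y

lemma ballKernel_nonneg (β : ℝ) {L : ℝ} (hL : 0 < L) (x y : V) : 0 ≤ ballKernel β L x y :=
  add_nonneg (nearKernel_nonneg _ _ _ _)
    (indicator_apply_nonneg fun _ => Real.rpow_nonneg hL.le _)

lemma rpow_neg_le_ballKernel {β L : ℝ} (hβ : 0 ≤ β) (hL : 0 < L) {x y : V} (hy : ‖y‖ ≤ L) :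
    ‖y - x‖ ^ (-β) ≤ ballKernel β L x y := by
  rw [ballKernel, indicator_of_mem (mem_closedBall_zero_iff.2 hy)]
  rcases le_or_gt ‖y - x‖ L with hnear | hfar
  · rw [nearKernel_of_le hnear]
    exact le_add_of_nonneg_right (Real.rpow_nonneg hL.le _)
  · exact (Real.rpow_le_rpow_of_nonpos hL hfar.le (neg_nonpos.2 hβ)).trans
      (le_add_of_nonneg_left (nearKernel_nonneg β L x y))

variable [NormedSpace ℝ V] [FiniteDimensional ℝ V] [MeasurableSpace V] [BorelSpace V]
  (μ : Measure V) [μ.IsAddHaarMeasure] {β L : ℝ}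

lemma integrable_indicator_closedBall_const (c : ℝ) :
    Integrable ((Metric.closedBall (0 : V) L).indicator fun _ => c) μ :=
  (integrable_indicator_iff measurableSet_closedBall).2
    (integrableOn_const measure_closedBall_lt_top.ne)

lemma norm_integral_le_of_norm_sub_le {E : Type*} [NormedAddCommGroup E] [NormedSpace ℝ E]
    {u : V → E} {A d : ℝ} (hd : 0 ≤ d) (hu : ∀ p, ‖u p‖ ≤ A)
    (hsupp : ∀ p q, u p ≠ 0 → u q ≠ 0 → ‖p - q‖ ≤ d) :
    ‖∫ p, u p ∂μ‖ ≤ A * (μ.real (Metric.ball 0 1) * d ^ finrank ℝ V) := by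
  have hA : 0 ≤ A := (norm_nonneg _).trans (hu 0)
  by_cases hz : ∃ q, u q ≠ 0
  · obtain ⟨q, hq⟩ := hz
    have hball : ∀ p ∉ Metric.closedBall q d, u p = 0 := fun p hp =>
      of_not_not fun hne => hp (mem_closedBall_iff_norm.2 (hsupp p q hne hq))
    rw [← setIntegral_eq_integral_of_forall_compl_eq_zero hball,
      mul_comm (μ.real _), ← Measure.addHaar_real_closedBall μ q hd]
    exact norm_setIntegral_le_of_norm_le_const measure_closedBall_lt_top fun p _ => hu p
  · push Not at hz
    simp only [hz, integral_zero, norm_zero]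
    positivity

variable [Nontrivial V]

lemma pow_finrank_smul_indicator_rpow (V : Type*) [NormedAddCommGroup V] [NormedSpace ℝ V]
    [FiniteDimensional ℝ V] [Nontrivial V] (β L : ℝ) :
    EqOn (fun r : ℝ => r ^ (finrank ℝ V - 1) • (Iic L).indicator (fun r => r ^ (-β)) r)
      ((Ioc 0 L).indicator fun r => r ^ (finrank ℝ V - 1 - β)) (Ioi 0) := by
  intro r (hr : 0 < r)
  simp only [smul_eq_mul, indicator_apply, mem_Iic, mem_Ioc, hr, true_and, mul_ite, mul_zero]
  congr 1
  rw [← Real.rpow_natCast, Nat.cast_pred Module.finrank_pos, ← Real.rpow_add hr, sub_eq_add_neg _ β]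

lemma integrable_nearKernel (hβ : β < finrank ℝ V) (hL : 0 ≤ L) (x : V) :
    Integrable (nearKernel β L x) μ := by
  have hcentred : Integrable (fun z : V => (Iic L).indicator (fun r : ℝ => r ^ (-β)) ‖z‖) μ := by
    rw [integrable_fun_norm_addHaar μ (f := (Iic L).indicator fun r : ℝ => r ^ (-β)),
      integrableOn_congr_fun (pow_finrank_smul_indicator_rpow V β L) measurableSet_Ioi]
    refine ((integrable_indicator_iff measurableSet_Ioc).2 ?_).integrableOn
    rw [← intervalIntegrable_iff_integrableOn_Ioc_of_le hL]
    exact intervalIntegral.intervalIntegrable_rpow' (by linarith)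
  exact hcentred.comp_sub_right x

lemma integral_nearKernel (hβ : β < finrank ℝ V) (hL : 0 ≤ L) (x : V) :
    ∫ y, nearKernel β L x y ∂μ
      = finrank ℝ V / (finrank ℝ V - β) * μ.real (Metric.ball 0 1) * L ^ (finrank ℝ V - β) := by
  have htranslate : ∫ y, nearKernel β L x y ∂μ
      = ∫ z : V, (Iic L).indicator (fun r : ℝ => r ^ (-β)) ‖z‖ ∂μ :=
    integral_sub_right_eq_self (fun z : V => (Iic L).indicator (fun r : ℝ => r ^ (-β)) ‖z‖) x
  have hradial : ∫ r in Ioi (0 : ℝ), (Ioc 0 L).indicator (fun r => r ^ (finrank ℝ V - 1 - β)) r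
      = L ^ (finrank ℝ V - β) / (finrank ℝ V - β) := by
    rw [setIntegral_indicator measurableSet_Ioc, inter_eq_self_of_subset_right Ioc_subset_Ioi_self,
      ← intervalIntegral.integral_of_le hL, integral_rpow (Or.inl (by linarith)),
      Real.zero_rpow (by linarith), sub_zero]
    ring_nf
  rw [htranslate, integral_fun_norm_addHaar μ ((Iic L).indicator fun r : ℝ => r ^ (-β)),
    setIntegral_congr_fun measurableSet_Ioi (pow_finrank_smul_indicator_rpow V β L), hradial,
    nsmul_eq_mul, smul_eq_mul]
  ring

lemma integrable_ballKernel (hβ : β < finrank ℝ V) (hL : 0 ≤ L) (x : V) :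
    Integrable (ballKernel β L x) μ :=
  (integrable_nearKernel μ hβ hL x).add (integrable_indicator_closedBall_const μ _)

lemma integral_ballKernel (hβ : β < finrank ℝ V) (hL : 0 < L) (x : V) :
    ∫ y, ballKernel β L x y ∂μ = (finrank ℝ V / (finrank ℝ V - β) + 1)
      * μ.real (Metric.ball 0 1) * L ^ (finrank ℝ V - β) := by
  simp only [ballKernel]
  rw [integral_add (integrable_nearKernel μ hβ hL.le x) (integrable_indicator_closedBall_const μ _),
    integral_nearKernel μ hβ hL.le, integral_indicator measurableSet_closedBall, setIntegral_const,
    Measure.addHaar_real_closedBall μ _ hL.le, smul_eq_mul, sub_eq_add_neg _ β, Real.rpow_add hL,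
    Real.rpow_natCast]
  ring

end PowerKernel

/-! ### Estimates for moments of the distribution function -/

section Density

variable {R₀ P₀ t A : ℝ} {g : E3 → E3 → ℝ} {u : E3 × E3 → ℝ}

lemma dispersion_nonneg (hR₀ : 0 ≤ R₀) : 0 ≤ dispersion R₀ P₀ :=
  div_nonneg (by positivity) (monoConst_pos _).le

/-- The constant in the `t⁻³` decay of momentum integrals of the distribution function. -/
def momentConst (R₀ P₀ : ℝ) : ℝ :=
  volume.real (Metric.ball (0 : E3) 1) * dispersion R₀ P₀ ^ 3

lemma momentConst_nonneg (hR₀ : 0 ≤ R₀) : 0 ≤ momentConst R₀ P₀ :=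
  mul_nonneg measureReal_nonneg (pow_nonneg (dispersion_nonneg hR₀) 3)

/-- `u` is a continuous, compactly supported density of size at most `A` that vanishes where `g`
does: the form in which `g` itself, its products with momentum weights, and its derivatives enter
the moment estimates. -/
structure DominatedBy (g : E3 → E3 → ℝ) (A : ℝ) (u : E3 × E3 → ℝ) : Prop where
  continuous : Continuous u
  hasCompactSupport : HasCompactSupport u
  abs_le : ∀ z, |u z| ≤ A
  apply_ne_zero : ∀ z, u z ≠ 0 → g z.1 z.2 ≠ 0

lemma DominatedBy.nonneg (hu : DominatedBy g A u) : 0 ≤ A := (abs_nonneg _).trans (hu.abs_le 0)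

lemma DominatedBy.mul {w : E3 × E3 → ℝ} {B : ℝ} (hu : DominatedBy g A u) (hw : Continuous w)
    (hwB : ∀ z, g z.1 z.2 ≠ 0 → |w z| ≤ B) (hB : 0 ≤ B) :
    DominatedBy g (A * B) fun z => u z * w z where
  continuous := hu.continuous.mul hw
  hasCompactSupport := hu.hasCompactSupport.mul_right
  abs_le z := by
    rcases eq_or_ne (u z) 0 with hz | hz
    · simpa only [hz, zero_mul, abs_zero] using mul_nonneg hu.nonneg hB
    · rw [abs_mul]
      exact mul_le_mul (hu.abs_le z) (hwB z (hu.apply_ne_zero z hz)) (abs_nonneg _) hu.nonneg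
  apply_ne_zero z hz := hu.apply_ne_zero z (left_ne_zero_of_mul hz)

lemma DominatedBy.abs_integral_le (hu : DominatedBy g A u) (hg : DensityBounds R₀ P₀ t g)
    (hR₀ : 0 ≤ R₀) (ht : 0 < t) (y : E3) :
    |∫ p, u (y, p)| ≤ A * (momentConst R₀ P₀ * t ^ (-3 : ℝ)) := by
  refine (norm_integral_le_of_norm_sub_le volume (d := dispersion R₀ P₀ / t)
    (div_nonneg (dispersion_nonneg hR₀) ht.le) (u := fun p => u (y, p))
    (fun p => hu.abs_le (y, p)) fun p q hp hq => ?_).trans_eq ?_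
  · rw [le_div_iff₀' ht]
    exact hg.mom_sub_le (hu.apply_ne_zero (y, p) hp) (hu.apply_ne_zero (y, q) hq)
  · rw [finrank_euclideanSpace_fin, momentConst, Real.rpow_neg ht.le, div_pow, ← div_eq_mul_inv,
      mul_div_assoc]
    norm_cast

lemma DominatedBy.abs_integral_mul_le (hu : DominatedBy g A u) (hg : DensityBounds R₀ P₀ t g)
    (hR₀ : 0 ≤ R₀) (ht : 0 < t) {k b : E3 → ℝ} (hk : Continuous k) (hb : Integrable b)
    (hb₀ : ∀ y, 0 ≤ b y) {x : E3} (hkb : ∀ y, y ≠ x → ‖y‖ ≤ R₀ + t → |k y| ≤ b y) :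
    |∫ z, u z * k z.1| ≤ A * (momentConst R₀ P₀ * t ^ (-3 : ℝ)) * ∫ y, b y := by
  have hint : Integrable (fun z : E3 × E3 => u z * k z.1) (volume.prod volume) :=
    (hu.continuous.mul (hk.comp continuous_fst)).integrable_of_hasCompactSupport
      hu.hasCompactSupport.mul_right
  have hmoment := fun y => hu.abs_integral_le hg hR₀ ht y
  have hconst := (abs_nonneg _).trans (hmoment x)
  rw [Measure.volume_eq_prod, integral_prod _ hint, ← integral_const_mul, ← Real.norm_eq_abs]
  refine norm_integral_le_of_norm_le (hb.const_mul _) ?_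
  filter_upwards [Measure.ae_ne volume x] with y hy
  rw [integral_mul_const, Real.norm_eq_abs, abs_mul]
  by_cases hyL : ‖y‖ ≤ R₀ + t
  · exact mul_le_mul (hmoment y) (hkb y hy hyL) (abs_nonneg _) hconst
  · have hvanish : ∀ p, u (y, p) = 0 := fun p =>
      of_not_not fun hne => hyL (hg.pos_le (hu.apply_ne_zero (y, p) hne))
    simp only [hvanish, integral_zero, abs_zero, zero_mul]
    exact mul_nonneg hconst (hb₀ y)

/-- The integral of `ballKernel β 1 x` over space. -/
def ballConst (β : ℝ) : ℝ := (3 / (3 - β) + 1) * volume.real (Metric.ball (0 : E3) 1)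

lemma ballConst_nonneg {β : ℝ} (hβ : β < 3) : 0 ≤ ballConst β :=
  mul_nonneg (add_nonneg (div_nonneg zero_le_three (sub_pos.2 hβ).le) zero_le_one)
    measureReal_nonneg

/-- The constant in the decay of the integral of a dominated density against a kernel of size
`|y - x|^(-β)`. -/
def sourceConst (R₀ P₀ β : ℝ) : ℝ :=
  momentConst R₀ P₀ * ballConst β * (2 * R₀ + 1) ^ (3 - β)

lemma sourceConst_nonneg (hR₀ : 0 ≤ R₀) {β : ℝ} (hβ : β < 3) : 0 ≤ sourceConst R₀ P₀ β :=
  mul_nonneg (mul_nonneg (momentConst_nonneg hR₀) (ballConst_nonneg hβ))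
    (Real.rpow_nonneg (by positivity) _)

lemma rpow_neg_three_mul_add_rpow_le (hR₀ : 0 ≤ R₀) (ht : 1 / 2 ≤ t) {β : ℝ} (hβ : β ≤ 3) :
    t ^ (-3 : ℝ) * (R₀ + t) ^ (3 - β) ≤ (2 * R₀ + 1) ^ (3 - β) * t ^ (-β) := by
  have ht₀ : 0 < t := by linarith
  calc t ^ (-3 : ℝ) * (R₀ + t) ^ (3 - β)
      ≤ t ^ (-3 : ℝ) * ((2 * R₀ + 1) * t) ^ (3 - β) := by
        refine mul_le_mul_of_nonneg_left ?_ (Real.rpow_nonneg ht₀.le _)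
        exact Real.rpow_le_rpow (by positivity) (by nlinarith) (sub_nonneg.2 hβ)
    _ = (2 * R₀ + 1) ^ (3 - β) * t ^ (-β) := by
        rw [Real.mul_rpow (by positivity) ht₀.le, mul_left_comm, ← Real.rpow_add ht₀]
        ring_nf

lemma DominatedBy.abs_integral_mul_le_rpow (hu : DominatedBy g A u)
    (hg : DensityBounds R₀ P₀ t g) (hR₀ : 0 ≤ R₀) (ht : 1 / 2 ≤ t) {k : E3 → ℝ}
    (hk : Continuous k) {x : E3} {C β : ℝ} (hC : 0 ≤ C) (hβ₀ : 0 ≤ β) (hβ : β < 3)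
    (hkb : ∀ y, y ≠ x → |k y| ≤ C * ‖y - x‖ ^ (-β)) :
    |∫ z, u z * k z.1| ≤ A * C * sourceConst R₀ P₀ β * t ^ (-β) := by
  have ht₀ : 0 < t := by linarith
  have hL : 0 < R₀ + t := by linarith
  have hdim : (Module.finrank ℝ E3 : ℝ) = 3 := by rw [finrank_euclideanSpace_fin, Nat.cast_ofNat]
  have hconst : 0 ≤ A * C * (momentConst R₀ P₀ * ballConst β) :=
    mul_nonneg (mul_nonneg hu.nonneg hC) (mul_nonneg (momentConst_nonneg hR₀) (ballConst_nonneg hβ))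
  have hmajorant := hu.abs_integral_mul_le hg hR₀ ht₀ hk
    ((integrable_ballKernel volume (hdim ▸ hβ) hL.le x).const_mul C)
    (fun y => mul_nonneg hC (ballKernel_nonneg β hL x y))
    fun y hy hyL => (hkb y hy).trans
      (mul_le_mul_of_nonneg_left (rpow_neg_le_ballKernel hβ₀ hL hyL) hC)
  rw [integral_const_mul, integral_ballKernel volume (hdim ▸ hβ) hL, hdim] at hmajorant
  calc |∫ z, u z * k z.1|
      ≤ A * C * (momentConst R₀ P₀ * ballConst β) * (t ^ (-3 : ℝ) * (R₀ + t) ^ (3 - β)) :=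
        hmajorant.trans_eq (by rw [ballConst]; ring)
    _ ≤ A * C * (momentConst R₀ P₀ * ballConst β) * ((2 * R₀ + 1) ^ (3 - β) * t ^ (-β)) :=
        mul_le_mul_of_nonneg_left (rpow_neg_three_mul_add_rpow_le hR₀ ht hβ.le) hconst
    _ = A * C * sourceConst R₀ P₀ β * t ^ (-β) := by rw [sourceConst]; ring

lemma DensityBounds.abs_fderiv_fst_le (h : DensityBounds R₀ P₀ t g)
    (hd : Differentiable ℝ fun z : E3 × E3 => g z.1 z.2) (z : E3 × E3) (v : E3) :
    |fderiv ℝ (fun z : E3 × E3 => g z.1 z.2) z (v, 0)| ≤ 3 * ‖v‖ := by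
  have hslice : HasFDerivAt (fun y => g y z.2)
      ((fderiv ℝ (fun z : E3 × E3 => g z.1 z.2) z).comp (.inl ℝ E3 E3)) z.1 :=
    HasFDerivAt.comp (g := fun z : E3 × E3 => g z.1 z.2) (f := fun y => (y, z.2)) z.1
      (hd z).hasFDerivAt ((hasFDerivAt_id z.1).prodMk (hasFDerivAt_const z.2 z.1))
  have hnorm : ‖fderiv ℝ (fun y => g y z.2) z.1‖ ≤ ((3 : NNReal) : ℝ) :=
    norm_fderiv_le_of_lipschitz ℝ (LipschitzWith.of_dist_le_mul fun y y' => by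
      simpa only [dist_eq_norm, Real.norm_eq_abs, NNReal.coe_ofNat] using h.abs_sub_le y y' z.2)
  rw [hslice.fderiv] at hnorm
  exact ContinuousLinearMap.le_of_opNorm_le _ hnorm v

lemma DensityBounds.apply_ne_zero_of_fderiv_ne_zero (h : DensityBounds R₀ P₀ t g)
    {z v : E3 × E3} (hv : fderiv ℝ (fun z : E3 × E3 => g z.1 z.2) z v ≠ 0) : g z.1 z.2 ≠ 0 := by
  refine fun hz => hv ?_
  have hmin : IsLocalMin (fun z : E3 × E3 => g z.1 z.2) z :=
    Eventually.of_forall fun _ => hz.trans_le (h.nonneg _ _)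
  rw [hmin.fderiv_eq_zero, zero_apply]

lemma DensityBounds.dominatedBy (h : DensityBounds R₀ P₀ t g)
    (hg : Continuous fun z : E3 × E3 => g z.1 z.2)
    (hc : HasCompactSupport fun z : E3 × E3 => g z.1 z.2) :
    DominatedBy g 1 fun z => g z.1 z.2 where
  continuous := hg
  hasCompactSupport := hc
  abs_le _ := (abs_of_nonneg (h.nonneg _ _)).trans_le (h.le_one _ _)
  apply_ne_zero _ := id

lemma DensityBounds.dominatedBy_fderiv_fst (h : DensityBounds R₀ P₀ t g)
    (hg : ContDiff ℝ 1 fun z : E3 × E3 => g z.1 z.2)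
    (hc : HasCompactSupport fun z : E3 × E3 => g z.1 z.2) (v : E3) :
    DominatedBy g (3 * ‖v‖) fun z => fderiv ℝ (fun z : E3 × E3 => g z.1 z.2) z (v, 0) where
  continuous := (hg.continuous_fderiv one_ne_zero).clm_apply continuous_const
  hasCompactSupport := hc.fderiv_apply (𝕜 := ℝ) (v, 0)
  abs_le z := h.abs_fderiv_fst_le (hg.differentiable one_ne_zero) z v
  apply_ne_zero _ hz := h.apply_ne_zero_of_fderiv_ne_zero hz

lemma rpow_neg_le_four_mul {p q : ℝ} (ht : 1 / 2 ≤ t) (hqp : q ≤ p) (hpq : p ≤ q + 2) :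
    t ^ (-p) ≤ 4 * t ^ (-q) := by
  have ht₀ : 0 < t := by linarith
  have hratio : t ^ (-(p - q)) ≤ 4 := by
    calc t ^ (-(p - q)) ≤ (1 / 2 : ℝ) ^ (-(p - q)) :=
          Real.rpow_le_rpow_of_nonpos one_half_pos ht (by linarith)
      _ = 2 ^ (p - q) := by
        rw [one_div, Real.inv_rpow two_pos.le, Real.rpow_neg two_pos.le, inv_inv]
      _ ≤ 2 ^ (2 : ℝ) := Real.rpow_le_rpow_of_exponent_le one_le_two (by linarith)
      _ = 4 := by norm_num
  calc t ^ (-p) = t ^ (-(p - q)) * t ^ (-q) := by rw [← Real.rpow_add ht₀]; ring_nf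
    _ ≤ 4 * t ^ (-q) := mul_le_mul_of_nonneg_right hratio (Real.rpow_nonneg ht₀.le _)

end Density

/-! ### Estimates for the sources of the fields -/

lemma abs_coord_le (u : E3) (i : Fin 3) : |u i| ≤ ‖u‖ := PiLp.norm_apply_le u i

lemma abs_velocity_coord_le (p : E3) (i : Fin 3) : |velocity p i| ≤ 1 :=
  (abs_coord_le _ i).trans (norm_velocity_le_one p)

/-- Bounds for the two kinds of moment integrals of a distribution function `G` against a test
function `θ` that the field equations produce: `w` is a velocity weight coming from transport in
space, `Dv(p) K` the acceleration due to the force `K`. -/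
structure SourceBound (G : E3 × E3 → ℝ) (K : E3 × E3 → E3) (θ : E3 → ℝ) (Q : ℝ) : Prop where
  transport : ∀ w : E3 → ℝ, Continuous w → (∀ p, |w p| ≤ 1) → ∀ l : List (Fin 3), l.length = 3 →
    |∫ z, G z * w z.2 * pds l θ z.1| ≤ Q
  force : ∀ (n : Fin 3) (l : List (Fin 3)), l.length = 2 →
    |∫ z, G z * (fderiv ℝ velocity z.2 (K z) n * pds l θ z.1)| ≤ Q

section Sources

variable {R₀ P₀ t A C s r : ℝ} {g : E3 → E3 → ℝ} {u : E3 × E3 → ℝ} {K : E3 × E3 → E3}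
  {w : E3 → ℝ} {l : List (Fin 3)}

lemma DominatedBy.mul_weight (hu : DominatedBy g A u) (hw : Continuous w) (hw₁ : ∀ p, |w p| ≤ 1) :
    DominatedBy g A fun z => u z * w z.2 := by
  simpa only [mul_one] using
    hu.mul (w := fun z => w z.2) (hw.comp continuous_snd) (fun z _ => hw₁ z.2) zero_le_one

lemma DominatedBy.mul_acceleration (hu : DominatedBy g A u) (hK : Continuous K) {κ : ℝ}
    (hKκ : ∀ z, ‖K z‖ ≤ κ) (n : Fin 3) :
    DominatedBy g (A * κ) fun z => u z * fderiv ℝ velocity z.2 (K z) n := by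
  refine hu.mul (continuous_coord (((contDiff_velocity.continuous_fderiv one_ne_zero).comp
    continuous_snd).clm_apply hK) n) (fun z _ => (abs_coord_le _ n).trans ?_)
    ((norm_nonneg _).trans (hKκ 0))
  simpa only [one_mul] using
    (fderiv ℝ velocity z.2).le_of_opNorm_le_of_le (norm_fderiv_velocity_le z.2) (hKκ z)

lemma DominatedBy.abs_integral_mul_pds_kernelDiff_le (hu : DominatedBy g A u)
    (hg : DensityBounds R₀ P₀ t g) (hR₀ : 0 ≤ R₀) (ht : 1 / 2 ≤ t) (hC : KernelBound C)
    (hs : 0 < s) (hr : 0 < r) (x : E3) {n : ℕ} (hn : n ≤ 2) (hl : l.length = n + 1) :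
    |∫ z, u z * pds l (kernelDiff s r x) z.1|
      ≤ A * (2 * C) * sourceConst R₀ P₀ n * t ^ (-(n : ℝ)) :=
  hu.abs_integral_mul_le_rpow hg hR₀ ht ((isTest_kernelDiff hs hr x).pds l).continuous
    (mul_nonneg two_pos.le hC.nonneg) n.cast_nonneg (by exact_mod_cast Nat.lt_succ_of_le hn)
    fun _ hy => hC.abs_pds_kernelDiff_le (hn.trans (Nat.le_succ 2)) hl hs hr hy

/-- The constant in the decay of the fields. -/
def fieldConst (R₀ P₀ C : ℝ) : ℝ :=
  4 * (2 * C * sourceConst R₀ P₀ 2) + 4 * (2 * C * sourceConst R₀ P₀ 1)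

lemma mul_sourceConst_nonneg (hR₀ : 0 ≤ R₀) (hC : 0 ≤ C) {β : ℝ} (hβ : β < 3) :
    0 ≤ 2 * C * sourceConst R₀ P₀ β :=
  mul_nonneg (mul_nonneg zero_le_two hC) (sourceConst_nonneg hR₀ hβ)

lemma fieldConst_nonneg (hR₀ : 0 ≤ R₀) (hC : 0 ≤ C) : 0 ≤ fieldConst R₀ P₀ C :=
  add_nonneg (mul_nonneg zero_le_four (mul_sourceConst_nonneg hR₀ hC (by norm_num)))
    (mul_nonneg zero_le_four (mul_sourceConst_nonneg hR₀ hC (by norm_num)))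

lemma DensityBounds.abs_integral_force_mul_pds_kernelDiff_le (h : DensityBounds R₀ P₀ t g)
    (hR₀ : 0 ≤ R₀) (ht : 1 / 2 ≤ t) (hg : Continuous fun z : E3 × E3 => g z.1 z.2)
    (hc : HasCompactSupport fun z : E3 × E3 => g z.1 z.2) (hK : Continuous K)
    (hKt : ∀ z, ‖K z‖ ≤ t ^ (-(3 / 2) : ℝ)) (hC : KernelBound C) (hs : 0 < s) (hr : 0 < r)
    (x : E3) {m : ℕ} (hm : m ≤ 2) (hl : l.length = m + 1) (n : Fin 3) {q : ℝ}
    (hq : q ≤ m + 3 / 2) (hmq : m + 3 / 2 ≤ q + 2) :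
    |∫ z, g z.1 z.2 * (fderiv ℝ velocity z.2 (K z) n * pds l (kernelDiff s r x) z.1)|
      ≤ 4 * (2 * C * sourceConst R₀ P₀ m) * t ^ (-q) := by
  have ht₀ : 0 < t := by linarith
  have hsource := ((h.dominatedBy hg hc).mul_acceleration hK hKt
    n).abs_integral_mul_pds_kernelDiff_le h hR₀ ht hC hs hr x hm hl
  simp only [mul_assoc (g _ _)] at hsource
  calc _ ≤ 1 * t ^ (-(3 / 2) : ℝ) * (2 * C) * sourceConst R₀ P₀ m * t ^ (-(m : ℝ)) := hsource
    _ = 2 * C * sourceConst R₀ P₀ m * t ^ (-(m + 3 / 2) : ℝ) := by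
        rw [neg_add, Real.rpow_add ht₀]; ring
    _ ≤ 2 * C * sourceConst R₀ P₀ m * (4 * t ^ (-q)) :=
        mul_le_mul_of_nonneg_left (rpow_neg_le_four_mul ht hq hmq)
          (mul_sourceConst_nonneg hR₀ hC.nonneg (by exact_mod_cast Nat.lt_succ_of_le hm))
    _ = _ := by ring

lemma DensityBounds.sourceBound_kernelDiff (h : DensityBounds R₀ P₀ t g)
    (hR₀ : 0 ≤ R₀) (ht : 1 / 2 ≤ t) (hg : Continuous fun z : E3 × E3 => g z.1 z.2)
    (hc : HasCompactSupport fun z : E3 × E3 => g z.1 z.2) (hK : Continuous K)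
    (hKt : ∀ z, ‖K z‖ ≤ t ^ (-(3 / 2) : ℝ)) (hC : KernelBound C) (hs : 0 < s) (hr : 0 < r)
    (x : E3) :
    SourceBound (fun z => g z.1 z.2) K (kernelDiff s r x)
      (fieldConst R₀ P₀ C * t ^ (-(9 / 5) : ℝ)) := by
  have hpow : 0 ≤ t ^ (-(9 / 5) : ℝ) := Real.rpow_nonneg (by linarith) _
  have htwo := mul_sourceConst_nonneg (P₀ := P₀) hR₀ hC.nonneg (by norm_num : (2 : ℝ) < 3)
  have hone := mul_sourceConst_nonneg (P₀ := P₀) hR₀ hC.nonneg (by norm_num : (1 : ℝ) < 3)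
  refine ⟨fun w hw hw₁ l hl => ?_, fun n l hl => ?_⟩
  · have hsource := ((h.dominatedBy hg hc).mul_weight hw hw₁).abs_integral_mul_pds_kernelDiff_le
      h hR₀ ht hC hs hr x le_rfl hl
    rw [one_mul, Nat.cast_ofNat] at hsource
    refine hsource.trans ?_
    calc _ ≤ 2 * C * sourceConst R₀ P₀ 2 * (4 * t ^ (-(9 / 5) : ℝ)) := mul_le_mul_of_nonneg_left
          (rpow_neg_le_four_mul ht (by norm_num) (by norm_num)) htwo
      _ = 4 * (2 * C * sourceConst R₀ P₀ 2) * t ^ (-(9 / 5) : ℝ) := by ring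
      _ ≤ _ := mul_le_mul_of_nonneg_right
          (le_add_of_nonneg_right (mul_nonneg zero_le_four hone)) hpow
  · have hforce := h.abs_integral_force_mul_pds_kernelDiff_le hR₀ ht hg hc hK hKt hC hs hr x
      one_le_two hl n (q := 9 / 5) (by norm_num) (by norm_num)
    rw [Nat.cast_one] at hforce
    exact hforce.trans (mul_le_mul_of_nonneg_right
      (le_add_of_nonneg_left (mul_nonneg zero_le_four htwo)) hpow)

/-- The constant in the decay of the contribution of nearby sources to the field gradients. -/
def nearConst (R₀ P₀ C : ℝ) : ℝ :=
  3 * momentConst R₀ P₀ * (2 * C * (3 * volume.real (Metric.ball (0 : E3) 1)))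

lemma nearConst_nonneg (hR₀ : 0 ≤ R₀) (hC : 0 ≤ C) : 0 ≤ nearConst R₀ P₀ C :=
  mul_nonneg (mul_nonneg zero_le_three (momentConst_nonneg hR₀))
    (mul_nonneg (mul_nonneg zero_le_two hC) (mul_nonneg zero_le_three measureReal_nonneg))

lemma DominatedBy.abs_integral_mul_pds_kernelDiff_one_le (hu : DominatedBy g 3 u)
    (hg : DensityBounds R₀ P₀ t g) (hR₀ : 0 ≤ R₀) (ht : 0 < t) (hC : KernelBound C)
    (hs : 0 < s) (hs₁ : s < 1) (x : E3) (hl : l.length = 3) :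
    |∫ z, u z * pds l (kernelDiff s 1 x) z.1| ≤ nearConst R₀ P₀ C * t ^ (-3 : ℝ) := by
  have hdim : (Module.finrank ℝ E3 : ℝ) = 3 := by rw [finrank_euclideanSpace_fin, Nat.cast_ofNat]
  have hβ : (2 : ℝ) < Module.finrank ℝ E3 := by rw [hdim]; norm_num
  have hC₂ : 0 ≤ 2 * C := mul_nonneg zero_le_two hC.nonneg
  have hmajorant := hu.abs_integral_mul_le hg hR₀ ht
    ((isTest_kernelDiff hs one_pos x).pds l).continuous
    ((integrable_nearKernel volume hβ zero_le_one x).const_mul (2 * C))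
    (fun y => mul_nonneg hC₂ (nearKernel_nonneg 2 1 x y)) (x := x) fun y hy _ => by
      rcases le_or_gt ‖y - x‖ 1 with hnear | hfar
      · rw [nearKernel_of_le hnear]
        exact_mod_cast hC.abs_pds_kernelDiff_le (n := 2) (by norm_num) hl hs one_pos hy
      · rw [pds_kernelDiff_eq_zero hs one_pos (hs₁.trans hfar) hfar, abs_zero]
        exact mul_nonneg hC₂ (nearKernel_nonneg _ _ _ _)
  rw [integral_const_mul, integral_nearKernel volume hβ zero_le_one, hdim, Real.one_rpow]
    at hmajorant
  exact hmajorant.trans_eq (by rw [nearConst]; ring)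

lemma DensityBounds.abs_integral_mul_pds_kernelDiff_near_le (h : DensityBounds R₀ P₀ t g)
    (hR₀ : 0 ≤ R₀) (ht : 1 / 2 ≤ t) (hg : ContDiff ℝ 1 fun z : E3 × E3 => g z.1 z.2)
    (hc : HasCompactSupport fun z : E3 × E3 => g z.1 z.2) (hC : KernelBound C)
    (hs : 0 < s) (hs₁ : s < 1) (x : E3) (hw : Continuous w) (hw₁ : ∀ p, |w p| ≤ 1)
    (hl : l.length = 4) :
    |∫ z : E3 × E3, g z.1 z.2 * w z.2 * pds l (kernelDiff s 1 x) z.1|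
      ≤ 4 * nearConst R₀ P₀ C * t ^ (-(8 / 3) : ℝ) := by
  obtain ⟨i, l, rfl⟩ := List.exists_cons_of_length_eq_add_one hl
  have hψ : IsTest (pds l (kernelDiff s 1 x)) := (isTest_kernelDiff hs one_pos x).pds l
  have hderiv := h.dominatedBy_fderiv_fst hg hc (EuclideanSpace.single i 1)
  rw [PiLp.norm_single, norm_one, mul_one] at hderiv
  have hparts := integral_mul_pd_fst hg hc hw (hψ.smooth.of_le (by simp)) i
  calc _ = |∫ z : E3 × E3, fderiv ℝ (fun z : E3 × E3 => g z.1 z.2) z (EuclideanSpace.single i 1, 0)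
        * w z.2 * pds l (kernelDiff s 1 x) z.1| :=
        (congrArg abs hparts).trans (abs_neg _)
    _ ≤ nearConst R₀ P₀ C * t ^ (-3 : ℝ) :=
        (hderiv.mul_weight hw hw₁).abs_integral_mul_pds_kernelDiff_one_le h hR₀ (by linarith) hC
          hs hs₁ x (Nat.succ.inj hl)
    _ ≤ nearConst R₀ P₀ C * (4 * t ^ (-(8 / 3) : ℝ)) := mul_le_mul_of_nonneg_left
        (rpow_neg_le_four_mul ht (by norm_num) (by norm_num)) (nearConst_nonneg hR₀ hC.nonneg)
    _ = _ := by ring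

lemma DominatedBy.abs_integral_mul_pds_kernelDiff_far_le (hu : DominatedBy g A u)
    (hg : DensityBounds R₀ P₀ t g) (hR₀ : 0 ≤ R₀) (ht : 1 / 2 ≤ t) (hC : KernelBound C)
    (hr : 1 ≤ r) (x : E3) (hl : l.length = 4) :
    |∫ z, u z * pds l (kernelDiff 1 r x) z.1|
      ≤ A * (2 * C) * sourceConst R₀ P₀ (8 / 3) * t ^ (-(8 / 3) : ℝ) :=
  hu.abs_integral_mul_le_rpow hg hR₀ ht
    ((isTest_kernelDiff one_pos (one_pos.trans_le hr) x).pds l).continuous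
    (mul_nonneg zero_le_two hC.nonneg) (by norm_num) (by norm_num)
    fun _ hy => hC.abs_pds_kernelDiff_le_of_one_le (n := 3) le_rfl hl le_rfl hr hy (by norm_num)
      (by norm_num)

/-- The constant in the decay of the gradients of the fields. -/
def gradConst (R₀ P₀ C : ℝ) : ℝ :=
  4 * nearConst R₀ P₀ C + 2 * C * sourceConst R₀ P₀ (8 / 3) + 4 * (2 * C * sourceConst R₀ P₀ 2)

lemma gradConst_nonneg (hR₀ : 0 ≤ R₀) (hC : 0 ≤ C) : 0 ≤ gradConst R₀ P₀ C :=
  add_nonneg (add_nonneg (mul_nonneg zero_le_four (nearConst_nonneg hR₀ hC))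
    (mul_sourceConst_nonneg hR₀ hC (by norm_num)))
    (mul_nonneg zero_le_four (mul_sourceConst_nonneg hR₀ hC (by norm_num)))

lemma integral_mul_pds_kernelDiff_add (hu : Continuous u) (hc : HasCompactSupport u) {q : ℝ}
    (hs : 0 < s) (hr : 0 < r) (hq : 0 < q) (x : E3) (l : List (Fin 3)) :
    (∫ z, u z * pds l (kernelDiff s r x) z.1) + ∫ z, u z * pds l (kernelDiff r q x) z.1
      = ∫ z, u z * pds l (kernelDiff s q x) z.1 := by
  have hint : ∀ {k : E3 → ℝ}, IsTest k → Integrable fun z => u z * k z.1 := fun hk =>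
    (hu.mul (hk.continuous.comp continuous_fst)).integrable_of_hasCompactSupport hc.mul_right
  rw [← integral_add (hint ((isTest_kernelDiff hs hr x).pds l))
    (hint ((isTest_kernelDiff hr hq x).pds l))]
  simp only [← mul_add, pds_kernelDiff_add]

lemma DensityBounds.sourceBound_pd_kernelDiff (h : DensityBounds R₀ P₀ t g)
    (hR₀ : 0 ≤ R₀) (ht : 1 / 2 ≤ t) (hg : ContDiff ℝ 1 fun z : E3 × E3 => g z.1 z.2)
    (hc : HasCompactSupport fun z : E3 × E3 => g z.1 z.2) (hK : Continuous K)
    (hKt : ∀ z, ‖K z‖ ≤ t ^ (-(3 / 2) : ℝ)) (hC : KernelBound C) (hs : 0 < s) (hs₁ : s < 1)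
    (hr : 1 < r) (x : E3) (m : Fin 3) :
    SourceBound (fun z => g z.1 z.2) K (pd m (kernelDiff s r x))
      (gradConst R₀ P₀ C * t ^ (-(8 / 3) : ℝ)) := by
  have hr₀ : 0 < r := one_pos.trans hr
  have hpow : 0 ≤ t ^ (-(8 / 3) : ℝ) := Real.rpow_nonneg (by linarith) _
  have htwo := mul_sourceConst_nonneg (P₀ := P₀) hR₀ hC.nonneg (by norm_num : (2 : ℝ) < 3)
  have hfar₀ := mul_sourceConst_nonneg (P₀ := P₀) hR₀ hC.nonneg (by norm_num : (8 / 3 : ℝ) < 3)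
  have hnear₀ := nearConst_nonneg (P₀ := P₀) hR₀ hC.nonneg
  have hpds : ∀ l, pds l (pd m (kernelDiff s r x)) = pds (l ++ [m]) (kernelDiff s r x) := fun l =>
    (List.foldr_append (f := pd) (b := kernelDiff s r x) (l := l) (l' := [m])).symm
  refine ⟨fun w hw hw₁ l hl => ?_, fun n l hl => ?_⟩ <;> rw [hpds] <;>
    replace hl := (List.length_append (as := l) (bs := [m])).trans (congrArg (· + 1) hl)
  · have hu := (h.dominatedBy hg.continuous hc).mul_weight hw hw₁
    rw [← integral_mul_pds_kernelDiff_add hu.continuous hu.hasCompactSupport hs one_pos hr₀]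
    refine (abs_add_le _ _).trans ((add_le_add
      (h.abs_integral_mul_pds_kernelDiff_near_le hR₀ ht hg hc hC hs hs₁ x hw hw₁ hl)
      (hu.abs_integral_mul_pds_kernelDiff_far_le h hR₀ ht hC hr.le x hl)).trans ?_)
    rw [one_mul, ← add_mul]
    exact mul_le_mul_of_nonneg_right (le_add_of_nonneg_right (mul_nonneg zero_le_four htwo)) hpow
  · refine (h.abs_integral_force_mul_pds_kernelDiff_le hR₀ ht hg.continuous hc hK hKt hC hs hr₀ x
      le_rfl hl n (q := 8 / 3) (by norm_num) (by norm_num)).trans ?_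
    exact mul_le_mul_of_nonneg_right
      (le_add_of_nonneg_left (add_nonneg (mul_nonneg zero_le_four hnear₀) hfar₀)) hpow

end Sources

/-! ### Estimates for the fields -/

section Fields

variable {T t Q : ℝ} {f : ℝ → E3 → E3 → ℝ} {EL ET B : ℝ → E3 → E3} {G : E3 × E3 → ℝ}
  {K : E3 × E3 → E3} {θ : E3 → ℝ}

lemma SourceBound.nonneg (hQ : SourceBound G K θ Q) : 0 ≤ Q :=
  (abs_nonneg _).trans (hQ.force 0 [0, 0] rfl)

lemma SourceBound.abs_integral_mul_pd_laplacian_le (hQ : SourceBound G K θ Q) (hG : Continuous G)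
    (hGc : HasCompactSupport G) (hθ : IsTest θ) {w : E3 → ℝ} (hw : Continuous w)
    (hw₁ : ∀ p, |w p| ≤ 1) (i : Fin 3) : |∫ z, G z * w z.2 * pd i (Δ θ) z.1| ≤ 3 * Q := by
  have hint : ∀ k ∈ Finset.univ, Integrable fun z => G z * w z.2 * pds [i, k, k] θ z.1 :=
    fun k _ => ((hG.mul (hw.comp continuous_snd)).mul
      ((hθ.pds [i, k, k]).continuous.comp continuous_fst)).integrable_of_hasCompactSupport
      hGc.mul_right.mul_right
  have hsum : ∫ z, G z * w z.2 * pd i (Δ θ) z.1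
      = ∑ k, ∫ z, G z * w z.2 * pds [i, k, k] θ z.1 := by
    rw [← integral_finsetSum _ hint, laplacian_eq_sum_pd hθ.smooth,
      pd_sum _ fun k => ((hθ.pd k).pd k).smooth.differentiable]
    simp only [Finset.mul_sum]
    rfl
  rw [hsum]
  refine (Finset.abs_sum_le_sum_abs _ _).trans
    ((Finset.sum_le_card_nsmul _ _ Q fun k _ => hQ.transport w hw hw₁ [i, k, k] rfl).trans_eq ?_)
  rw [Finset.card_univ, Fintype.card_fin, nsmul_eq_mul, Nat.cast_ofNat]

lemma IsClassicalSolution.abs_integral_EL_mul_bilaplacian_le (h : IsClassicalSolution T f EL ET B)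
    (ht : t ∈ Ico 0 T) (hθ : IsTest θ) (hQ : SourceBound (fun z => f t z.1 z.2) K θ Q)
    (i : Fin 3) : |∫ y, EL t y i * Δ (Δ θ) y| ≤ 3 * Q := by
  rw [h.integral_EL_mul_laplacian ht hθ.laplacian, abs_neg,
    h.integral_chargeDensity_mul ht (hθ.laplacian.pd i).continuous]
  exact hQ.abs_integral_mul_pd_laplacian_le (h.contDiff_f ht).continuous (h.compact_f t ht) hθ
    (w := fun _ => 1) continuous_const (fun _ => abs_one.le) i

lemma IsClassicalSolution.abs_integral_B_mul_bilaplacian_le (h : IsClassicalSolution T f EL ET B)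
    (ht : t ∈ Ioo 0 T) (hθ : IsTest θ) (hQ : SourceBound (fun z => f t z.1 z.2) K θ Q)
    (i : Fin 3) : |∫ y, B t y i * Δ (Δ θ) y| ≤ 6 * Q := by
  have ht' : t ∈ Ico 0 T := Ioo_subset_Ico_self ht
  have hmoment : ∀ n k : Fin 3, |∫ y, currentDensity f t y n * pd k (Δ θ) y| ≤ 3 * Q := by
    intro n k
    rw [h.integral_currentDensity_mul ht' (hθ.laplacian.pd k).continuous]
    exact hQ.abs_integral_mul_pd_laplacian_le (h.contDiff_f ht').continuous (h.compact_f t ht') hθ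
      (continuous_velocity_coord n) (fun p => abs_velocity_coord_le p n) k
  rw [h.integral_B_mul_laplacian ht hθ.laplacian, abs_neg, integralCross]
  exact (abs_sub _ _).trans ((add_le_add (hmoment _ _) (hmoment _ _)).trans_eq (by ring))

variable {a : ℝ} {S : Set (E3 × E3)}

lemma IsClassicalSolution.exists_hasDerivAt_integral_currentDensity_mul
    (h : IsClassicalSolution T f EL ET B) (ha : a < T) (hS : IsCompact S)
    (hfS : ∀ s ∈ Ioo 0 a, ∀ z ∉ S, f s z.1 z.2 = 0) (ht : t ∈ Ioo 0 a) (hθ : IsTest θ)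
    (hQ : SourceBound (fun z => f t z.1 z.2) (fun z => force EL ET B t z.1 z.2) θ Q)
    (n k m : Fin 3) :
    ∃ d, HasDerivAt (fun s => ∫ x, currentDensity f s x n * pd k (pd m θ) x) d t ∧
      |d| ≤ 4 * Q := by
  refine ⟨_, h.hasDerivAt_integral_currentDensity_mul ha hS hfS ht
    (((hθ.pd m).pd k).smooth.of_le (by simp)) n, ?_⟩
  have htransport : ∀ l ∈ Finset.univ, |∫ z : E3 × E3,
      f t z.1 z.2 * (velocity z.2 l * velocity z.2 n) * pds [l, k, m] θ z.1| ≤ Q := fun l _ =>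
    hQ.transport (fun p => velocity p l * velocity p n)
      ((continuous_velocity_coord l).mul (continuous_velocity_coord n)) (fun p => by
        rw [abs_mul]
        exact mul_le_one₀ (abs_velocity_coord_le p l) (abs_nonneg _) (abs_velocity_coord_le p n))
      [l, k, m] rfl
  have hsum := (Finset.abs_sum_le_sum_abs _ _).trans (Finset.sum_le_card_nsmul _ _ Q htransport)
  rw [Finset.card_univ, Fintype.card_fin, nsmul_eq_mul, Nat.cast_ofNat] at hsum
  exact (abs_add_le _ _).trans
    ((add_le_add hsum (hQ.force n [k, m] rfl)).trans_eq (by ring))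

lemma IsClassicalSolution.exists_hasDerivAt_integralCross_currentDensity
    (h : IsClassicalSolution T f EL ET B) (ha : a < T) (hS : IsCompact S)
    (hfS : ∀ s ∈ Ioo 0 a, ∀ z ∉ S, f s z.1 z.2 = 0) (ht : t ∈ Ioo 0 a) (hθ : IsTest θ)
    (hQ : SourceBound (fun z => f t z.1 z.2) (fun z => force EL ET B t z.1 z.2) θ Q)
    (m i : Fin 3) :
    ∃ d, HasDerivAt (fun s => integralCross (currentDensity f s) (pd m θ) i) d t ∧
      |d| ≤ 8 * Q := by
  obtain ⟨d₁, hd₁, hdQ₁⟩ := h.exists_hasDerivAt_integral_currentDensity_mul ha hS hfS ht hθ hQ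
    (i + 1) (i + 2) m
  obtain ⟨d₂, hd₂, hdQ₂⟩ := h.exists_hasDerivAt_integral_currentDensity_mul ha hS hfS ht hθ hQ
    (i + 2) (i + 1) m
  exact ⟨d₁ - d₂, hd₁.sub hd₂, (abs_sub _ _).trans ((add_le_add hdQ₁ hdQ₂).trans_eq (by ring))⟩

lemma IsClassicalSolution.abs_integral_ET_mul_bilaplacian_le (h : IsClassicalSolution T f EL ET B)
    (ha : a < T) (hS : IsCompact S) (hfS : ∀ s ∈ Ioo 0 a, ∀ z ∉ S, f s z.1 z.2 = 0)
    (ht : t ∈ Ioo 0 a) (hθ : IsTest θ)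
    (hQ : SourceBound (fun z => f t z.1 z.2) (fun z => force EL ET B t z.1 z.2) θ Q)
    (i : Fin 3) : |∫ y, ET t y i * Δ (Δ θ) y| ≤ 16 * Q := by
  obtain ⟨d₁, hd₁, hdQ₁⟩ := h.exists_hasDerivAt_integralCross_currentDensity ha hS hfS ht hθ hQ
    (i + 1) (i + 2)
  obtain ⟨d₂, hd₂, hdQ₂⟩ := h.exists_hasDerivAt_integralCross_currentDensity ha hS hfS ht hθ hQ
    (i + 2) (i + 1)
  rw [(h.hasDerivAt_integralCross_currentDensity ⟨ht.1, ht.2.trans ha⟩ hθ i).unique (hd₁.sub hd₂)]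
  exact (abs_sub _ _).trans ((add_le_add hdQ₁ hdQ₂).trans_eq (by ring))

end Fields

/-! ### Decay of the fields -/

lemma norm_le_of_abs_coord_le {u : E3} {q : ℝ} (h : ∀ i, |u i| ≤ q) : ‖u‖ ≤ 3 * q := by
  conv_lhs => rw [← sum_coord_smul_single u]
  calc ‖∑ i, u i • (EuclideanSpace.single i 1 : E3)‖ ≤ ∑ _i : Fin 3, q :=
        norm_sum_le_of_le _ fun i _ => by
          rw [norm_smul, PiLp.norm_single, norm_one, mul_one]
          exact h i
    _ = 3 * q := by rw [Fin.sum_const, nsmul_eq_mul, Nat.cast_ofNat]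

lemma opNorm_le_of_abs_coord_le {L : E3 →L[ℝ] E3} {q : ℝ}
    (h : ∀ l i, |L (EuclideanSpace.single l 1) i| ≤ q) : ‖L‖ ≤ 9 * q := by
  have hq : 0 ≤ q := (abs_nonneg _).trans (h 0 0)
  refine L.opNorm_le_bound (mul_nonneg (by norm_num) hq) fun u => ?_
  conv_lhs => rw [← sum_coord_smul_single u, map_sum]
  calc ‖∑ l, L (u l • (EuclideanSpace.single l 1 : E3))‖ ≤ ∑ _l : Fin 3, ‖u‖ * (3 * q) :=
        norm_sum_le_of_le _ fun l _ => by
          rw [map_smul, norm_smul]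
          exact mul_le_mul (abs_coord_le u l) (norm_le_of_abs_coord_le (h l)) (norm_nonneg _)
            (norm_nonneg _)
    _ = 9 * q * ‖u‖ := by
        rw [Fin.sum_const, nsmul_eq_mul, Nat.cast_ofNat]
        ring

/-- The field `F` and its Jacobian are bounded by `q` and `q'`. -/
structure FieldBounds (q q' : ℝ) (F : E3 → E3) : Prop where
  norm_le : ∀ x, ‖F x‖ ≤ q
  norm_fderiv_le : ∀ x, ‖fderiv ℝ F x‖ ≤ q'

lemma FieldBounds.of_integral_bilaplacian {F : E3 → E3} {M M' q q' : ℝ}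
    (hF : Differentiable ℝ F) (hF' : Continuous (fderiv ℝ F)) (hM : FieldBounds M M' F)
    (hF₀ : Tendsto F (cocompact E3) (𝓝 0))
    (hq : ∀ (i : Fin 3) (s r : ℝ) (x : E3), 0 < s → s < 1 → 1 < r →
      |∫ y, F y i * Δ (Δ (kernelDiff s r x)) y| ≤ 16 * q)
    (hq' : ∀ (i l : Fin 3) (s r : ℝ) (x : E3), 0 < s → s < 1 → 1 < r →
      |∫ y, F y i * Δ (Δ (pd l (kernelDiff s r x))) y| ≤ 16 * q') :
    FieldBounds (6 / Real.pi * q) (18 / Real.pi * q') F := by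
  have hscale {b v : ℝ} (hv : 8 * Real.pi * v ≤ 16 * b) : v ≤ 2 / Real.pi * b := by
    rw [div_mul_eq_mul_div, le_div_iff₀ Real.pi_pos]
    linarith
  refine ⟨fun x => ?_, fun x => ?_⟩
  · have hcoord (i : Fin 3) : |F x i| ≤ 2 / Real.pi * q :=
      hscale (abs_le_of_integral_bilaplacian (continuous_coord hF.continuous i)
        (fun y => (abs_coord_le _ i).trans (hM.norm_le y))
        (squeeze_zero_norm (fun y => abs_coord_le (F y) i)
          (tendsto_zero_iff_norm_tendsto_zero.1 hF₀)) fun s r => hq i s r x)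
    exact (norm_le_of_abs_coord_le hcoord).trans_eq (by ring)
  · have hbound (l i : Fin 3) (y : E3) : |pd l (fun y => F y i) y| ≤ M' := by
      rw [pd_coord hF]
      refine (abs_coord_le _ i).trans (((fderiv ℝ F y).le_opNorm _).trans ?_)
      rw [PiLp.norm_single, norm_one, mul_one]
      exact hM.norm_fderiv_le y
    have hpartial (l i : Fin 3) : |partialD F l i x| ≤ 2 / Real.pi * q' := by
      rw [← pd_coord hF]
      exact hscale (abs_pd_le_of_integral_bilaplacian (differentiable_coord hF i)
        (pd_coord hF l i ▸ continuous_partialD hF' l i)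
        (fun y => (abs_coord_le _ i).trans (hM.norm_le y)) (hbound l i) fun s r => hq' i l s r x)
    exact (opNorm_le_of_abs_coord_le hpartial).trans_eq (by ring)

/-- `G` and `K` satisfy `SourceBound` against all the kernels that recover a field, with constant
`q`, and against the derivatives of these kernels, which recover its gradient, with constant `q'`.
-/
structure KernelSourceBounds (G : E3 × E3 → ℝ) (K : E3 × E3 → E3) (q q' : ℝ) : Prop where
  kernelDiff : ∀ s r x, 0 < s → s < 1 → 1 < r → SourceBound G K (kernelDiff s r x) q
  pd_kernelDiff : ∀ l s r x, 0 < s → s < 1 → 1 < r →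
    SourceBound G K (pd l (VlasovDarwin.kernelDiff s r x)) q'

lemma KernelSourceBounds.fieldBounds {G : E3 × E3 → ℝ} {K : E3 × E3 → E3} {F : E3 → E3}
    {M M' q q' : ℝ} (hS : KernelSourceBounds G K q q') (hF : Differentiable ℝ F)
    (hF' : Continuous (fderiv ℝ F)) (hM : FieldBounds M M' F)
    (hF₀ : Tendsto F (cocompact E3) (𝓝 0))
    (hQ : ∀ {θ Q}, IsTest θ → SourceBound G K θ Q → ∀ i, |∫ y, F y i * Δ (Δ θ) y| ≤ 16 * Q) :
    FieldBounds (6 / Real.pi * q) (18 / Real.pi * q') F :=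
  .of_integral_bilaplacian hF hF' hM hF₀
    (fun i s r x hs hs₁ hr =>
      hQ (isTest_kernelDiff hs (zero_lt_one.trans hr) x) (hS.kernelDiff s r x hs hs₁ hr) i)
    fun i l s r x hs hs₁ hr =>
      hQ ((isTest_kernelDiff hs (zero_lt_one.trans hr) x).pd l)
        (hS.pd_kernelDiff l s r x hs hs₁ hr) i

lemma norm_le_const_mul_rpow_of_forall_lt {V W : Type*} [TopologicalSpace V]
    [SeminormedAddCommGroup W] {F : ℝ → V → W} {T t b c q : ℝ}
    (hF : ContinuousOn (fun z : ℝ × V => F z.1 z.2) (Ico 0 T ×ˢ univ)) (hb : 0 ≤ b) (hbt : b < t)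
    (htT : t < T) {x : V} (h : ∀ s ∈ Ico b t, ‖F s x‖ ≤ c * s ^ q) : ‖F t x‖ ≤ c * t ^ q := by
  have hpast : Ico b t ∈ 𝓝[<] t := Ico_mem_nhdsLT hbt
  have hslab : ∀ᶠ s in 𝓝[<] t, (s, x) ∈ Ico 0 T ×ˢ (univ : Set V) := by
    filter_upwards [hpast] with s hs using ⟨⟨hb.trans hs.1, hs.2.trans htT⟩, mem_univ _⟩
  have hline : Tendsto (fun s => (s, x)) (𝓝[<] t) (𝓝[Ico 0 T ×ˢ univ] (t, x)) :=
    tendsto_nhdsWithin_iff.2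
      ⟨(Continuous.prodMk_left x).continuousAt.mono_left nhdsWithin_le_nhds, hslab⟩
  have hFt := hF (t, x) ⟨⟨hb.trans hbt.le, htT⟩, mem_univ _⟩
  refine le_of_tendsto_of_tendsto (hFt.tendsto.comp hline).norm
    (((Real.continuousAt_rpow_const t q (.inl (hb.trans_lt hbt).ne')).mono_left
      nhdsWithin_le_nhds).const_mul c) ?_
  filter_upwards [hpast] with s hs using h s hs

section Decay

variable {T t α a R₀ P₀ C : ℝ} {f : ℝ → E3 → E3 → ℝ} {EL ET B : ℝ → E3 → E3}

lemma FreeStreaming.exists_fieldBounds (hfs : FreeStreaming α a EL ET B) (hα : 0 ≤ α)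
    (ht : t ∈ Icc 0 a) :
    ∃ M M', FieldBounds M M' (EL t) ∧ FieldBounds M M' (ET t) ∧ FieldBounds M M' (B t) := by
  obtain ⟨eT, eL, b, -, hT, hL, hB⟩ := exists_norm_le_of_supNorm_add_le
    (mul_nonneg hα (one_add_rpow_pos ht.1 _).le) (hfs t ht).1
  obtain ⟨eT', eL', b', -, hT', hL', hB'⟩ := exists_norm_le_of_supNorm_add_le
    (mul_nonneg hα (one_add_rpow_pos ht.1 _).le) (hfs t ht).2
  refine ⟨max eL (max eT b), max eL' (max eT' b'), ⟨fun x => ?_, fun x => ?_⟩,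
    ⟨fun x => ?_, fun x => ?_⟩, fun x => ?_, fun x => ?_⟩ <;>
  simp only [le_max_iff, hT x, hL x, hB x, hT' x, hL' x, hB' x, true_or, or_true]

lemma IsClassicalSolution.kernelSourceBounds (h : IsClassicalSolution T f EL ET B)
    (hα₁ : α ≤ 1) (hK : DecayingForce α a (force EL ET B)) (ha : a < T)
    (hd : DensityBounds R₀ P₀ t (f t)) (hR₀ : 0 ≤ R₀) (hC : KernelBound C)
    (ht : t ∈ Icc (1 / 2) a) :
    KernelSourceBounds (fun z => f t z.1 z.2) (fun z => force EL ET B t z.1 z.2)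
      (fieldConst R₀ P₀ C * t ^ (-(9 / 5) : ℝ)) (gradConst R₀ P₀ C * t ^ (-(8 / 3) : ℝ)) := by
  have ht₀ : 0 < t := by linarith [ht.1]
  have htT : t ∈ Ico 0 T := ⟨ht₀.le, ht.2.trans_lt ha⟩
  have hf := h.contDiff_f htT
  have hforce : Continuous fun z : E3 × E3 => force EL ET B t z.1 z.2 :=
    (h.contDiff_transportField htT).continuous.snd
  have hforce_le (z : E3 × E3) : ‖force EL ET B t z.1 z.2‖ ≤ t ^ (-(3 / 2) : ℝ) :=
    calc ‖force EL ET B t z.1 z.2‖ ≤ α * (1 + t) ^ (-(3 / 2) : ℝ) :=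
          hK.norm_le t ⟨ht₀.le, ht.2⟩ z.1 z.2
      _ ≤ 1 * (1 + t) ^ (-(3 / 2) : ℝ) :=
          mul_le_mul_of_nonneg_right hα₁ (one_add_rpow_pos ht₀.le _).le
      _ = (1 + t) ^ (-(3 / 2) : ℝ) := one_mul _
      _ ≤ t ^ (-(3 / 2) : ℝ) := Real.rpow_le_rpow_of_nonpos ht₀ (by linarith) (by norm_num)
  exact ⟨fun s r x hs _ hr => hd.sourceBound_kernelDiff hR₀ ht.1 hf.continuous
      (h.compact_f t htT) hforce hforce_le hC hs (zero_lt_one.trans hr) x,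
    fun l s r x hs hs₁ hr => hd.sourceBound_pd_kernelDiff hR₀ ht.1 hf (h.compact_f t htT) hforce
      hforce_le hC hs hs₁ hr x l⟩

lemma exists_isCompact_of_densityBounds (hd : ∀ s ∈ Icc 0 a, DensityBounds R₀ P₀ s (f s)) :
    ∃ S : Set (E3 × E3), IsCompact S ∧ ∀ s ∈ Ioo 0 a, ∀ z ∉ S, f s z.1 z.2 = 0 := by
  refine ⟨Metric.closedBall 0 (R₀ + a) ×ˢ Metric.closedBall 0 (P₀ + 1),
    (isCompact_closedBall _ _).prod (isCompact_closedBall _ _), fun s hs z hz => ?_⟩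
  by_contra hne
  have hds := hd s (Ioo_subset_Icc_self hs)
  exact hz ⟨mem_closedBall_zero_iff.2 (by linarith [hds.pos_le hne, hs.2]),
    mem_closedBall_zero_iff.2 (hds.mom_le hne)⟩

/-- The decay of a field at time `t` which the proposition asserts, with the constants that result
from a kernel bound `C`. -/
def FieldDecay (R₀ P₀ C t : ℝ) (F : E3 → E3) : Prop :=
  FieldBounds (6 / Real.pi * (fieldConst R₀ P₀ C * t ^ (-(9 / 5) : ℝ)))
    (18 / Real.pi * (gradConst R₀ P₀ C * t ^ (-(8 / 3) : ℝ))) F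

lemma IsClassicalSolution.fieldDecay_EL_B (h : IsClassicalSolution T f EL ET B) (hα : 0 ≤ α)
    (hα₁ : α ≤ 1) (ha : a < T) (hfs : FreeStreaming α a EL ET B)
    (hd : DensityBounds R₀ P₀ t (f t)) (hR₀ : 0 ≤ R₀) (hC : KernelBound C)
    (ht : t ∈ Icc (1 / 2) a) :
    FieldDecay R₀ P₀ C t (EL t) ∧ FieldDecay R₀ P₀ C t (B t) := by
  have ht₀ : 0 < t := by linarith [ht.1]
  have htT : t ∈ Ioo 0 T := ⟨ht₀, ht.2.trans_lt ha⟩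
  have htT' : t ∈ Ico 0 T := Ioo_subset_Ico_self htT
  have hS := h.kernelSourceBounds hα₁ (h.decayingForce hα ha hfs) ha hd hR₀ hC ht
  obtain ⟨M, M', hL, -, hB⟩ := hfs.exists_fieldBounds hα ⟨ht₀.le, ht.2⟩
  exact ⟨hS.fieldBounds (h.differentiable_EL htT') (h.continuous_fderiv_EL htT') hL
      (h.EL_infty t htT') fun hθ hQ i => (h.abs_integral_EL_mul_bilaplacian_le htT' hθ hQ i).trans
        (mul_le_mul_of_nonneg_right (by norm_num) hQ.nonneg),
    hS.fieldBounds (h.differentiable_B htT') (h.continuous_fderiv_B htT') hB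
      (h.B_infty t htT') fun hθ hQ i => (h.abs_integral_B_mul_bilaplacian_le htT hθ hQ i).trans
        (mul_le_mul_of_nonneg_right (by norm_num) hQ.nonneg)⟩

lemma IsClassicalSolution.fieldDecay_ET_of_lt (h : IsClassicalSolution T f EL ET B)
    (hα : 0 ≤ α) (hα₁ : α ≤ 1) (ha : a < T) (hfs : FreeStreaming α a EL ET B)
    (hd : ∀ s ∈ Icc 0 a, DensityBounds R₀ P₀ s (f s)) (hR₀ : 0 ≤ R₀) (hC : KernelBound C)
    (ht : t ∈ Ico (1 / 2) a) : FieldDecay R₀ P₀ C t (ET t) := by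
  have ht₀ : t ∈ Ioo 0 a := ⟨by linarith [ht.1], ht.2⟩
  have htT : t ∈ Ico 0 T := ⟨ht₀.1.le, ht.2.trans ha⟩
  have hS := h.kernelSourceBounds hα₁ (h.decayingForce hα ha hfs) ha
    (hd t (Ioo_subset_Icc_self ht₀)) hR₀ hC (Ico_subset_Icc_self ht)
  obtain ⟨M, M', -, hT, -⟩ := hfs.exists_fieldBounds hα (Ioo_subset_Icc_self ht₀)
  obtain ⟨S, hcompact, hfS⟩ := exists_isCompact_of_densityBounds hd
  exact hS.fieldBounds (h.differentiable_ET t htT) (h.continuous_fderiv_ET htT) hT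
    (h.ET_infty t htT) fun hθ hQ i =>
      h.abs_integral_ET_mul_bilaplacian_le ha hcompact hfS ht₀ hθ hQ i

-- The bound on `ET` rests on a two-sided time derivative, so the end point `t = a` is a limit.
lemma IsClassicalSolution.fieldDecay_ET (h : IsClassicalSolution T f EL ET B)
    (hα : 0 ≤ α) (hα₁ : α ≤ 1) (ha : a < T) (hfs : FreeStreaming α a EL ET B)
    (hd : ∀ s ∈ Icc 0 a, DensityBounds R₀ P₀ s (f s)) (hR₀ : 0 ≤ R₀) (hC : KernelBound C)
    (ht : t ∈ Icc 1 a) : FieldDecay R₀ P₀ C t (ET t) := by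
  have hpast (s : ℝ) (hs : s ∈ Ico (1 / 2) t) : FieldDecay R₀ P₀ C s (ET s) :=
    h.fieldDecay_ET_of_lt hα hα₁ ha hfs hd hR₀ hC ⟨hs.1, hs.2.trans_le ht.2⟩
  have ht₂ : 1 / 2 < t := by linarith [ht.1]
  have htT : t < T := ht.2.trans_lt ha
  simp only [FieldDecay, ← mul_assoc] at hpast ⊢
  exact ⟨fun x => norm_le_const_mul_rpow_of_forall_lt h.continuousOn_ET (by norm_num) ht₂ htT
      fun s hs => (hpast s hs).norm_le x,
    fun x => norm_le_const_mul_rpow_of_forall_lt (F := fun s => fderiv ℝ (ET s))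
      h.continuousOn_fderiv_ET (by norm_num) ht₂ htT fun s hs => (hpast s hs).norm_fderiv_le x⟩

lemma IsClassicalSolution.fieldDecay (h : IsClassicalSolution T f EL ET B) (hα : 0 ≤ α)
    (hα₆ : α ≤ 1 / 6) (hαP : 36 * α ≤ monoConst (3 * (P₀ + 1)))
    (hI : LipschitzData R₀ P₀ (f 0)) (ha : a < T) (hfs : FreeStreaming α a EL ET B)
    (hR₀ : 0 ≤ R₀) (hC : KernelBound C) (ht : t ∈ Icc 1 a) :
    FieldDecay R₀ P₀ C t (ET t) ∧ FieldDecay R₀ P₀ C t (EL t) ∧ FieldDecay R₀ P₀ C t (B t) := by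
  have hα₁ : α ≤ 1 := by linarith
  have hd : ∀ s ∈ Icc 0 a, DensityBounds R₀ P₀ s (f s) := fun s hs =>
    h.densityBounds hα hα₆ hαP hI ha hfs hs
  exact ⟨h.fieldDecay_ET hα hα₁ ha hfs hd hR₀ hC ht,
    h.fieldDecay_EL_B hα hα₁ ha hfs (hd t ⟨zero_le_one.trans ht.1, ht.2⟩) hR₀ hC
      ⟨by linarith [ht.1], ht.2⟩⟩

end Decay

lemma supNorm_add_le {V : Type} [NormedAddCommGroup V] {F G H : E3 → V} {c : ℝ}
    (hF : ∀ x, ‖F x‖ ≤ c) (hG : ∀ x, ‖G x‖ ≤ c) (hH : ∀ x, ‖H x‖ ≤ c) :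
    supNorm F + supNorm G + supNorm H ≤ ENNReal.ofReal (3 * c) := by
  have hsup {J : E3 → V} (hJ : ∀ x, ‖J x‖ ≤ c) : supNorm J ≤ ENNReal.ofReal c :=
    iSup_le fun x => ofReal_norm (J x) ▸ ENNReal.ofReal_le_ofReal (hJ x)
  calc supNorm F + supNorm G + supNorm H
      ≤ ENNReal.ofReal c + ENNReal.ofReal c + ENNReal.ofReal c :=
        add_le_add_three (hsup hF) (hsup hG) (hsup hH)
    _ = 3 * ENNReal.ofReal c := by ring
    _ = ENNReal.ofReal (3 * c) := by rw [ENNReal.ofReal_mul zero_le_three, ENNReal.ofReal_ofNat]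

/-- The constant in the decay of the fields and of their gradients. -/
def decayConst (R₀ P₀ C : ℝ) : ℝ :=
  18 / Real.pi * fieldConst R₀ P₀ C + 54 / Real.pi * gradConst R₀ P₀ C + 1

lemma decayConst_pos {R₀ P₀ C : ℝ} (hR₀ : 0 ≤ R₀) (hC : 0 ≤ C) : 0 < decayConst R₀ P₀ C := by
  have hfield := fieldConst_nonneg (P₀ := P₀) hR₀ hC
  have hgrad := gradConst_nonneg (P₀ := P₀) hR₀ hC
  unfold decayConst
  positivity

lemma fieldNorm_le_and_gradFieldNorm_le {R₀ P₀ C t : ℝ} {EL ET B : ℝ → E3 → E3} (hR₀ : 0 ≤ R₀)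
    (hC : 0 ≤ C) (ht : 0 ≤ t) (hT : FieldDecay R₀ P₀ C t (ET t))
    (hL : FieldDecay R₀ P₀ C t (EL t)) (hB : FieldDecay R₀ P₀ C t (B t)) :
    fieldNorm EL ET B t ≤ ENNReal.ofReal (decayConst R₀ P₀ C * t ^ (-(9 / 5) : ℝ)) ∧
      gradFieldNorm EL ET B t ≤ ENNReal.ofReal (decayConst R₀ P₀ C * t ^ (-(8 / 3) : ℝ)) := by
  have hfield : 0 ≤ 18 / Real.pi * fieldConst R₀ P₀ C :=
    mul_nonneg (by positivity) (fieldConst_nonneg hR₀ hC)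
  have hgrad : 0 ≤ 54 / Real.pi * gradConst R₀ P₀ C :=
    mul_nonneg (by positivity) (gradConst_nonneg hR₀ hC)
  constructor
  · refine (supNorm_add_le hT.norm_le hL.norm_le hB.norm_le).trans (ENNReal.ofReal_le_ofReal ?_)
    calc _ = 18 / Real.pi * fieldConst R₀ P₀ C * t ^ (-(9 / 5) : ℝ) := by ring
      _ ≤ _ := mul_le_mul_of_nonneg_right (by rw [decayConst]; linarith) (Real.rpow_nonneg ht _)
  · refine (supNorm_add_le hT.norm_fderiv_le hL.norm_fderiv_le hB.norm_fderiv_le).trans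
      (ENNReal.ofReal_le_ofReal ?_)
    calc _ = 54 / Real.pi * gradConst R₀ P₀ C * t ^ (-(8 / 3) : ℝ) := by ring
      _ ≤ _ := mul_le_mul_of_nonneg_right (by rw [decayConst]; linarith) (Real.rpow_nonneg ht _)

end VlasovDarwin

end

theorem proposition2_general (R₀ P₀ : ℝ) (hR₀ : 0 ≤ R₀) :
    ∃ α C₂ : ℝ, 0 < α ∧ 0 < C₂ ∧
      ∀ (T : ℝ) (f : ℝ → VlasovDarwin.E3 → VlasovDarwin.E3 → ℝ)
        (EL ET B : ℝ → VlasovDarwin.E3 → VlasovDarwin.E3),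
        VlasovDarwin.IsClassicalSolution T f EL ET B →
        VlasovDarwin.LipschitzData R₀ P₀ (f 0) →
        ∀ a : ℝ, a < T → VlasovDarwin.FreeStreaming α a EL ET B →
          ∀ t ∈ Set.Icc 1 a,
            VlasovDarwin.fieldNorm EL ET B t ≤ ENNReal.ofReal (C₂ * t ^ (-(9 / 5) : ℝ)) ∧
            VlasovDarwin.gradFieldNorm EL ET B t ≤
              ENNReal.ofReal (C₂ * t ^ (-(8 / 3) : ℝ)) := by
  obtain ⟨C, hC⟩ := VlasovDarwin.exists_kernelBound
  set m := VlasovDarwin.monoConst (3 * (P₀ + 1))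
  have hm : 0 < m / 36 := div_pos (VlasovDarwin.monoConst_pos _) (by norm_num)
  have hα : 0 < min (1 / 6) (m / 36) := lt_min (by norm_num) hm
  have hαm : 36 * min (1 / 6) (m / 36) ≤ m := by linarith [min_le_right (1 / 6) (m / 36)]
  refine ⟨_, _, hα, VlasovDarwin.decayConst_pos (P₀ := P₀) hR₀ hC.nonneg,
    fun T f EL ET B h hf a ha hfs t ht => ?_⟩
  obtain ⟨hT, hL, hB⟩ :=
    h.fieldDecay hα.le (min_le_left _ _) hαm hf ha hfs hR₀ hC ht
  exact VlasovDarwin.fieldNorm_le_and_gradFieldNorm_le hR₀ hC.nonneg (zero_le_one.trans ht.1)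
    hT hL hB

theorem proposition2 (R₀ P₀ : ℝ) (hR₀ : 0 < R₀) (hP₀ : 0 < P₀) :
    ∃ α C₂ : ℝ, 0 < α ∧ 0 < C₂ ∧
      ∀ (T : ℝ) (f : ℝ → VlasovDarwin.E3 → VlasovDarwin.E3 → ℝ)
        (EL ET B : ℝ → VlasovDarwin.E3 → VlasovDarwin.E3),
        VlasovDarwin.IsClassicalSolution T f EL ET B →
        VlasovDarwin.InitialData R₀ P₀ (f 0) →
        ∀ a : ℝ, a < T → VlasovDarwin.FreeStreaming α a EL ET B →
          ∀ t ∈ Set.Icc 1 a,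
            VlasovDarwin.fieldNorm EL ET B t ≤ ENNReal.ofReal (C₂ * t ^ (-(9 / 5) : ℝ)) ∧
            VlasovDarwin.gradFieldNorm EL ET B t ≤
              ENNReal.ofReal (C₂ * t ^ (-(8 / 3) : ℝ)) := by
  obtain ⟨α, C₂, hα, hC₂, hdecay⟩ := proposition2_general R₀ P₀ hR₀.le
  exact ⟨α, C₂, hα, hC₂, fun T f EL ET B h hf => hdecay T f EL ET B h hf.lipschitzData⟩
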